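/- Let $\rho,q\in C^\infty[0,\infty)$ be real-valued with $\rho>0$ and $\int_0^\infty\rho^{1/2}(x)\,dx=\infty$; put $\tau(x)=\int_0^x\rho^{1/2}(s)\,ds$ and let $x(\cdot)$ be the inverse function of $\tau$ on $[0,\infty)$. Functions of time are extended by zero to $t<0$. For a smooth $f$ vanishing near $t=0$, consider the problem $$\rho u_{tt}-u_{xx}+qu=0\ (x,t>0),\qquad u|_{t=0}=u_t|_{t=0}=0,\qquad u|_{x=0}=f.$$ There is a function $w$, smooth in the closed wedge $\{0\le\tau(x)\le t\}$ (the regular part of the fundamental solution), such that for every such $f$ the classical smooth solution is $$u^f(x,t)=\Big[\tfrac{\rho(x)}{\rho(0)}\Big]^{-1/4}f(t-\tau(x))+\int_0^{t-\tau(x)}w(x,t-s)f(s)\,ds .\qquad(*)$$ For $f\in L_2$ the generalized solution $u^f$ is defined by $(*)$. Let $T>0$, $\mathcal F^{a}=L_2(0,a)$ and $\mathcal H^T=L_2((0,x(T));\rho\,dx)$. The formula $W^Tf=u^f(\cdot,T)$ defines a bounded control operator $W^T:\mathcal F^T\to\mathcal H^T$; let $C^T=(W^T)^*W^T$ be the connecting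 operator. Let $\widetilde R^{2T}f=u^f_x(0,\cdot)$ be the extended response operator in $\mathcal F^{2T}$ with domain $\{f\in H^1[0,2T]: f(0)=0\}$. With $\alpha=\rho^{1/2}(0)$, $\beta=-[4\rho(0)]^{-1}\rho'(0)$ and some $r\in C^\infty[0,2T]$ with $r(t)=w_x(0,t)$ for $0<t\le 2T$, it has the form $$(\widetilde R^{2T}f)(t)=-\alpha f'(t)+\beta f(t)+\int_0^t r(t-s)f(s)\,ds,\qquad 0<t<2T .$$ Let $S^T:\mathcal F^T\to\mathcal F^{2T}$ be given by $(S^Tf)(t)=f(t)$ for $0\le t\le T$ and $(S^Tf)(t)=-f(2T-t)$ for $T<t\le 2T$, and let $(J^{2T}f)(t)=\int_0^tf(s)\,ds$ in $\mathcal F^{2T}$. Then $J^{2T}S^T$ maps $\mathcal F^T$ into the domain of $\widetilde R^{2T}$, $$C^T=-\tfrac12\,(S^T)^*\,\widetilde R^{2T}J^{2T}S^T ,$$ and for every $f\in\mathcal F^T$ and almost every $t\in(0,T)$ $$(C^Tf)(t)=\alpha f(t)+\int_0^T\Big[\tfrac12\int_{|t-s|}^{2T-t-s}r(\eta)\,d\eta\Big]f(s)\,ds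 .$$ -/

import Mathlib

open MeasureTheory Set Filter Topology
open scoped ContDiff ENNReal

noncomputable section

namespace DirichletWave

/-! ### The forward problem -/

/-- The eikonal `τ(x) = ∫₀ˣ ρ^{1/2}(s) ds`. -/
def eikonal (ρ : ℝ → ℝ) (x : ℝ) : ℝ := ∫ s in (0 : ℝ)..x, ρ s ^ (1 / 2 : ℝ)

/-- `x(T)`: the inverse function, on the half-line `x ≥ 0`, of the eikonal. -/
def eikonalInv (ρ : ℝ → ℝ) (T : ℝ) : ℝ := Function.invFunOn (eikonal ρ) (Ici 0) T

/-- `u` is a classical smooth solution of `ρ u_tt - u_xx + q u = 0` for `x, t > 0` with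
`u = u_t = 0` at `t = 0` and `u = f` at `x = 0`.  It is smooth up to the boundary. -/
structure IsClassicalSolution (ρ q f : ℝ → ℝ) (u : ℝ → ℝ → ℝ) : Prop where
  smooth : ContDiffOn ℝ ∞ (fun p : ℝ × ℝ => u p.1 p.2) (Ici 0 ×ˢ Ici 0)
  wave_eq : ∀ x, 0 < x → ∀ t, 0 < t →
    ρ x * iteratedDeriv 2 (fun t' => u x t') t - iteratedDeriv 2 (fun x' => u x' t) x
      + q x * u x t = 0
  init : ∀ x, 0 ≤ x → u x 0 = 0
  init_vel : ∀ x, 0 ≤ x → derivWithin (fun t' => u x t') (Ici 0) 0 = 0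
  boundary : ∀ t, 0 ≤ t → u 0 t = f t

/-- The Duhamel expression
`[ρ(x)/ρ(0)]^{-1/4} f(t - τ(x)) + ∫₀^{t - τ(x)} w(x, t - s) f(s) ds`,
i.e. the convolution in time of `f` (which is to vanish for negative times) with
`[ρ(x)/ρ(0)]^{-1/4} δ(t - τ(x)) + w(x, t)`. -/
def wave (ρ : ℝ → ℝ) (w : ℝ → ℝ → ℝ) (f : ℝ → ℝ) (x t : ℝ) : ℝ :=
  (ρ x / ρ 0) ^ (-(1 / 4) : ℝ) * f (t - eikonal ρ x)
    + ∫ s in (0 : ℝ)..(t - eikonal ρ x), w x (t - s) * f s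

/-- `w` is the regular part of the fundamental solution
`u^δ(x, t) = [ρ(x)/ρ(0)]^{-1/4} δ(t - τ(x)) + w(x, t)` of the problem:  it is smooth in the
closed wedge `0 ≤ τ(x) ≤ t`, and `u^δ * f` is the classical solution for every smooth
control `f` which vanishes near `t = 0` (and, by convention, for negative times). -/
structure IsFundamentalKernel (ρ q : ℝ → ℝ) (w : ℝ → ℝ → ℝ) : Prop where
  smooth : ContDiffOn ℝ ∞ (fun p : ℝ × ℝ => w p.1 p.2)
    {p : ℝ × ℝ | 0 ≤ p.1 ∧ eikonal ρ p.1 ≤ p.2}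
  duhamel : ∀ f : ℝ → ℝ, ContDiff ℝ ∞ f → (∃ ε > 0, ∀ t ≤ ε, f t = 0) →
    IsClassicalSolution ρ q f (wave ρ w f)

/-! ### Outer and inner spaces -/

/-- The outer space `L₂(0, a)` of controls. -/
abbrev OuterSpace (a : ℝ) : Type := Lp ℝ 2 (volume.restrict (Ioo (0 : ℝ) a))

/-- The measure `ρ(x) dx` on `(0, x(T))`. -/
def innerMeasure (ρ : ℝ → ℝ) (T : ℝ) : Measure ℝ :=
  (volume.restrict (Ioo (0 : ℝ) (eikonalInv ρ T))).withDensity fun x => ENNReal.ofReal (ρ x)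

/-- The inner space `L_{2,ρ}(0, x(T))` of states. -/
abbrev InnerSpace (ρ : ℝ → ℝ) (T : ℝ) : Type := Lp ℝ 2 (innerMeasure ρ T)

/-- Extension by zero of a control on `(0, a)` to the whole time axis. -/
def zeroExt (a : ℝ) (f : OuterSpace a) : ℝ → ℝ := (Ioo (0 : ℝ) a).indicator f

/-- The continuous function `t ↦ ∫₀ᵗ g(s) ds` (with `g` extended by zero; it vanishes for
`t ≤ 0`). -/
def primitive (a : ℝ) (g : OuterSpace a) (t : ℝ) : ℝ := ∫ s in (0 : ℝ)..t, zeroExt a g s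

/-- `f ∈ H¹[0, a]`, `f(0) = 0` and `df/dt = g`, i.e. `f(t) = ∫₀ᵗ g(s) ds` on `(0, a)`. -/
def HasL2Deriv (a : ℝ) (f g : OuterSpace a) : Prop :=
  ∀ᵐ t ∂(volume.restrict (Ioo (0 : ℝ) a)), f t = primitive a g t

/-! ### The auxiliary operators -/

theorem zeroExt_congr {a : ℝ} {f : OuterSpace a} {h : ℝ → ℝ}
    (hf : f =ᵐ[volume.restrict (Ioo (0 : ℝ) a)] h) :
    zeroExt a f =ᵐ[volume] (Ioo (0 : ℝ) a).indicator h := by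
  have := (ae_restrict_iff' (measurableSet_Ioo (a := (0 : ℝ)) (b := a))).1 hf
  filter_upwards [this] with t ht
  by_cases h' : t ∈ Ioo (0 : ℝ) a
  · simp [zeroExt, h', ht h']
  · simp [zeroExt, h']

theorem integrable_zeroExt {a : ℝ} (f : OuterSpace a) : Integrable (zeroExt a f) :=
  (integrable_indicator_iff measurableSet_Ioo).2 ((Lp.memLp f).integrable (by norm_num))

theorem continuous_primitive {a : ℝ} (g : OuterSpace a) : Continuous (primitive a g) :=
  intervalIntegral.continuous_primitive (fun _ _ => (integrable_zeroExt g).intervalIntegrable) 0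

theorem memLp_primitive {a : ℝ} (g : OuterSpace a) :
    MemLp (primitive a g) 2 (volume.restrict (Ioo (0 : ℝ) a)) := by
  obtain ⟨C, hC⟩ := (isCompact_Icc (a := (0 : ℝ)) (b := a)).exists_bound_of_continuousOn
    (continuous_primitive g).continuousOn
  refine MemLp.of_bound (continuous_primitive g).aestronglyMeasurable C ?_
  refine (ae_restrict_iff' measurableSet_Ioo).2 (Eventually.of_forall fun t ht => ?_)
  exact hC t (Ioo_subset_Icc_self ht)

theorem primitive_add {a : ℝ} (f g : OuterSpace a) (t : ℝ) :
    primitive a (f + g) t = primitive a f t + primitive a g t := by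
  unfold primitive
  rw [← intervalIntegral.integral_add (integrable_zeroExt f).intervalIntegrable
    (integrable_zeroExt g).intervalIntegrable]
  refine intervalIntegral.integral_congr_ae ?_
  filter_upwards [zeroExt_congr (Lp.coeFn_add f g)] with s hs _
  rw [hs]
  by_cases h' : s ∈ Ioo (0 : ℝ) a <;> simp [zeroExt, h']

theorem primitive_smul {a : ℝ} (c : ℝ) (f : OuterSpace a) (t : ℝ) :
    primitive a (c • f) t = c * primitive a f t := by
  unfold primitive
  rw [← intervalIntegral.integral_const_mul]
  refine intervalIntegral.integral_congr_ae ?_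
  filter_upwards [zeroExt_congr (Lp.coeFn_smul c f)] with s hs _
  rw [hs]
  by_cases h' : s ∈ Ioo (0 : ℝ) a <;> simp [zeroExt, h']

/-- Integration in time `(J f)(t) = ∫₀ᵗ f(s) ds` as an operator in `L₂(0, a)`. -/
def integrationOp (a : ℝ) : OuterSpace a →ₗ[ℝ] OuterSpace a where
  toFun f := (memLp_primitive f).toLp (primitive a f)
  map_add' f g := by
    rw [← MemLp.toLp_add]
    exact MemLp.toLp_congr _ _ (Eventually.of_forall fun t => primitive_add f g t)
  map_smul' c f := by
    rw [RingHom.id_apply, ← MemLp.toLp_const_smul]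
    exact MemLp.toLp_congr _ _ (Eventually.of_forall fun t => primitive_smul c f t)

/-- `f(t)` for `t ≤ T` and `-f(2T - t)` for `t > T`. -/
def oddExtFun (T : ℝ) (f : ℝ → ℝ) (t : ℝ) : ℝ := if t ≤ T then f t else -f (2 * T - t)

/-- The folding `t ↦ t` for `t ≤ T`, `t ↦ 2T - t` for `t > T`. -/
def fold (T t : ℝ) : ℝ := if t ≤ T then t else 2 * T - t

theorem measurable_fold (T : ℝ) : Measurable (fold T) :=
  Measurable.ite measurableSet_Iic measurable_id (measurable_const.sub measurable_id)

theorem map_fold_le (T : ℝ) :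
    (volume.restrict (Ioo (0 : ℝ) (2 * T))).map (fold T)
      ≤ (2 : ℝ≥0∞) • volume.restrict (Ioo (0 : ℝ) T) := by
  refine Measure.le_iff.2 fun s hs => ?_
  rw [Measure.map_apply (measurable_fold T) hs, Measure.smul_apply,
    Measure.restrict_apply (measurable_fold T hs), Measure.restrict_apply hs]
  have hsub : fold T ⁻¹' s ∩ Ioo 0 (2 * T) ⊆
      (s ∩ Ioo 0 T) ∪ ((fun t => 2 * T - t) ⁻¹' (s ∩ Ioo 0 T) ∪ {T}) := by
    rintro t ⟨h1, h2, h3⟩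
    by_cases h : t = T
    · right; right; exact h
    · by_cases h' : t ≤ T
      · left
        exact ⟨by simpa [fold, h'] using h1, h2, lt_of_le_of_ne h' h⟩
      · right; left
        refine ⟨by simpa [fold, h'] using h1, ?_, ?_⟩
        · linarith
        · linarith [not_le.1 h']
  have hm : volume ((fun t : ℝ => 2 * T - t) ⁻¹' (s ∩ Ioo 0 T)) = volume (s ∩ Ioo 0 T) :=
    (Measure.measurePreserving_sub_left (volume : Measure ℝ) (2 * T)).measure_preimage
      (hs.inter measurableSet_Ioo).nullMeasurableSet
  calc _ ≤ volume (s ∩ Ioo 0 T) +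
        (volume ((fun t : ℝ => 2 * T - t) ⁻¹' (s ∩ Ioo 0 T)) + volume {T}) :=
        (measure_mono hsub).trans
          ((measure_union_le _ _).trans (add_le_add le_rfl (measure_union_le _ _)))
    _ = _ := by rw [hm]; simp [two_mul]

theorem quasi_fold (T : ℝ) : Measure.QuasiMeasurePreserving (fold T)
    (volume.restrict (Ioo (0 : ℝ) (2 * T))) (volume.restrict (Ioo (0 : ℝ) T)) :=
  ⟨measurable_fold T, (map_fold_le T).absolutelyContinuous.trans
    (Measure.AbsolutelyContinuous.rfl.smul_left _)⟩

theorem oddExtFun_eq (T : ℝ) (f : ℝ → ℝ) :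
    oddExtFun T f = fun t => (if t ≤ T then (1 : ℝ) else -1) * f (fold T t) := by
  funext t
  by_cases h : t ≤ T <;> simp [oddExtFun, fold, h]

theorem eLpNorm_oddExtFun_le {T : ℝ} {f : ℝ → ℝ}
    (hf : MemLp f 2 (volume.restrict (Ioo (0 : ℝ) T))) :
    eLpNorm (oddExtFun T f) 2 (volume.restrict (Ioo (0 : ℝ) (2 * T)))
      ≤ 2 * eLpNorm f 2 (volume.restrict (Ioo (0 : ℝ) T)) := by
  have hf2 : AEStronglyMeasurable f ((volume.restrict (Ioo (0 : ℝ) (2 * T))).map (fold T)) :=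
    hf.1.mono_ac (quasi_fold T).absolutelyContinuous
  calc eLpNorm (oddExtFun T f) 2 (volume.restrict (Ioo (0 : ℝ) (2 * T)))
      = eLpNorm (f ∘ fold T) 2 (volume.restrict (Ioo (0 : ℝ) (2 * T))) := by
        refine eLpNorm_congr_norm_ae (Eventually.of_forall fun t => ?_)
        by_cases h : t ≤ T <;> simp [oddExtFun, fold, h]
    _ = eLpNorm f 2 ((volume.restrict (Ioo (0 : ℝ) (2 * T))).map (fold T)) :=
        (eLpNorm_map_measure hf2 (measurable_fold T).aemeasurable).symm
    _ ≤ eLpNorm f 2 ((2 : ℝ≥0∞) • volume.restrict (Ioo (0 : ℝ) T)) :=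
        eLpNorm_mono_measure _ (map_fold_le T)
    _ = (2 : ℝ≥0∞) ^ (1 / (2 : ℝ)) * eLpNorm f 2 (volume.restrict (Ioo (0 : ℝ) T)) := by
        rw [eLpNorm_smul_measure_of_ne_top (by norm_num)]
        simp
    _ ≤ 2 * eLpNorm f 2 (volume.restrict (Ioo (0 : ℝ) T)) := by
        gcongr
        calc (2 : ℝ≥0∞) ^ (1 / (2 : ℝ)) ≤ (2 : ℝ≥0∞) ^ (1 : ℝ) :=
              ENNReal.rpow_le_rpow_of_exponent_le (by norm_num) (by norm_num)
          _ = 2 := ENNReal.rpow_one 2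

theorem memLp_oddExtFun {T : ℝ} {f : ℝ → ℝ}
    (hf : MemLp f 2 (volume.restrict (Ioo (0 : ℝ) T))) :
    MemLp (oddExtFun T f) 2 (volume.restrict (Ioo (0 : ℝ) (2 * T))) := by
  refine ⟨?_, (eLpNorm_oddExtFun_le hf).trans_lt (ENNReal.mul_lt_top (by norm_num) hf.2)⟩
  rw [oddExtFun_eq]
  exact (Measurable.ite measurableSet_Iic measurable_const
    measurable_const).aestronglyMeasurable.mul (hf.1.comp_quasiMeasurePreserving (quasi_fold T))

/-- The operator `S : L₂(0, T) → L₂(0, 2T)`, `(S f)(t) = f(t)` for `0 ≤ t ≤ T` and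
`(S f)(t) = -f(2T - t)` for `T < t ≤ 2T`. -/
def oddExt (T : ℝ) : OuterSpace T →L[ℝ] OuterSpace (2 * T) :=
  LinearMap.mkContinuous
    { toFun := fun f => (memLp_oddExtFun (Lp.memLp f)).toLp (oddExtFun T f)
      map_add' := fun f g => by
        rw [← MemLp.toLp_add]
        refine MemLp.toLp_congr _ _ ?_
        filter_upwards [(quasi_fold T).ae_eq_comp (Lp.coeFn_add f g)] with t ht
        simp only [oddExtFun_eq, Pi.add_apply, Function.comp_apply] at ht ⊢
        rw [ht]; ring
      map_smul' := fun c f => by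
        rw [RingHom.id_apply, ← MemLp.toLp_const_smul]
        refine MemLp.toLp_congr _ _ ?_
        filter_upwards [(quasi_fold T).ae_eq_comp (Lp.coeFn_smul c f)] with t ht
        simp only [oddExtFun_eq, Pi.smul_apply, Function.comp_apply, smul_eq_mul] at ht ⊢
        rw [ht]; ring }
    2 (fun f => by
      simp only [LinearMap.coe_mk, AddHom.coe_mk, Lp.norm_def]
      rw [eLpNorm_congr_ae (MemLp.coeFn_toLp _)]
      have h := ENNReal.toReal_mono (ENNReal.mul_ne_top (by norm_num) (Lp.memLp f).2.ne)
        (eLpNorm_oddExtFun_le (Lp.memLp f))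
      simpa [ENNReal.toReal_mul] using h)

/-! ### The operators of the Dirichlet system -/

/-- `W` is the control operator `W f = u^f(·, T)` of the system, where `w` is the regular part
of the fundamental solution. -/
def IsControlOp (ρ : ℝ → ℝ) (w : ℝ → ℝ → ℝ) (T : ℝ)
    (W : OuterSpace T →L[ℝ] InnerSpace ρ T) : Prop :=
  ∀ f : OuterSpace T, ∀ᵐ x ∂(innerMeasure ρ T), W f x = wave ρ w (zeroExt T f) x T

/-- The connecting operator `C = W* W`. -/
def connectingOp {ρ : ℝ → ℝ} {T : ℝ} (W : OuterSpace T →L[ℝ] InnerSpace ρ T) :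
    OuterSpace T →L[ℝ] OuterSpace T :=
  (ContinuousLinearMap.adjoint W).comp W

/-- `R` is the extended response operator in `L₂(0, 2T)`, with domain
`{f ∈ H¹[0, 2T] | f(0) = 0}` and `R f = u^f_x(0, ·)` (the derivative at `x = 0` being from the
right).  The wave is evaluated at the continuous representative of `f`, and only its values at
points `0 ≤ τ(x) ≤ t < 2T - τ(x)` matter. -/
structure IsExtendedResponseOp (ρ : ℝ → ℝ) (w : ℝ → ℝ → ℝ) (T : ℝ)
    (R : OuterSpace (2 * T) →ₗ.[ℝ] OuterSpace (2 * T)) : Prop where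
  mem_domain : ∀ f, f ∈ R.domain ↔ ∃ g, HasL2Deriv (2 * T) f g
  apply_eq : ∀ (f : R.domain) (g : OuterSpace (2 * T)), HasL2Deriv (2 * T) f g →
    ∀ᵐ t ∂(volume.restrict (Ioo (0 : ℝ) (2 * T))),
      HasDerivWithinAt (fun x => wave ρ w (primitive (2 * T) g) x t) (R f t) (Ici 0) 0

/-- `r ∈ C^∞[0, 2T]` is the kernel of the operator `R`:
`(R f)(t) = -α f'(t) + β f(t) + ∫₀ᵗ r(t - s) f(s) ds` on `(0, 2T)`, where `α = ρ^{1/2}(0)` and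
`β = -[4 ρ(0)]⁻¹ ρ'(0)`. -/
structure IsResponseKernel (ρ : ℝ → ℝ) (T : ℝ)
    (R : OuterSpace (2 * T) →ₗ.[ℝ] OuterSpace (2 * T)) (r : ℝ → ℝ) : Prop where
  smooth : ContDiffOn ℝ ∞ r (Icc 0 (2 * T))
  apply_eq : ∀ (f : R.domain) (g : OuterSpace (2 * T)), HasL2Deriv (2 * T) f g →
    ∀ᵐ t ∂(volume.restrict (Ioo (0 : ℝ) (2 * T))),
      R f t = -(ρ 0 ^ (1 / 2 : ℝ)) * g t
        + (-(4 * ρ 0)⁻¹ * derivWithin ρ (Ici 0) 0) * (f : OuterSpace (2 * T)) t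
        + ∫ s in (0 : ℝ)..t, r (t - s) * (f : OuterSpace (2 * T)) s

end DirichletWave

end

/-!
The Liouville substitution `u(x, t) = [ρ(x)/ρ(0)]^{-1/4} v(τ(x), t)` turns the wave equation into
`v_tt - v_yy + Q v = 0` on the half-line `y ≥ 0` (`wave_eq_of_reduced`).  In the characteristic
variables `ξ = t - y`, `η = t + y` this is `v_ξη = -¼ Q((η - ξ)/2) v`.  The wave generated by a
control `f` is `f(ξ) + ∫₀^ξ K(ξ - s, η - s) f(s) ds`, where `K` solves a Goursat problem and is the
sum of a Picard series.  The potential `Q` is smooth on `[0, ∞)` only.  On the wedge `0 ≤ ξ ≤ η` the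
kernel `K` depends on `Q` on `[0, ∞)` alone (`goursatKernel_congr`), so its smoothness up to the
boundary of the wedge follows from extensions of `Q` of class `C^n` to the whole line, one for each
`n`.  This gives the regular part `w` of the fundamental solution (`exists_fundamentalKernel`).

For an arbitrary fundamental kernel `w`, the boundary condition forces `w(0, ·) = 0`
(`kernel_boundary`).  Hence `|w(x, t)| ≤ L x`, the Duhamel integral of a merely continuous control is
differentiable in `x` at `x = 0`, and the response of the system is `-α F' + β F + r * F` with
`r(t) = w_x(0, t)` (`hasDerivWithinAt_wave`).

The connecting operator is found from Green's identity.  Let `f`, `g` be test functions on `(0, T)`,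
and let `F = J S f`; as `S f` is odd with respect to `t = T`, the function `F` is even.  The
difference `u^F(x, t) - u^F(x, 2T - t)` solves the wave equation, vanishes at `x = 0`, and at `t = T`
it is zero with the velocity `2 u^F_t = 2 u^f`.  Integrating it against `u^g` over
`(0, x(T)) × (0, T)` gives
`(W f, W g) = -½ ∫₀ᵀ [(R F)(t) - (R F)(2T - t)] g(t) dt` (`integral_wave_mul_wave`), which is
`-½ (S* R J S f, g)`.  The formula for `R` and an integration by parts show that the bracket is
`-2 (α f(t) + ∫₀ᵀ [½ ∫_{|t - s|}^{2T - t - s} r] f(s) ds)` (`responseFun_sub_reflect`).  The two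
expressions for `C` extend from test functions to `L₂(0, T)` since all operators are bounded
(`connectingOp_eq`); the second computation holds verbatim for `f ∈ L₂(0, T)`
(`adjoint_oddExt_response`).
-/

namespace DirichletWave

/-! ### Smooth functions on half-lines and integrals depending on parameters -/

/-- A function of class `C^n` on `[0, ∞)` extends to a function of class `C^n` on the line: extend
the derivative, and integrate. -/
theorem exists_contDiff_extension (n : ℕ) : ∀ {f : ℝ → ℝ}, ContDiffOn ℝ n f (Ici 0) →
    ∃ g : ℝ → ℝ, ContDiff ℝ n g ∧ EqOn g f (Ici 0) := by
  induction n with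
  | zero =>
    intro f hf
    refine ⟨fun x => f (max x 0), ?_, fun x hx => by simp [max_eq_left (show (0:ℝ) ≤ x from hx)]⟩
    have hf' : ContinuousOn f (Ici 0) := hf.continuousOn
    exact contDiff_zero.2
      (hf'.comp_continuous (continuous_id.max continuous_const) fun x => mem_Ici.2 (le_max_right _ _))
  | succ n ih =>
    intro f hf
    have hu : UniqueDiffOn ℝ (Ici (0 : ℝ)) := uniqueDiffOn_Ici 0
    have h1 : ContDiffOn ℝ n (derivWithin f (Ici 0)) (Ici 0) :=
      hf.derivWithin hu (by norm_cast)
    obtain ⟨g, hg, hgf⟩ := ih h1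
    refine ⟨fun x => f 0 + ∫ s in (0 : ℝ)..x, g s, ?_, fun x hx => ?_⟩
    · have hd : ∀ x, HasDerivAt (fun x => f 0 + ∫ s in (0 : ℝ)..x, g s) (g x) x := fun x =>
        (hg.continuous.integral_hasStrictDerivAt 0 x).hasDerivAt.const_add _
      have : ContDiff ℝ ((n : WithTop ℕ∞) + 1) (fun x => f 0 + ∫ s in (0 : ℝ)..x, g s) := by
        rw [contDiff_succ_iff_deriv]
        refine ⟨fun x => (hd x).differentiableAt, by simp, ?_⟩
        rwa [show deriv (fun x => f 0 + ∫ s in (0 : ℝ)..x, g s) = g from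
          funext fun x => (hd x).deriv]
      exact_mod_cast this
    · have hx' : (0 : ℝ) ≤ x := hx
      have hfd : DifferentiableOn ℝ f (Ici 0) := hf.differentiableOn (by simp)
      have : ∫ s in (0 : ℝ)..x, g s = f x - f 0 := by
        refine intervalIntegral.integral_eq_sub_of_hasDerivAt_of_le hx'
          (hf.continuousOn.mono Icc_subset_Ici_self) (fun s hs => ?_)
          (hg.continuous.intervalIntegrable _ _)
        have hs0 : s ∈ Ici (0 : ℝ) := le_of_lt hs.1
        rw [hgf hs0]
        exact ((hfd s hs0).hasDerivWithinAt).hasDerivAt (Ici_mem_nhds hs.1)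
      simp only [this]; ring

section Parametric

variable {E : Type} [NormedAddCommGroup E] [NormedSpace ℝ E]

/-- Leibniz's rule for `(x, b) ↦ ∫₀ᵇ G(x, s) ds`. -/
theorem hasStrictFDerivAt_parametric_primitive [FiniteDimensional ℝ E] {F : Type}
    [NormedAddCommGroup F]
    [NormedSpace ℝ F] [CompleteSpace F] {G : E × ℝ → F} (hG : ContDiff ℝ 1 G) (p : E × ℝ) :
    HasStrictFDerivAt (fun p : E × ℝ => ∫ s in (0 : ℝ)..p.2, G (p.1, s))
      ((∫ s in (0 : ℝ)..p.2, (fderiv ℝ G (p.1, s)).comp (ContinuousLinearMap.inl ℝ E ℝ)).coprod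
        (ContinuousLinearMap.toSpanSingleton ℝ (G p))) p := by
  have hGc : Continuous G := hG.continuous
  have hG' : Continuous (fun p : E × ℝ =>
      (fderiv ℝ G p).comp (ContinuousLinearMap.inl ℝ E ℝ)) :=
    (hG.continuous_fderiv (by simp)).clm_comp continuous_const
  have h := hasStrictFDerivAt_uncurry_coprod (𝕜 := ℝ) (u := p)
    (f := fun (x : E) (b : ℝ) => ∫ s in (0 : ℝ)..b, G (x, s))
    (f₁ := fun x b => ∫ s in (0 : ℝ)..b,
      (fderiv ℝ G (x, s)).comp (ContinuousLinearMap.inl ℝ E ℝ))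
    (f₂ := fun x b => ContinuousLinearMap.toSpanSingleton ℝ (G (x, b)))
    (Eventually.of_forall fun v => ?_) (Eventually.of_forall fun v => ?_) ?_ ?_
  · exact h
  · obtain ⟨C, hC⟩ := ((isCompact_closedBall v.1 1).prod
      (isCompact_uIcc (a := (0 : ℝ)) (b := v.2))).exists_bound_of_continuousOn hG'.continuousOn
    refine intervalIntegral.hasFDerivAt_integral_of_dominated_of_fderiv_le
      (F' := fun x s => (fderiv ℝ G (x, s)).comp (ContinuousLinearMap.inl ℝ E ℝ))
      (bound := fun _ => C) (Metric.ball_mem_nhds v.1 one_pos)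
      (Eventually.of_forall fun x => ?_) ?_ ?_ ?_ (by simp) ?_
    · exact (hGc.comp (by fun_prop)).aestronglyMeasurable
    · exact (hGc.comp (by fun_prop)).intervalIntegrable _ _
    · exact (hG'.comp (by fun_prop : Continuous fun s : ℝ => (v.1, s))).aestronglyMeasurable
    · refine Eventually.of_forall fun s hs x hx => hC (x, s)
        ⟨Metric.ball_subset_closedBall hx, uIoc_subset_uIcc hs⟩
    · refine Eventually.of_forall fun s hs x hx => ?_
      exact ((hG.differentiable (by simp) (x, s)).hasFDerivAt).comp x
        ((hasFDerivAt_id x).prodMk (hasFDerivAt_const s x))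
  · refine HasDerivAt.hasFDerivAt ?_
    have hc : Continuous fun s : ℝ => G (v.1, s) := hGc.comp (by fun_prop)
    exact (hc.integral_hasStrictDerivAt 0 _).hasDerivAt
  · exact (intervalIntegral.continuous_parametric_primitive_of_continuous
      (f := fun x s => (fderiv ℝ G (x, s)).comp (ContinuousLinearMap.inl ℝ E ℝ)) hG').continuousAt
  · exact ((ContinuousLinearMap.toSpanSingletonCLE (𝕜 := ℝ) (E := F)).continuous.comp
      hGc).continuousAt

theorem contDiff_parametric_primitive [FiniteDimensional ℝ E] (n : ℕ) :
    ∀ {F : Type} [NormedAddCommGroup F]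
    [NormedSpace ℝ F] [CompleteSpace F] {G : E × ℝ → F}, ContDiff ℝ n G →
    ContDiff ℝ n (fun p : E × ℝ => ∫ s in (0 : ℝ)..p.2, G (p.1, s)) := by
  induction n with
  | zero =>
    intro F _ _ _ G hG
    exact contDiff_zero.2 (intervalIntegral.continuous_parametric_primitive_of_continuous
      (f := fun x s => G (x, s)) hG.continuous)
  | succ n ih =>
    intro F _ _ _ G hG
    have hG1 : ContDiff ℝ 1 G := hG.of_le (by norm_cast; omega)
    have hG' : ContDiff ℝ n (fun p : E × ℝ =>
        (fderiv ℝ G p).comp (ContinuousLinearMap.inl ℝ E ℝ)) :=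
      (hG.fderiv_right (by norm_cast)).clm_comp contDiff_const
    push_cast
    rw [contDiff_succ_iff_hasFDerivAt]
    refine ⟨_, ?_, fun p => (hasStrictFDerivAt_parametric_primitive hG1 p).hasFDerivAt⟩
    have h2 : ContDiff ℝ n fun p : E × ℝ => ContinuousLinearMap.toSpanSingleton ℝ (G p) :=
      (ContinuousLinearMap.toSpanSingletonCLE (𝕜 := ℝ) (E := F)).contDiff.comp
        (hG.of_le (by norm_cast; omega))
    have h1 := ih hG'
    have : ContDiff ℝ n fun p : E × ℝ =>
      (∫ s in (0 : ℝ)..p.2, (fderiv ℝ G (p.1, s)).comp (ContinuousLinearMap.inl ℝ E ℝ)).comp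
          (ContinuousLinearMap.fst ℝ E ℝ)
        + (ContinuousLinearMap.toSpanSingleton ℝ (G p)).comp
          (ContinuousLinearMap.snd ℝ E ℝ) :=
      (h1.clm_comp contDiff_const).add (h2.clm_comp contDiff_const)
    convert this using 2 with p
    ext <;> simp

/-- Leibniz's rule for a moving upper end point and a scalar parameter. -/
theorem hasDerivAt_parametric_integral {G G' : ℝ × ℝ → ℝ} (hG : ContDiff ℝ 1 G)
    (hG' : ∀ x s, HasDerivAt (fun x => G (x, s)) (G' (x, s)) x) {b : ℝ → ℝ} {b' x : ℝ}
    (hb : HasDerivAt b b' x) :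
    HasDerivAt (fun x => ∫ s in (0 : ℝ)..b x, G (x, s))
      ((∫ s in (0 : ℝ)..b x, G' (x, s)) + b' * G (x, b x)) x := by
  have h := (hasStrictFDerivAt_parametric_primitive hG (x, b x)).hasFDerivAt
  have hc : HasDerivAt (fun x => (x, b x)) (1, b') x := (hasDerivAt_id x).prodMk hb
  have h2 := h.comp_hasDerivAt x hc
  have hcont : Continuous (fun s : ℝ =>
      (fderiv ℝ G (x, s)).comp (ContinuousLinearMap.inl ℝ ℝ ℝ)) :=
    ((hG.continuous_fderiv (by simp)).comp (by fun_prop)).clm_comp continuous_const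
  refine h2.congr_deriv ?_
  symm
  rw [ContinuousLinearMap.coprod_apply, ContinuousLinearMap.intervalIntegral_apply
    (hcont.intervalIntegrable _ _)]
  congr 1
  refine intervalIntegral.integral_congr fun s _ => ?_
  have h3 : HasDerivAt (fun x => G (x, s)) (fderiv ℝ G (x, s) (1, 0)) x :=
    ((hG.differentiable (by simp) (x, s)).hasFDerivAt).comp_hasDerivAt x
      ((hasDerivAt_id x).prodMk (hasDerivAt_const x s))
  simpa using (hG' x s).unique h3

end Parametric

/-- The double primitive `∫₀^ξ ∫₀^η G`. -/
noncomputable def doublePrimitive (G : ℝ × ℝ → ℝ) (p : ℝ × ℝ) : ℝ :=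
  ∫ s in (0 : ℝ)..p.1, ∫ r in (0 : ℝ)..p.2, G (s, r)

theorem doublePrimitive_swap {G : ℝ × ℝ → ℝ} (hG : Continuous G) (p : ℝ × ℝ) :
    doublePrimitive G p = ∫ r in (0 : ℝ)..p.2, ∫ s in (0 : ℝ)..p.1, G (s, r) := by
  refine intervalIntegral_intervalIntegral_swap (F := fun s r => G (s, r)) ?_
  exact (hG.continuousOn.integrableOn_compact
    (isCompact_uIcc.prod isCompact_uIcc)).mono_set (prod_mono uIoc_subset_uIcc uIoc_subset_uIcc)

theorem continuous_integral_fst {G : ℝ × ℝ → ℝ} (hG : Continuous G) :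
    Continuous fun p : ℝ × ℝ => ∫ s in (0 : ℝ)..p.1, G (s, p.2) :=
  intervalIntegral.continuous_parametric_intervalIntegral_of_continuous
      (f := fun (p : ℝ × ℝ) s => G (s, p.2)) (hG.comp (by fun_prop)) continuous_fst

theorem continuous_integral_snd {G : ℝ × ℝ → ℝ} (hG : Continuous G) :
    Continuous fun p : ℝ × ℝ => ∫ r in (0 : ℝ)..p.2, G (p.1, r) :=
  intervalIntegral.continuous_parametric_intervalIntegral_of_continuous
      (f := fun (p : ℝ × ℝ) r => G (p.1, r)) (hG.comp (by fun_prop)) continuous_snd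

theorem hasStrictFDerivAt_doublePrimitive {G : ℝ × ℝ → ℝ} (hG : Continuous G) (p : ℝ × ℝ) :
    HasStrictFDerivAt (doublePrimitive G)
      ((ContinuousLinearMap.toSpanSingleton ℝ (∫ r in (0 : ℝ)..p.2, G (p.1, r))).coprod
        (ContinuousLinearMap.toSpanSingleton ℝ (∫ s in (0 : ℝ)..p.1, G (s, p.2)))) p := by
  have c1 := continuous_integral_fst hG
  have c2 := continuous_integral_snd hG
  refine hasStrictFDerivAt_uncurry_coprod (𝕜 := ℝ) (u := p)
    (f := fun x y => doublePrimitive G (x, y))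
    (f₁ := fun x y => ContinuousLinearMap.toSpanSingleton ℝ (∫ r in (0 : ℝ)..y, G (x, r)))
    (f₂ := fun x y => ContinuousLinearMap.toSpanSingleton ℝ (∫ s in (0 : ℝ)..x, G (s, y)))
    (Eventually.of_forall fun v => ?_) (Eventually.of_forall fun v => ?_) ?_ ?_
  · have hc : Continuous fun s : ℝ => ∫ r in (0 : ℝ)..v.2, G (s, r) :=
      c2.comp (by fun_prop : Continuous fun s : ℝ => (s, v.2))
    exact (hc.integral_hasStrictDerivAt 0 _).hasDerivAt.hasFDerivAt
  · have hc : Continuous fun r : ℝ => ∫ s in (0 : ℝ)..v.1, G (s, r) :=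
      c1.comp (by fun_prop : Continuous fun r : ℝ => (v.1, r))
    simp only [doublePrimitive_swap hG]
    exact (hc.integral_hasStrictDerivAt 0 _).hasDerivAt.hasFDerivAt
  · exact ((ContinuousLinearMap.toSpanSingletonCLE (𝕜 := ℝ) (E := ℝ)).continuous.comp
      c2).continuousAt
  · exact ((ContinuousLinearMap.toSpanSingletonCLE (𝕜 := ℝ) (E := ℝ)).continuous.comp
      c1).continuousAt

/-- The double primitive gains one derivative. -/
theorem contDiff_doublePrimitive {n : ℕ} {G : ℝ × ℝ → ℝ} (hG : ContDiff ℝ n G) :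
    ContDiff ℝ (n + 1) (doublePrimitive G) := by
  rw [contDiff_succ_iff_hasFDerivAt]
  refine ⟨_, ?_, fun p => (hasStrictFDerivAt_doublePrimitive hG.continuous p).hasFDerivAt⟩
  have h1 : ContDiff ℝ n fun p : ℝ × ℝ => ∫ r in (0 : ℝ)..p.2, G (p.1, r) :=
    contDiff_parametric_primitive n hG
  have h2 : ContDiff ℝ n fun p : ℝ × ℝ => ∫ s in (0 : ℝ)..p.1, G (s, p.2) :=
    (contDiff_parametric_primitive n (G := fun z : ℝ × ℝ => G (z.2, z.1))
      (hG.comp (contDiff_snd.prodMk contDiff_fst))).comp (contDiff_snd.prodMk contDiff_fst)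
  have e := (ContinuousLinearMap.toSpanSingletonCLE (𝕜 := ℝ) (E := ℝ)).contDiff (n := n)
  have : ContDiff ℝ n fun p : ℝ × ℝ =>
      (ContinuousLinearMap.toSpanSingleton ℝ (∫ r in (0 : ℝ)..p.2, G (p.1, r))).comp
          (ContinuousLinearMap.fst ℝ ℝ ℝ)
        + (ContinuousLinearMap.toSpanSingleton ℝ (∫ s in (0 : ℝ)..p.1, G (s, p.2))).comp
          (ContinuousLinearMap.snd ℝ ℝ ℝ) :=
    ((e.comp h1).clm_comp contDiff_const).add ((e.comp h2).clm_comp contDiff_const)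
  convert this using 2 with p
  ext <;> simp

/-! ### The Goursat problem for the reduced equation -/

/-- The potential of the reduced wave equation in the characteristic variables
`ξ = t - y`, `η = t + y`. -/
noncomputable def charPotential (Q : ℝ → ℝ) (p : ℝ × ℝ) : ℝ := -(1 / 4) * Q ((p.2 - p.1) / 2)

/-- The data `-½ ∫₀^{η/2} Q` of the Goursat problem on the characteristic `ξ = 0`. -/
noncomputable def goursatData (Q : ℝ → ℝ) (z : ℝ) : ℝ := -(1 / 2) * ∫ s in (0 : ℝ)..z / 2, Q s

/-- The Picard iterates of the integral equation `goursatKernel_eq`, which is equivalent to the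
Goursat problem.  They are defined on the whole plane, with oriented integrals. -/
noncomputable def goursatTerm (Q : ℝ → ℝ) : ℕ → ℝ × ℝ → ℝ
  | 0 => fun p => goursatData Q p.2 - goursatData Q p.1
  | j + 1 => fun p => ∫ s in (0 : ℝ)..p.1, ∫ r in p.1..p.2,
      charPotential Q (s, r) * goursatTerm Q j (s, r)

/-- The solution `K` of the Goursat problem `K_ξη = -¼ Q((η - ξ)/2) K`,
`K(0, η) = -½ ∫₀^{η/2} Q`, `K(ξ, ξ) = 0`. -/
noncomputable def goursatKernel (Q : ℝ → ℝ) (p : ℝ × ℝ) : ℝ := ∑' j, goursatTerm Q j p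

section

variable {Q : ℝ → ℝ}

theorem continuous_charPotential (hQ : Continuous Q) : Continuous (charPotential Q) := by
  unfold charPotential; fun_prop

theorem contDiff_charPotential {n : ℕ} (hQ : ContDiff ℝ n Q) :
    ContDiff ℝ n (charPotential Q) := by
  unfold charPotential; fun_prop

theorem hasDerivAt_goursatData (hQ : Continuous Q) (z : ℝ) :
    HasDerivAt (goursatData Q) (-(1 / 4) * Q (z / 2)) z := by
  have h := ((hQ.integral_hasStrictDerivAt 0 (z / 2)).hasDerivAt.comp z
    ((hasDerivAt_id z).div_const 2)).const_mul (-(1 / 2))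
  refine h.congr_deriv ?_
  ring

theorem contDiff_goursatData {n : ℕ} (hQ : ContDiff ℝ n Q) :
    ContDiff ℝ (n + 1) (goursatData Q) := by
  rw [contDiff_succ_iff_deriv]
  refine ⟨fun z => (hasDerivAt_goursatData hQ.continuous z).differentiableAt, by simp, ?_⟩
  rw [show deriv (goursatData Q) = fun z => -(1 / 4) * Q (z / 2) from
    funext fun z => (hasDerivAt_goursatData hQ.continuous z).deriv]
  fun_prop

theorem continuous_goursatData (hQ : Continuous Q) : Continuous (goursatData Q) :=
  continuous_iff_continuousAt.2 fun z => (hasDerivAt_goursatData hQ z).continuousAt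

theorem integral_sector_eq_doublePrimitive {G : ℝ × ℝ → ℝ} (hG : Continuous G) (p : ℝ × ℝ) :
    ∫ s in (0 : ℝ)..p.1, ∫ r in p.1..p.2, G (s, r)
      = doublePrimitive G p - doublePrimitive G (p.1, p.1) := by
  have hc : ∀ s : ℝ, Continuous fun r => G (s, r) := fun s => hG.comp (by fun_prop)
  have hi : ∀ z : ℝ, Continuous fun s : ℝ => ∫ r in (0 : ℝ)..z, G (s, r) := fun z =>
    (continuous_integral_snd hG).comp (by fun_prop : Continuous fun s : ℝ => (s, z))
  unfold doublePrimitive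
  rw [← intervalIntegral.integral_sub ((hi _).intervalIntegrable _ _)
    ((hi _).intervalIntegrable _ _)]
  refine intervalIntegral.integral_congr fun s _ => ?_
  exact (intervalIntegral.integral_interval_sub_left ((hc s).intervalIntegrable _ _)
    ((hc s).intervalIntegrable _ _)).symm

theorem continuous_goursatTerm (hQ : Continuous Q) (j : ℕ) : Continuous (goursatTerm Q j) := by
  induction j with
  | zero =>
    have := continuous_goursatData hQ
    simp only [goursatTerm]
    fun_prop
  | succ j ih =>
    have hG : Continuous fun p => charPotential Q p * goursatTerm Q j p :=
      (continuous_charPotential hQ).mul ih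
    have hM := contDiff_doublePrimitive (n := 0) (contDiff_zero.2 hG)
    simp only [goursatTerm]
    simp only [integral_sector_eq_doublePrimitive hG]
    exact hM.continuous.sub (hM.continuous.comp (by fun_prop))

/-- Factorial decay of the Picard iterates, uniformly on squares. -/
theorem abs_goursatTerm_le {L A M : ℝ}
    (hM : ∀ p : ℝ × ℝ, |p.1| ≤ L → |p.2| ≤ L → |charPotential Q p| ≤ M)
    (hA : ∀ p : ℝ × ℝ, |p.1| ≤ L → |p.2| ≤ L → |goursatTerm Q 0 p| ≤ A) (j : ℕ) :
    ∀ p : ℝ × ℝ, |p.1| ≤ L → |p.2| ≤ L →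
      |goursatTerm Q j p| ≤ A * (2 * L * M) ^ j * (|p.1| ^ j / j.factorial) := by
  induction j with
  | zero => intro p h1 h2; simpa using hA p h1 h2
  | succ j ih =>
    intro p h1 h2
    have hL : 0 ≤ L := (abs_nonneg _).trans h1
    have hM0 : 0 ≤ M := (abs_nonneg _).trans (hM p h1 h2)
    have hA0 : 0 ≤ A := (abs_nonneg _).trans (hA p h1 h2)
    have hin : ∀ s, |s| ≤ |p.1| → |∫ r in p.1..p.2, charPotential Q (s, r) * goursatTerm Q j (s, r)|
        ≤ A * (2 * L * M) ^ (j + 1) * (|s| ^ j / j.factorial) := by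
      intro s hs
      have hs' : |s| ≤ L := hs.trans h1
      have := intervalIntegral.norm_integral_le_of_norm_le_const (a := p.1) (b := p.2)
        (f := fun r => charPotential Q (s, r) * goursatTerm Q j (s, r))
        (C := M * (A * (2 * L * M) ^ j * (|s| ^ j / j.factorial))) (fun r hr => ?_)
      · rw [Real.norm_eq_abs] at this
        refine this.trans ?_
        have h3 : |p.2 - p.1| ≤ 2 * L := by
          have := abs_sub p.2 p.1; linarith
        calc _ ≤ M * (A * (2 * L * M) ^ j * (|s| ^ j / j.factorial)) * (2 * L) := by gcongr
          _ = _ := by ring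
      · have hr' : |r| ≤ L := by
          have := uIoc_subset_uIcc hr
          rw [abs_le] at h1 h2 ⊢
          rcases mem_uIcc.1 this with h | h <;> constructor <;> linarith
        rw [norm_mul, Real.norm_eq_abs, Real.norm_eq_abs]
        exact mul_le_mul (hM (s, r) hs' hr') (ih (s, r) hs' hr') (abs_nonneg _) hM0
    have hint : ∀ x : ℝ, |∫ s in (0 : ℝ)..x, |s| ^ j| = |x| ^ (j + 1) / (j + 1) := by
      intro x
      rcases le_total 0 x with hx | hx
      · rw [intervalIntegral.integral_congr (g := fun s => s ^ j) fun s hs => by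
          rw [uIcc_of_le hx] at hs; simp [abs_of_nonneg hs.1]]
        rw [integral_pow, abs_div, abs_of_nonneg (a := (j : ℝ) + 1) (by positivity)]
        simp [abs_pow]
      · rw [intervalIntegral.integral_congr (g := fun s => (-1) ^ j * s ^ j) fun s hs => by
          rw [uIcc_of_ge hx] at hs
          simp only [abs_of_nonpos hs.2]; rw [← mul_pow]; simp]
        rw [intervalIntegral.integral_const_mul, integral_pow, abs_mul, abs_div,
          abs_of_nonneg (a := (j : ℝ) + 1) (by positivity)]
        simp [abs_pow]
    calc |goursatTerm Q (j + 1) p|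
        ≤ |∫ s in (0 : ℝ)..p.1, A * (2 * L * M) ^ (j + 1) * (|s| ^ j / j.factorial)| := by
          refine intervalIntegral.norm_integral_le_abs_of_norm_le
            (f := fun s => ∫ r in p.1..p.2, charPotential Q (s, r) * goursatTerm Q j (s, r)) ?_ ?_
          · refine (ae_restrict_iff' measurableSet_uIoc).2 (Eventually.of_forall fun s hs => ?_)
            refine hin s ?_
            have := uIoc_subset_uIcc hs
            rcases mem_uIcc.1 this with h | h
            · rw [abs_of_nonneg h.1]; exact h.2.trans (le_abs_self _)
            · rw [abs_of_nonpos h.2]; exact (neg_le_neg h.1).trans (neg_le_abs _)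
          · exact Continuous.intervalIntegrable (by fun_prop) _ _
      _ = _ := by
          rw [intervalIntegral.integral_const_mul, intervalIntegral.integral_div, abs_mul, abs_div,
            hint, abs_of_nonneg (a := A * (2 * L * M) ^ (j + 1)) (by positivity),
            abs_of_nonneg (a := (j.factorial : ℝ)) (by positivity), Nat.factorial_succ]
          push_cast
          field_simp

/-- A summable majorant of the Picard series on a square. -/
theorem exists_goursat_bound (hQ : Continuous Q) (L : ℝ) :
    ∃ M : ℝ, ∃ u : ℕ → ℝ, Summable u ∧
      (∀ p : ℝ × ℝ, |p.1| ≤ L → |p.2| ≤ L → |charPotential Q p| ≤ M) ∧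
      ∀ j, ∀ p : ℝ × ℝ, |p.1| ≤ L → |p.2| ≤ L → |goursatTerm Q j p| ≤ u j := by
  have hmem : ∀ p : ℝ × ℝ, |p.1| ≤ L → |p.2| ≤ L → p ∈ Icc (-L) L ×ˢ Icc (-L) L :=
    fun p h1 h2 => ⟨abs_le.1 h1, abs_le.1 h2⟩
  have hK : IsCompact (Icc (-L) L ×ˢ Icc (-L) L) := isCompact_Icc.prod isCompact_Icc
  obtain ⟨M, hM⟩ := hK.exists_bound_of_continuousOn (continuous_charPotential hQ).continuousOn
  obtain ⟨A, hA⟩ := hK.exists_bound_of_continuousOn (continuous_goursatTerm hQ 0).continuousOn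
  refine ⟨M, fun j => A * (2 * L * M) ^ j * (L ^ j / j.factorial), ?_,
    fun p h1 h2 => hM p (hmem p h1 h2), fun j p h1 h2 => ?_⟩
  · have := (Real.summable_pow_div_factorial (2 * L * M * L)).mul_left A
    refine this.congr fun j => ?_
    rw [mul_pow]; ring
  · have hL : 0 ≤ L := (abs_nonneg _).trans h1
    have hM0 : 0 ≤ M := (norm_nonneg _).trans (hM p (hmem p h1 h2))
    have hA0 : 0 ≤ A := (norm_nonneg _).trans (hA p (hmem p h1 h2))
    refine (abs_goursatTerm_le (fun p h1 h2 => hM p (hmem p h1 h2))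
      (fun p h1 h2 => hA p (hmem p h1 h2)) j p h1 h2).trans ?_
    beta_reduce
    gcongr

theorem hasSum_goursatKernel (hQ : Continuous Q) (p : ℝ × ℝ) :
    HasSum (fun j => goursatTerm Q j p) (goursatKernel Q p) := by
  obtain ⟨M, u, hu, -, h⟩ := exists_goursat_bound hQ (max |p.1| |p.2|)
  exact (Summable.of_norm_bounded hu fun j =>
    h j p (le_max_left _ _) (le_max_right _ _)).hasSum

theorem continuous_goursatKernel (hQ : Continuous Q) : Continuous (goursatKernel Q) := by
  rw [continuous_iff_continuousAt]
  intro p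
  obtain ⟨M, u, hu, -, h⟩ := exists_goursat_bound hQ (max |p.1| |p.2| + 1)
  set L := max |p.1| |p.2| + 1
  have hN : {p : ℝ × ℝ | |p.1| < L ∧ |p.2| < L} ∈ 𝓝 p := by
    refine IsOpen.mem_nhds ?_ ⟨?_, ?_⟩
    · exact (isOpen_lt continuous_fst.abs continuous_const).inter
        (isOpen_lt continuous_snd.abs continuous_const)
    · exact (le_max_left _ _).trans_lt (lt_add_one _)
    · exact (le_max_right _ _).trans_lt (lt_add_one _)
  refine ContinuousOn.continuousAt ?_ hN
  exact continuousOn_tsum (fun j => (continuous_goursatTerm hQ j).continuousOn) hu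
    fun j p hp => h j p hp.1.le hp.2.le

/-- The integral equation of the Goursat problem. -/
theorem goursatKernel_eq (hQ : Continuous Q) (p : ℝ × ℝ) :
    goursatKernel Q p = goursatData Q p.2 - goursatData Q p.1
      + ∫ s in (0 : ℝ)..p.1, ∫ r in p.1..p.2, charPotential Q (s, r) * goursatKernel Q (s, r) := by
  obtain ⟨M, u, hu, hM, h⟩ := exists_goursat_bound hQ (max |p.1| |p.2|)
  set L := max |p.1| |p.2|
  have h1 : |p.1| ≤ L := le_max_left _ _
  have h2 : |p.2| ≤ L := le_max_right _ _
  have hM0 : 0 ≤ M := (abs_nonneg _).trans (hM p h1 h2)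
  have hsmem : ∀ s ∈ uIoc 0 p.1, |s| ≤ L := by
    intro s hs
    refine le_trans ?_ h1
    rcases mem_uIcc.1 (uIoc_subset_uIcc hs) with h | h
    · rw [abs_of_nonneg h.1]; exact h.2.trans (le_abs_self _)
    · rw [abs_of_nonpos h.2]; exact (neg_le_neg h.1).trans (neg_le_abs _)
  have hrmem : ∀ r ∈ uIoc p.1 p.2, |r| ≤ L := by
    intro r hr
    rw [abs_le] at h1 h2 ⊢
    rcases mem_uIcc.1 (uIoc_subset_uIcc hr) with h | h <;> constructor <;> linarith
  have hb : ∀ j, ∀ s ∈ uIoc 0 p.1, ∀ r ∈ uIoc p.1 p.2,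
      ‖charPotential Q (s, r) * goursatTerm Q j (s, r)‖ ≤ M * u j := fun j s hs r hr => by
    rw [norm_mul, Real.norm_eq_abs, Real.norm_eq_abs]
    exact mul_le_mul (hM _ (hsmem s hs) (hrmem r hr)) (h j _ (hsmem s hs) (hrmem r hr))
      (abs_nonneg _) hM0
  have hG : ∀ j, Continuous fun p => charPotential Q p * goursatTerm Q j p := fun j =>
    (continuous_charPotential hQ).mul (continuous_goursatTerm hQ j)
  have hin : ∀ s ∈ uIoc 0 p.1, HasSum
      (fun j => ∫ r in p.1..p.2, charPotential Q (s, r) * goursatTerm Q j (s, r))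
      (∫ r in p.1..p.2, charPotential Q (s, r) * goursatKernel Q (s, r)) := by
    intro s hs
    refine intervalIntegral.hasSum_integral_of_dominated_convergence (fun j _ => M * u j)
      (fun j => ((hG j).comp (by fun_prop : Continuous fun r : ℝ => (s, r))).aestronglyMeasurable)
      (fun j => Eventually.of_forall fun r hr => hb j s hs r hr)
      (Eventually.of_forall fun _ _ => hu.mul_left M) (by simp)
      (Eventually.of_forall fun r _ => (hasSum_goursatKernel hQ (s, r)).mul_left _)
  have hout : HasSum (fun j => goursatTerm Q (j + 1) p)
      (∫ s in (0 : ℝ)..p.1, ∫ r in p.1..p.2,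
        charPotential Q (s, r) * goursatKernel Q (s, r)) := by
    refine intervalIntegral.hasSum_integral_of_dominated_convergence
      (fun j _ => M * u j * |p.2 - p.1|) (fun j => ?_)
      (fun j => Eventually.of_forall fun s hs => ?_)
      (Eventually.of_forall fun _ _ => (hu.mul_left M).mul_right _) (by simp)
      (Eventually.of_forall hin)
    · have hc : Continuous fun s : ℝ => ∫ r in p.1..p.2,
          charPotential Q (s, r) * goursatTerm Q j (s, r) :=
        intervalIntegral.continuous_parametric_intervalIntegral_of_continuous'
          (f := fun s r => charPotential Q (s, r) * goursatTerm Q j (s, r)) (hG j) _ _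
      exact hc.aestronglyMeasurable
    · exact intervalIntegral.norm_integral_le_of_norm_le_const fun r hr => hb j s hs r hr
  have := (hasSum_nat_add_iff (f := fun j => goursatTerm Q j p) 1).1 hout
  have h3 := (hasSum_goursatKernel hQ p).unique this
  rw [h3]
  simp [goursatTerm, add_comm]

theorem goursatKernel_diag (hQ : Continuous Q) (z : ℝ) : goursatKernel Q (z, z) = 0 := by
  rw [goursatKernel_eq hQ]; simp

theorem goursatKernel_eq_doublePrimitive (hQ : Continuous Q) (p : ℝ × ℝ) :
    goursatKernel Q p = goursatData Q p.2 - goursatData Q p.1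
      + (doublePrimitive (fun p => charPotential Q p * goursatKernel Q p) p
        - doublePrimitive (fun p => charPotential Q p * goursatKernel Q p) (p.1, p.1)) := by
  rw [goursatKernel_eq hQ,
    integral_sector_eq_doublePrimitive (G := fun p => charPotential Q p * goursatKernel Q p)
      ((continuous_charPotential hQ).mul (continuous_goursatKernel hQ))]

/-- The kernel inherits the smoothness of the potential: the right-hand side of the integral
equation is one derivative smoother than the kernel. -/
theorem contDiff_goursatKernel {n : ℕ} (hQ : ContDiff ℝ n Q) : ContDiff ℝ n (goursatKernel Q) := by
  suffices ∀ m ≤ n, ContDiff ℝ m (goursatKernel Q) from this n le_rfl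
  intro m
  induction m with
  | zero => exact fun _ => contDiff_zero.2 (continuous_goursatKernel hQ.continuous)
  | succ m ih =>
    intro hm
    have hQm : ContDiff ℝ m Q := hQ.of_le (by norm_cast; omega)
    have hM := contDiff_doublePrimitive ((contDiff_charPotential hQm).mul (ih (by omega)))
    have hd := contDiff_goursatData hQm
    rw [show goursatKernel Q = _ from
      funext fun p => goursatKernel_eq_doublePrimitive hQ.continuous p]
    push_cast
    exact ((hd.comp contDiff_snd).sub (hd.comp contDiff_fst)).add
      (hM.sub (hM.comp (contDiff_fst.prodMk contDiff_fst)))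

/-- In the sector `0 ≤ ξ ≤ η` the kernel only depends on the potential on `[0, ∞)`. -/
theorem goursatKernel_congr {Q₁ Q₂ : ℝ → ℝ} (h : EqOn Q₁ Q₂ (Ici 0)) {p : ℝ × ℝ}
    (h1 : 0 ≤ p.1) (h2 : p.1 ≤ p.2) : goursatKernel Q₁ p = goursatKernel Q₂ p := by
  have hd : ∀ z, 0 ≤ z → goursatData Q₁ z = goursatData Q₂ z := by
    intro z hz
    unfold goursatData
    rw [intervalIntegral.integral_congr fun s hs => ?_]
    rw [uIcc_of_le (by positivity)] at hs
    exact h hs.1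
  unfold goursatKernel
  refine tsum_congr fun j => ?_
  induction j generalizing p with
  | zero => simp only [goursatTerm]; rw [hd _ h1, hd _ (h1.trans h2)]
  | succ j ih =>
    simp only [goursatTerm]
    refine intervalIntegral.integral_congr fun s hs => ?_
    rw [uIcc_of_le h1] at hs
    refine intervalIntegral.integral_congr fun r hr => ?_
    rw [uIcc_of_le h2] at hr
    have hsr : s ≤ r := hs.2.trans hr.1
    simp only [ih (p := (s, r)) hs.1 hsr, charPotential]
    rw [h (show (0 : ℝ) ≤ (r - s) / 2 by linarith)]

end

/-! ### Waves generated by a control, in characteristic variables -/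

/-- The solution `f(ξ) + ∫₀^ξ K(ξ - s, η - s) f(s) ds` of the reduced wave equation. -/
noncomputable def charWave (Q f : ℝ → ℝ) (p : ℝ × ℝ) : ℝ :=
  f p.1 + ∫ s in (0 : ℝ)..p.1, goursatKernel Q (p.1 - s, p.2 - s) * f s

section

variable {Q f : ℝ → ℝ}

theorem contDiff_charWave {n : ℕ} (hQ : ContDiff ℝ n Q) (hf : ContDiff ℝ n f) :
    ContDiff ℝ n (charWave Q f) := by
  have hK := contDiff_goursatKernel hQ
  have h1 : ContDiff ℝ n fun z : (ℝ × ℝ) × ℝ =>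
      goursatKernel Q (z.1.1 - z.2, z.1.2 - z.2) * f z.2 :=
    (hK.comp (by fun_prop)).mul (hf.comp (by fun_prop))
  have h2 := contDiff_parametric_primitive n h1
  exact (hf.comp contDiff_fst).add (h2.comp (contDiff_id.prodMk contDiff_fst))

/-- `∂_η K`. -/
theorem hasDerivAt_goursatKernel_snd (hQ : Continuous Q) (a b : ℝ) :
    HasDerivAt (fun b => goursatKernel Q (a, b))
      (-(1 / 4) * Q (b / 2)
        + ∫ s in (0 : ℝ)..a, charPotential Q (s, b) * goursatKernel Q (s, b)) b := by
  have hG := (continuous_charPotential hQ).mul (continuous_goursatKernel hQ)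
  have h1 := (hasStrictFDerivAt_doublePrimitive hG (a, b)).hasFDerivAt.comp_hasDerivAt b
    ((hasDerivAt_const b a).prodMk (hasDerivAt_id b))
  have h2 := ((hasDerivAt_goursatData hQ b).sub_const (goursatData Q a)).add
    (h1.sub_const (doublePrimitive (fun p => charPotential Q p * goursatKernel Q p) (a, a)))
  refine (h2.congr_deriv ?_).congr_of_eventuallyEq
    (Eventually.of_forall fun z => goursatKernel_eq_doublePrimitive hQ (a, z))
  simp

/-- The reduced wave equation `V_ηξ = -¼ Q((η - ξ)/2) V` in characteristic variables. -/
theorem charWave_eq (hQ : ContDiff ℝ 1 Q) (hf : ContDiff ℝ 1 f) :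
    ∃ D : ℝ × ℝ → ℝ, (∀ a b, HasDerivAt (fun b => charWave Q f (a, b)) (D (a, b)) b) ∧
      ∀ a b, HasDerivAt (fun a => D (a, b)) (charPotential Q (a, b) * charWave Q f (a, b)) a := by
  have hQ1 : ContDiff ℝ (1 : ℕ) Q := by exact_mod_cast hQ
  have hK : ContDiff ℝ 1 (goursatKernel Q) := by exact_mod_cast contDiff_goursatKernel hQ1
  have hP : ContDiff ℝ 1 (charPotential Q) := by exact_mod_cast contDiff_charPotential hQ1
  set K' : ℝ × ℝ → ℝ := fun p => -(1 / 4) * Q (p.2 / 2)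
        + ∫ s in (0 : ℝ)..p.1, charPotential Q (s, p.2) * goursatKernel Q (s, p.2) with hK'def
  have hK' : ContDiff ℝ 1 K' := by
    have h2 : ContDiff ℝ 1 fun p : ℝ × ℝ => ∫ s in (0 : ℝ)..p.1,
        charPotential Q (s, p.2) * goursatKernel Q (s, p.2) := by
      have := (contDiff_parametric_primitive 1
        (G := fun z : ℝ × ℝ => charPotential Q (z.2, z.1) * goursatKernel Q (z.2, z.1))
        (by exact_mod_cast (hP.mul hK).comp (contDiff_snd.prodMk contDiff_fst))).comp
          (contDiff_snd.prodMk contDiff_fst)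
      exact_mod_cast this
    exact (contDiff_const.mul (hQ.comp (by fun_prop))).add h2
  refine ⟨fun p => ∫ s in (0 : ℝ)..p.1, K' (p.1 - s, p.2 - s) * f s, fun a b => ?_, fun a b => ?_⟩
  · have h := hasDerivAt_parametric_integral
      (G := fun z => goursatKernel Q (a - z.2, z.1 - z.2) * f z.2)
      (G' := fun z => K' (a - z.2, z.1 - z.2) * f z.2) (b := fun _ => a) (b' := 0) (x := b)
      ((hK.comp (by fun_prop)).mul (hf.comp (by fun_prop))) (fun x s => ?_) (hasDerivAt_const _ _)
    · simpa [charWave] using h.const_add (f a)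
    · have := (hasDerivAt_goursatKernel_snd hQ.continuous (a - s) (x - s)).comp x
        ((hasDerivAt_id x).sub_const s)
      exact (this.mul_const (f s)).congr_deriv (by simp [hK'def])
  · have h := hasDerivAt_parametric_integral
      (G := fun z => K' (z.1 - z.2, b - z.2) * f z.2)
      (G' := fun z => charPotential Q (z.1 - z.2, b - z.2)
        * goursatKernel Q (z.1 - z.2, b - z.2) * f z.2) (b := fun a => a) (b' := 1) (x := a)
      ((hK'.comp (by fun_prop)).mul (hf.comp (by fun_prop))) (fun x s => ?_) (hasDerivAt_id _)
    · refine h.congr_deriv ?_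
      have e : ∀ s, charPotential Q (a - s, b - s) = charPotential Q (a, b) := fun s => by
        simp [charPotential]
      simp only [e, mul_assoc, intervalIntegral.integral_const_mul]
      simp only [charWave, hK'def, charPotential, sub_self, intervalIntegral.integral_same]
      ring
    · have hc : Continuous fun r : ℝ => charPotential Q (r, b - s) * goursatKernel Q (r, b - s) :=
        (hP.continuous.comp (by fun_prop)).mul (hK.continuous.comp (by fun_prop))
      have := ((hc.integral_hasStrictDerivAt 0 (x - s)).hasDerivAt.comp x
        ((hasDerivAt_id x).sub_const s)).const_add (-(1 / 4) * Q ((b - s) / 2))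
      exact (this.mul_const (f s)).congr_deriv (by simp)

end

theorem iteratedDeriv_two_eq {g g' : ℝ → ℝ} {c t : ℝ} (h1 : ∀ᶠ s in 𝓝 t, HasDerivAt g (g' s) s)
    (h2 : HasDerivAt g' c t) : iteratedDeriv 2 g t = c := by
  rw [iteratedDeriv_succ, iteratedDeriv_one]
  have : deriv g =ᶠ[𝓝 t] g' := h1.mono fun s hs => hs.deriv
  rw [this.deriv_eq, h2.deriv]

/-- In the variables `y`, `t` the function `charWave` solves `v_tt - v_yy + Q v = 0`. -/
theorem charWave_wave_eq {Q f : ℝ → ℝ} (hQ : ContDiff ℝ 2 Q) (hf : ContDiff ℝ 2 f) :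
    ∃ vy vyy vt vtt : ℝ → ℝ → ℝ, ∀ y t,
      HasDerivAt (fun y => charWave Q f (t - y, t + y)) (vy y t) y ∧
      HasDerivAt (fun y => vy y t) (vyy y t) y ∧
      HasDerivAt (fun t => charWave Q f (t - y, t + y)) (vt y t) t ∧
      HasDerivAt (fun t => vt y t) (vtt y t) t ∧
      vtt y t - vyy y t = -Q y * charWave Q f (t - y, t + y) := by
  have hV : ContDiff ℝ 2 (charWave Q f) := by
    exact_mod_cast contDiff_charWave (n := 2) (by exact_mod_cast hQ) (by exact_mod_cast hf)
  obtain ⟨D, hD1, hD2⟩ := charWave_eq (hQ.of_le (by norm_num)) (hf.of_le (by norm_num))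
  set V := charWave Q f
  set D1 : ℝ × ℝ → ℝ := fun p => fderiv ℝ V p (1, 0) with hD1def
  set D2 : ℝ × ℝ → ℝ := fun p => fderiv ℝ V p (0, 1) with hD2def
  have hV' : ContDiff ℝ 1 (fderiv ℝ V) := hV.fderiv_right (by norm_num)
  have c1 : ContDiff ℝ 1 D1 := hV'.clm_apply contDiff_const
  have c2 : ContDiff ℝ 1 D2 := hV'.clm_apply contDiff_const
  have dV : ∀ p, HasFDerivAt V (fderiv ℝ V p) p := fun p =>
    (hV.differentiable (by norm_num) p).hasFDerivAt
  have d1 : ∀ p, HasFDerivAt D1 (fderiv ℝ D1 p) p := fun p =>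
    (c1.differentiable (by norm_num) p).hasFDerivAt
  have d2 : ∀ p, HasFDerivAt D2 (fderiv ℝ D2 p) p := fun p =>
    (c2.differentiable (by norm_num) p).hasFDerivAt
  have hfd : ∀ p u v, fderiv ℝ (fun p => fderiv ℝ V p v) p u = fderiv ℝ (fderiv ℝ V) p u v := by
    intro p u v
    have := ((hV'.differentiable (by norm_num) p).hasFDerivAt).clm_apply
      (hasFDerivAt_const v p)
    rw [this.fderiv]; simp
  have hsymm : ∀ p, fderiv ℝ D1 p (0, 1) = fderiv ℝ D2 p (1, 0) := by
    intro p
    rw [hD1def, hD2def, hfd, hfd]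
    exact (hV.contDiffAt.isSymmSndFDerivAt (by simp)) _ _
  have hDD2 : D = D2 := by
    funext ⟨a, b⟩
    have := (dV (a, b)).comp_hasDerivAt b ((hasDerivAt_const b a).prodMk (hasDerivAt_id b))
    exact (hD1 a b).unique this
  have hmix : ∀ p, fderiv ℝ D2 p (1, 0) = charPotential Q p * V p := by
    rintro ⟨a, b⟩
    have := (d2 (a, b)).comp_hasDerivAt a ((hasDerivAt_id a).prodMk (hasDerivAt_const a b))
    rw [hDD2] at hD2
    exact this.unique (hD2 a b)
  have cy : ∀ y t : ℝ, HasDerivAt (fun y : ℝ => (t - y, t + y)) ((-1 : ℝ), (1 : ℝ)) y := fun y t =>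
    ((hasDerivAt_id y).const_sub t).prodMk ((hasDerivAt_id y).const_add t)
  have ct : ∀ y t : ℝ, HasDerivAt (fun t : ℝ => (t - y, t + y)) ((1 : ℝ), (1 : ℝ)) t := fun y t =>
    ((hasDerivAt_id t).sub_const y).prodMk ((hasDerivAt_id t).add_const y)
  have spl : ∀ (A : ℝ × ℝ →L[ℝ] ℝ) (a b : ℝ), A (a, b) = a * A (1, 0) + b * A (0, 1) := by
    intro A a b
    rw [show (a, b) = a • ((1 : ℝ), (0 : ℝ)) + b • ((0 : ℝ), (1 : ℝ)) by simp, map_add, map_smul,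
      map_smul, smul_eq_mul, smul_eq_mul]
  refine ⟨fun y t => -D1 (t - y, t + y) + D2 (t - y, t + y),
    fun y t => -(fderiv ℝ D1 (t - y, t + y) (-1, 1)) + fderiv ℝ D2 (t - y, t + y) (-1, 1),
    fun y t => D1 (t - y, t + y) + D2 (t - y, t + y),
    fun y t => fderiv ℝ D1 (t - y, t + y) (1, 1) + fderiv ℝ D2 (t - y, t + y) (1, 1),
    fun y t => ⟨?_, ?_, ?_, ?_, ?_⟩⟩
  · refine ((dV (t - y, t + y)).comp_hasDerivAt y (cy y t)).congr_deriv ?_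
    rw [spl]; simp [D1, D2]
  · exact ((d1 (t - y, t + y)).comp_hasDerivAt y (cy y t)).neg.add
      ((d2 (t - y, t + y)).comp_hasDerivAt y (cy y t))
  · refine ((dV (t - y, t + y)).comp_hasDerivAt t (ct y t)).congr_deriv ?_
    rw [spl]; simp [D1, D2]
  · exact ((d1 (t - y, t + y)).comp_hasDerivAt t (ct y t)).add
      ((d2 (t - y, t + y)).comp_hasDerivAt t (ct y t))
  · beta_reduce
    rw [spl _ (-1) 1, spl _ (-1) 1, spl _ 1 1, spl _ 1 1, hsymm, hmix]
    simp only [charPotential]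
    rw [show (t + y - (t - y)) / 2 = y by ring]
    ring

/-! ### The eikonal and its inverse -/

section Eikonal

variable {ρ : ℝ → ℝ}

theorem contDiffOn_sqrt_density {n : WithTop ℕ∞} (hρ : ContDiffOn ℝ n ρ (Ici 0))
    (hpos : ∀ x, 0 ≤ x → 0 < ρ x) :
    ContDiffOn ℝ n (fun x => ρ x ^ (1 / 2 : ℝ)) (Ici 0) :=
  hρ.rpow_const_of_ne fun x hx => (hpos x hx).ne'

/-- `ρ^{1/2}` on `[0, ∞)` has a positive extension of class `C^n` to the line; positivity is kept by
extending the logarithm. -/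
theorem exists_pos_extension (hρ : ContDiffOn ℝ ∞ ρ (Ici 0)) (hpos : ∀ x, 0 ≤ x → 0 < ρ x)
    (n : ℕ) : ∃ g : ℝ → ℝ, ContDiff ℝ n g ∧ (∀ x, 0 < g x) ∧
      ∀ x, 0 ≤ x → g x = ρ x ^ (1 / 2 : ℝ) := by
  have h1 : ContDiffOn ℝ n (fun x => Real.log (ρ x ^ (1 / 2 : ℝ))) (Ici 0) :=
    (contDiffOn_sqrt_density (hρ.of_le (by exact_mod_cast le_top)) hpos).log
      fun x hx => (Real.rpow_pos_of_pos (hpos x hx) _).ne'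
  obtain ⟨l, hl, hle⟩ := exists_contDiff_extension n h1
  refine ⟨fun x => Real.exp (l x), Real.contDiff_exp.comp hl, fun x => Real.exp_pos _,
    fun x hx => ?_⟩
  simp only [hle (show x ∈ Ici (0 : ℝ) from hx)]
  exact Real.exp_log (Real.rpow_pos_of_pos (hpos x hx) _)

theorem eikonal_eq_of_eqOn {g : ℝ → ℝ} (hg : ∀ x, 0 ≤ x → g x = ρ x ^ (1 / 2 : ℝ)) {x : ℝ}
    (hx : 0 ≤ x) : eikonal ρ x = ∫ s in (0 : ℝ)..x, g s := by
  refine intervalIntegral.integral_congr fun s hs => ?_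
  rw [uIcc_of_le hx] at hs
  exact (hg s hs.1).symm

@[simp]
theorem eikonal_zero : eikonal ρ 0 = 0 := by simp [eikonal]

theorem hasDerivWithinAt_eikonal (hρ : ContDiffOn ℝ ∞ ρ (Ici 0)) (hpos : ∀ x, 0 ≤ x → 0 < ρ x)
    {x : ℝ} (hx : 0 ≤ x) :
    HasDerivWithinAt (eikonal ρ) (ρ x ^ (1 / 2 : ℝ)) (Ici 0) x := by
  obtain ⟨g, hg, -, hge⟩ := exists_pos_extension hρ hpos 0
  rw [← hge x hx]
  exact ((hg.continuous.integral_hasStrictDerivAt 0 x).hasDerivAt.hasDerivWithinAt).congr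
    (fun y hy => eikonal_eq_of_eqOn hge hy) (eikonal_eq_of_eqOn hge hx)

theorem hasDerivAt_eikonal (hρ : ContDiffOn ℝ ∞ ρ (Ici 0)) (hpos : ∀ x, 0 ≤ x → 0 < ρ x)
    {x : ℝ} (hx : 0 < x) : HasDerivAt (eikonal ρ) (ρ x ^ (1 / 2 : ℝ)) x :=
  (hasDerivWithinAt_eikonal hρ hpos hx.le).hasDerivAt (Ici_mem_nhds hx)

theorem continuousOn_eikonal (hρ : ContDiffOn ℝ ∞ ρ (Ici 0)) (hpos : ∀ x, 0 ≤ x → 0 < ρ x) :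
    ContinuousOn (eikonal ρ) (Ici 0) := fun _ hx =>
  (hasDerivWithinAt_eikonal hρ hpos hx).continuousWithinAt

theorem strictMonoOn_eikonal (hρ : ContDiffOn ℝ ∞ ρ (Ici 0)) (hpos : ∀ x, 0 ≤ x → 0 < ρ x) :
    StrictMonoOn (eikonal ρ) (Ici 0) := by
  refine strictMonoOn_of_deriv_pos (convex_Ici 0) (continuousOn_eikonal hρ hpos) fun x hx => ?_
  rw [interior_Ici] at hx
  rw [(hasDerivAt_eikonal hρ hpos hx).deriv]
  exact Real.rpow_pos_of_pos (hpos x (le_of_lt hx)) _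

theorem eikonal_nonneg (hρ : ContDiffOn ℝ ∞ ρ (Ici 0)) (hpos : ∀ x, 0 ≤ x → 0 < ρ x) {x : ℝ}
    (hx : 0 ≤ x) : 0 ≤ eikonal ρ x := by
  have := (strictMonoOn_eikonal hρ hpos).monotoneOn (self_mem_Ici) hx hx
  simpa using this

theorem contDiffOn_eikonal (hρ : ContDiffOn ℝ ∞ ρ (Ici 0)) (hpos : ∀ x, 0 ≤ x → 0 < ρ x) :
    ContDiffOn ℝ ∞ (eikonal ρ) (Ici 0) := by
  rw [contDiffOn_infty_iff_derivWithin (uniqueDiffOn_Ici 0)]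
  refine ⟨fun x hx => (hasDerivWithinAt_eikonal hρ hpos hx).differentiableWithinAt, ?_⟩
  exact (contDiffOn_sqrt_density hρ hpos).congr fun x hx =>
    (hasDerivWithinAt_eikonal hρ hpos hx).derivWithin (uniqueDiffOn_Ici 0 x hx)

theorem eikonalInv_spec (hρ : ContDiffOn ℝ ∞ ρ (Ici 0)) (hpos : ∀ x, 0 ≤ x → 0 < ρ x)
    (hτ : Tendsto (eikonal ρ) atTop atTop) {y : ℝ} (hy : 0 ≤ y) :
    0 ≤ eikonalInv ρ y ∧ eikonal ρ (eikonalInv ρ y) = y := by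
  have h : ∃ x ∈ Ici (0 : ℝ), eikonal ρ x = y := by
    obtain ⟨b, hb0, hb⟩ := ((eventually_ge_atTop (0 : ℝ)).and
      (hτ.eventually_ge_atTop y)).exists
    have := intermediate_value_Icc hb0 ((continuousOn_eikonal hρ hpos).mono Icc_subset_Ici_self)
    obtain ⟨x, hx, hxy⟩ := this (show y ∈ Icc _ _ from ⟨by simpa using hy, hb⟩)
    exact ⟨x, hx.1, hxy⟩
  exact ⟨Function.invFunOn_mem h, Function.invFunOn_eq h⟩

theorem eikonalInv_eikonal (hρ : ContDiffOn ℝ ∞ ρ (Ici 0)) (hpos : ∀ x, 0 ≤ x → 0 < ρ x)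
    (hτ : Tendsto (eikonal ρ) atTop atTop) {x : ℝ} (hx : 0 ≤ x) :
    eikonalInv ρ (eikonal ρ x) = x := by
  have h := eikonalInv_spec hρ hpos hτ (eikonal_nonneg hρ hpos hx)
  exact (strictMonoOn_eikonal hρ hpos).injOn h.1 hx h.2

/-- The inverse of the eikonal is smooth on `[0, ∞)`: for each `n` it is the restriction of the
inverse of a strictly increasing function of class `C^n` on the line. -/
theorem contDiffOn_eikonalInv (hρ : ContDiffOn ℝ ∞ ρ (Ici 0)) (hpos : ∀ x, 0 ≤ x → 0 < ρ x)
    (hτ : Tendsto (eikonal ρ) atTop atTop) : ContDiffOn ℝ ∞ (eikonalInv ρ) (Ici 0) := by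
  rw [contDiffOn_infty]
  intro n
  obtain ⟨g, hg, hgpos, hge⟩ := exists_pos_extension hρ hpos n
  set e : ℝ → ℝ := fun x => ∫ s in (0 : ℝ)..x, g s
  have hd : ∀ x, HasStrictDerivAt e (g x) x := fun x => hg.continuous.integral_hasStrictDerivAt 0 x
  have he : ContDiff ℝ n e := by
    have : ContDiff ℝ (n + 1) e := by
      rw [contDiff_succ_iff_deriv]
      refine ⟨fun x => (hd x).hasDerivAt.differentiableAt, by simp, ?_⟩
      rwa [show deriv e = g from funext fun x => (hd x).hasDerivAt.deriv]
    exact this.of_le (by norm_cast; omega)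
  have hmono : StrictMono e := strictMono_of_deriv_pos fun x => by
    rw [(hd x).hasDerivAt.deriv]; exact hgpos x
  have hopen : IsOpenEmbedding e := .of_continuous_injective_isOpenMap he.continuous
    hmono.injective (isOpenMap_of_hasStrictDerivAt hd fun x => (hgpos x).ne')
  set Φ := hopen.toOpenPartialHomeomorph e
  have hinv : ∀ x, Φ.symm (e x) = x := fun x => Φ.left_inv (mem_univ x)
  have key : ∀ y, 0 ≤ y → e (eikonalInv ρ y) = y := fun y hy => by
    have h := eikonalInv_spec hρ hpos hτ hy
    exact (eikonal_eq_of_eqOn hge h.1).symm.trans h.2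
  have hcongr : ∀ y, 0 ≤ y → eikonalInv ρ y = Φ.symm y := fun y hy => by
    conv_rhs => rw [← key y hy]
    rw [hinv]
  refine ContDiffOn.congr (f := Φ.symm) (fun y hy => ?_) fun y hy => hcongr y hy
  have hy' : y ∈ Φ.target := by
    rw [← key y hy]; exact Φ.map_source (mem_univ _)
  exact (Φ.contDiffAt_symm_deriv (hgpos _).ne' hy' (hd _).hasDerivAt
    he.contDiffAt).contDiffWithinAt

end Eikonal

/-! ### The amplitude and the reduced potential -/

/-- The amplitude `[ρ(x)/ρ(0)]^{-1/4}` of the wave front. -/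
noncomputable def amplitude (ρ : ℝ → ℝ) (x : ℝ) : ℝ := (ρ x / ρ 0) ^ (-(1 / 4) : ℝ)

/-- The potential `Q` of the equation `v_tt - v_yy + Q v = 0` which the substitution
`u(x, t) = [ρ(x)/ρ(0)]^{-1/4} v(τ(x), t)` produces. -/
noncomputable def reducedPotential (ρ q : ℝ → ℝ) (y : ℝ) : ℝ :=
  (q (eikonalInv ρ y) * amplitude ρ (eikonalInv ρ y)
      - derivWithin (derivWithin (amplitude ρ) (Ici 0)) (Ici 0) (eikonalInv ρ y))
    / (ρ (eikonalInv ρ y) * amplitude ρ (eikonalInv ρ y))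

section Reduction

variable {ρ q : ℝ → ℝ}

theorem amplitude_pos (hpos : ∀ x, 0 ≤ x → 0 < ρ x) {x : ℝ} (hx : 0 ≤ x) : 0 < amplitude ρ x :=
  Real.rpow_pos_of_pos (div_pos (hpos x hx) (hpos 0 le_rfl)) _

theorem contDiffOn_amplitude (hρ : ContDiffOn ℝ ∞ ρ (Ici 0)) (hpos : ∀ x, 0 ≤ x → 0 < ρ x) :
    ContDiffOn ℝ ∞ (amplitude ρ) (Ici 0) :=
  (hρ.div_const (ρ 0)).rpow_const_of_ne fun x hx => (div_pos (hpos x hx) (hpos 0 le_rfl)).ne'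

theorem amplitude_zero (hpos : ∀ x, 0 ≤ x → 0 < ρ x) : amplitude ρ 0 = 1 := by
  simp [amplitude, (hpos 0 le_rfl).ne']

theorem amplitude_sq_mul (hpos : ∀ x, 0 ≤ x → 0 < ρ x) {x : ℝ} (hx : 0 ≤ x) :
    amplitude ρ x ^ 2 * ρ x ^ (1 / 2 : ℝ) = ρ 0 ^ (1 / 2 : ℝ) := by
  have h0 := hpos 0 le_rfl
  have hx0 := hpos x hx
  rw [amplitude, ← Real.rpow_natCast, ← Real.rpow_mul (by positivity),
    Real.div_rpow hx0.le h0.le, show (-(1 / 4) : ℝ) * ((2 : ℕ) : ℝ) = -(1 / 2) by norm_num,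
    Real.rpow_neg hx0.le, Real.rpow_neg h0.le]
  have := (Real.rpow_pos_of_pos hx0 (1 / 2)).ne'
  field_simp

theorem contDiffOn_reducedPotential (hρ : ContDiffOn ℝ ∞ ρ (Ici 0))
    (hpos : ∀ x, 0 ≤ x → 0 < ρ x) (hq : ContDiffOn ℝ ∞ q (Ici 0))
    (hτ : Tendsto (eikonal ρ) atTop atTop) :
    ContDiffOn ℝ ∞ (reducedPotential ρ q) (Ici 0) := by
  have hX := contDiffOn_eikonalInv hρ hpos hτ
  have hm : MapsTo (eikonalInv ρ) (Ici 0) (Ici 0) := fun y hy => (eikonalInv_spec hρ hpos hτ hy).1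
  have hu : UniqueDiffOn ℝ (Ici (0 : ℝ)) := uniqueDiffOn_Ici 0
  have hσ := contDiffOn_amplitude hρ hpos
  have hσ2 : ContDiffOn ℝ ∞ (derivWithin (derivWithin (amplitude ρ) (Ici 0)) (Ici 0)) (Ici 0) :=
    (hσ.derivWithin (m := ∞) hu (by simp)).derivWithin hu (by simp)
  have hF : ContDiffOn ℝ ∞ (fun x => (q x * amplitude ρ x
      - derivWithin (derivWithin (amplitude ρ) (Ici 0)) (Ici 0) x) / (ρ x * amplitude ρ x))
      (Ici 0) :=
    ((hq.mul hσ).sub hσ2).div (hρ.mul hσ) fun x hx =>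
      (mul_pos (hpos x hx) (amplitude_pos hpos hx)).ne'
  exact hF.comp hX hm

/-- The Liouville substitution turns solutions of the reduced equation into solutions of the
original one. -/
theorem wave_eq_of_reduced (hρ : ContDiffOn ℝ ∞ ρ (Ici 0)) (hpos : ∀ x, 0 ≤ x → 0 < ρ x)
    (hτ : Tendsto (eikonal ρ) atTop atTop) {Q f : ℝ → ℝ} (hQ : ContDiff ℝ 2 Q)
    (hQe : EqOn Q (reducedPotential ρ q) (Ici 0)) (hf : ContDiff ℝ 2 f) {u : ℝ → ℝ → ℝ}
    (hu : ∀ x, 0 ≤ x → ∀ t, 0 ≤ t →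
      u x t = amplitude ρ x * charWave Q f (t - eikonal ρ x, t + eikonal ρ x))
    {x t : ℝ} (hx : 0 < x) (ht : 0 < t) :
    ρ x * iteratedDeriv 2 (fun t' => u x t') t - iteratedDeriv 2 (fun x' => u x' t) x
      + q x * u x t = 0 := by
  obtain ⟨vy, vyy, vt, vtt, hv⟩ := charWave_wave_eq hQ hf
  set V := charWave Q f
  set σ := amplitude ρ with hσdef
  set σ1 := derivWithin σ (Ici 0) with hσ1
  set σ2 := derivWithin σ1 (Ici 0) with hσ2
  have hud : UniqueDiffOn ℝ (Ici (0 : ℝ)) := uniqueDiffOn_Ici 0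
  have cσ : ContDiffOn ℝ ∞ σ (Ici 0) := contDiffOn_amplitude hρ hpos
  have cσ1 : ContDiffOn ℝ ∞ σ1 (Ici 0) := cσ.derivWithin hud (by simp)
  have dσ : ∀ x, 0 < x → HasDerivAt σ (σ1 x) x := fun x hx =>
    ((cσ.differentiableOn (by simp) x hx.le).hasDerivWithinAt).hasDerivAt (Ici_mem_nhds hx)
  have dσ1 : ∀ x, 0 < x → HasDerivAt σ1 (σ2 x) x := fun x hx =>
    ((cσ1.differentiableOn (by simp) x hx.le).hasDerivWithinAt).hasDerivAt (Ici_mem_nhds hx)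
  set h : ℝ → ℝ := fun x => ρ x ^ (1 / 2 : ℝ) with hh
  have ch : ContDiffOn ℝ ∞ h (Ici 0) := contDiffOn_sqrt_density hρ hpos
  set h1 := derivWithin h (Ici 0)
  have dh : HasDerivAt h (h1 x) x :=
    ((ch.differentiableOn (by simp) x hx.le).hasDerivWithinAt).hasDerivAt (Ici_mem_nhds hx)
  have dτ : ∀ x, 0 < x → HasDerivAt (eikonal ρ) (h x) x := fun x hx =>
    hasDerivAt_eikonal hρ hpos hx
  have hsq : h x ^ 2 = ρ x := by
    rw [hh, ← Real.rpow_natCast, ← Real.rpow_mul (hpos x hx.le).le]; norm_num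
  -- the transport equation, from `σ² h = const`
  have htr : 2 * σ1 x * h x + σ x * h1 x = 0 := by
    have e : HasDerivAt (fun x => σ x ^ 2 * h x) 0 x :=
      (hasDerivAt_const x (ρ 0 ^ (1 / 2 : ℝ))).congr_of_eventuallyEq
        ((eventually_gt_nhds hx).mono fun z hz => amplitude_sq_mul hpos (le_of_lt hz))
    have e2 := (((dσ x hx).pow 2).mul dh).unique e
    have hs : 0 < σ x := amplitude_pos hpos hx.le
    have : σ x * (2 * σ1 x * h x + σ x * h1 x) = 0 := by
      rw [← e2]; simp; ring
    exact (mul_eq_zero.1 this).resolve_left hs.ne'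
  have et : iteratedDeriv 2 (fun t' => u x t') t = σ x * vtt (eikonal ρ x) t := by
    refine iteratedDeriv_two_eq (g' := fun s => σ x * vt (eikonal ρ x) s) ?_
      ((hv (eikonal ρ x) t).2.2.2.1.const_mul _)
    filter_upwards [eventually_gt_nhds ht] with s hs
    refine ((hv (eikonal ρ x) s).2.2.1.const_mul (σ x)).congr_of_eventuallyEq ?_
    filter_upwards [eventually_gt_nhds hs] with z hz
    exact hu x hx.le z hz.le
  have ex : iteratedDeriv 2 (fun x' => u x' t) x
      = σ2 x * V (t - eikonal ρ x, t + eikonal ρ x)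
        + (2 * σ1 x * h x + σ x * h1 x) * vy (eikonal ρ x) t
        + σ x * h x ^ 2 * vyy (eikonal ρ x) t := by
    have dV : ∀ z, 0 < z → HasDerivAt (fun z => V (t - eikonal ρ z, t + eikonal ρ z))
        (vy (eikonal ρ z) t * h z) z := fun z hz => by
      have := (hv (eikonal ρ z) t).1.comp z (dτ z hz)
      exact this
    refine iteratedDeriv_two_eq
      (g' := fun z => σ1 z * V (t - eikonal ρ z, t + eikonal ρ z)
        + σ z * (vy (eikonal ρ z) t * h z)) ?_ ?_
    · filter_upwards [eventually_gt_nhds hx] with s hs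
      refine ((dσ s hs).mul (dV s hs)).congr_of_eventuallyEq ?_
      filter_upwards [eventually_gt_nhds hs] with z hz
      exact hu z hz.le t ht.le
    · have dvy : HasDerivAt (fun z => vy (eikonal ρ z) t) (vyy (eikonal ρ x) t * h x) x :=
        (hv (eikonal ρ x) t).2.1.comp x (dτ x hx)
      refine (((dσ1 x hx).mul (dV x hx)).add ((dσ x hx).mul (dvy.mul dh))).congr_deriv ?_
      simp only [Pi.mul_apply]
      ring
  have hQx : Q (eikonal ρ x) * (ρ x * σ x) = q x * σ x - σ2 x := by
    rw [hQe (show eikonal ρ x ∈ Ici 0 from eikonal_nonneg hρ hpos hx.le), reducedPotential,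
      eikonalInv_eikonal hρ hpos hτ hx.le]
    have := (mul_pos (hpos x hx.le) (amplitude_pos hpos hx.le)).ne'
    rw [div_mul_cancel₀ _ this]
  have hw := (hv (eikonal ρ x) t).2.2.2.2
  rw [et, ex, htr, hu x hx.le t ht.le, hsq]
  linear_combination (ρ x * σ x) * hw - V (t - eikonal ρ x, t + eikonal ρ x) * hQx

/-! ### Existence of the fundamental kernel -/

/-- Existence of the regular part of the fundamental solution.  The kernel is built from one
continuous extension of the reduced potential; on the wedge it coincides with the kernels built from
extensions of class `C^n`. -/
theorem exists_fundamentalKernel (hρ : ContDiffOn ℝ ∞ ρ (Ici 0)) (hpos : ∀ x, 0 ≤ x → 0 < ρ x)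
    (hq : ContDiffOn ℝ ∞ q (Ici 0)) (hτ : Tendsto (eikonal ρ) atTop atTop) :
    ∃ w : ℝ → ℝ → ℝ, IsFundamentalKernel ρ q w := by
  have hpot := contDiffOn_reducedPotential hρ hpos hq hτ
  have hext : ∀ n : ℕ, ∃ Q : ℝ → ℝ, ContDiff ℝ n Q ∧ EqOn Q (reducedPotential ρ q) (Ici 0) :=
    fun n => exists_contDiff_extension n (hpot.of_le (by exact_mod_cast le_top))
  obtain ⟨Q₀, hQ₀, hQ₀e⟩ := hext 0
  set w : ℝ → ℝ → ℝ := fun x t =>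
    amplitude ρ x * goursatKernel Q₀ (t - eikonal ρ x, t + eikonal ρ x) with hw
  have cσ := contDiffOn_amplitude hρ hpos
  have cτ := contDiffOn_eikonal hρ hpos
  have hτ0 : ∀ {x}, 0 ≤ x → 0 ≤ eikonal ρ x := fun hx => eikonal_nonneg hρ hpos hx
  have hwave : ∀ {Q f : ℝ → ℝ}, EqOn Q (reducedPotential ρ q) (Ici 0) → (∀ t ≤ 0, f t = 0) →
      ∀ x, 0 ≤ x → ∀ t, 0 ≤ t →
        wave ρ w f x t = amplitude ρ x * charWave Q f (t - eikonal ρ x, t + eikonal ρ x) := by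
    intro Q f hQe hf x hx t ht
    rw [wave, charWave, mul_add, ← intervalIntegral.integral_const_mul]
    congr 1
    refine intervalIntegral.integral_congr fun s hs => ?_
    rcases le_total 0 (t - eikonal ρ x) with h | h
    · rw [uIcc_of_le h] at hs
      simp only [hw]
      rw [goursatKernel_congr (hQ₀e.trans hQe.symm)]
      · rw [sub_right_comm, show t - s + eikonal ρ x = t + eikonal ρ x - s by ring]; ring
      · simp only; linarith [hs.2]
      · simp only; linarith [hτ0 hx]
    · rw [uIcc_of_ge h] at hs
      simp [hf s hs.2]
  refine ⟨w, ?_, fun f hf ⟨ε, hε, hfε⟩ => ?_⟩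
  · rw [contDiffOn_infty]
    intro n
    obtain ⟨Q, hQ, hQe⟩ := hext n
    have hsub : {p : ℝ × ℝ | 0 ≤ p.1 ∧ eikonal ρ p.1 ≤ p.2} ⊆ Prod.fst ⁻¹' Ici 0 := fun p hp => hp.1
    have hn : ((n : ℕ) : WithTop ℕ∞) ≤ (∞ : WithTop ℕ∞) := by exact_mod_cast le_top
    have c1 : ContDiffOn ℝ n (fun p : ℝ × ℝ => amplitude ρ p.1)
        {p : ℝ × ℝ | 0 ≤ p.1 ∧ eikonal ρ p.1 ≤ p.2} :=
      (cσ.of_le hn).comp contDiff_fst.contDiffOn hsub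
    have c2 : ContDiffOn ℝ n (fun p : ℝ × ℝ => eikonal ρ p.1)
        {p : ℝ × ℝ | 0 ≤ p.1 ∧ eikonal ρ p.1 ≤ p.2} :=
      (cτ.of_le hn).comp contDiff_fst.contDiffOn hsub
    have c3 := (contDiff_goursatKernel hQ).comp_contDiffOn
      ((contDiff_snd.contDiffOn.sub c2).prodMk (contDiff_snd.contDiffOn.add c2))
    refine (c1.mul c3).congr fun p hp => ?_
    simp only [hw, Function.comp_def]
    rw [goursatKernel_congr (hQ₀e.trans hQe.symm)]
    · simp only; linarith [hp.2]
    · simp only; linarith [hτ0 hp.1]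
  have hf0 : ∀ t ≤ 0, f t = 0 := fun t ht => hfε t (ht.trans hε.le)
  have hzero : ∀ x, 0 ≤ x → ∀ t, 0 ≤ t → t ≤ ε → wave ρ w f x t = 0 := by
    intro x hx t ht hte
    rw [wave, hfε _ (by linarith [hτ0 hx])]
    rw [intervalIntegral.integral_congr (g := fun _ => 0) fun s hs => ?_]
    · simp
    · have : s ≤ ε := by
        rcases mem_uIcc.1 hs with h | h <;> linarith [hτ0 hx, h.2]
      simp [hfε s this]
  refine ⟨?_, fun x hx t ht => ?_, fun x hx => hzero x hx 0 le_rfl hε.le, fun x hx => ?_,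
    fun t ht => ?_⟩
  · rw [contDiffOn_infty]
    intro n
    obtain ⟨Q, hQ, hQe⟩ := hext n
    have hn : ((n : ℕ) : WithTop ℕ∞) ≤ (∞ : WithTop ℕ∞) := by exact_mod_cast le_top
    have hsub : (Ici (0 : ℝ) ×ˢ Ici (0 : ℝ)) ⊆ Prod.fst ⁻¹' Ici 0 := fun p hp => hp.1
    have c1 : ContDiffOn ℝ n (fun p : ℝ × ℝ => amplitude ρ p.1) (Ici 0 ×ˢ Ici 0) :=
      (cσ.of_le hn).comp contDiff_fst.contDiffOn hsub
    have c2 : ContDiffOn ℝ n (fun p : ℝ × ℝ => eikonal ρ p.1) (Ici 0 ×ˢ Ici 0) :=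
      (cτ.of_le hn).comp contDiff_fst.contDiffOn hsub
    have c3 := (contDiff_charWave hQ (hf.of_le hn)).comp_contDiffOn
      ((contDiff_snd.contDiffOn.sub c2).prodMk (contDiff_snd.contDiffOn.add c2))
    exact (c1.mul c3).congr fun p hp => hwave hQe hf0 p.1 hp.1 p.2 hp.2
  · obtain ⟨Q, hQ, hQe⟩ := hext 2
    exact wave_eq_of_reduced hρ hpos hτ (by exact_mod_cast hQ) hQe
      (hf.of_le (WithTop.coe_le_coe.2 le_top)) (hwave hQe hf0) hx ht
  · have : HasDerivWithinAt (fun t' => wave ρ w f x t') 0 (Ici 0) 0 := by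
      refine (hasDerivWithinAt_const (0 : ℝ) (Ici 0) (0 : ℝ)).congr_of_eventuallyEq ?_
        (hzero x hx 0 le_rfl hε.le)
      filter_upwards [self_mem_nhdsWithin, mem_nhdsWithin_of_mem_nhds (Iio_mem_nhds hε)] with t h1 h2
      exact hzero x hx t h1 (le_of_lt h2)
    exact this.derivWithin (uniqueDiffOn_Ici 0 0 self_mem_Ici)
  · rw [hwave hQ₀e hf0 0 le_rfl t ht, amplitude_zero hpos, charWave]
    have : ∀ s, goursatKernel Q₀ (t - eikonal ρ 0 - s, t + eikonal ρ 0 - s) = 0 := fun s => by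
      simp [goursatKernel_diag hQ₀.continuous]
    simp only [this]
    simp

end Reduction

/-! ### The regular part of the fundamental solution near the boundary -/

/-- A function supported in a compact subset of `(0, T)` vanishes near `(-∞, 0]`. -/
theorem exists_eq_zero_near_zero {g : ℝ → ℝ} {T : ℝ} (hT : 0 < T) (hc : HasCompactSupport g)
    (hs : tsupport g ⊆ Ioo 0 T) : ∃ ε > 0, ε < T ∧ ∀ t ≤ ε, g t = 0 := by
  rcases (tsupport g).eq_empty_or_nonempty with h | h
  · exact ⟨T / 2, by linarith, by linarith, fun t _ => image_eq_zero_of_notMem_tsupport (by simp [h])⟩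
  · obtain ⟨m, hm, hmin⟩ := hc.isCompact.exists_isMinOn h continuousOn_id
    have hm' := hs hm
    refine ⟨m / 2, by linarith [hm'.1], by linarith [hm'.1, hm'.2], fun t ht => ?_⟩
    refine image_eq_zero_of_notMem_tsupport fun htm => ?_
    have : m ≤ t := hmin htm
    linarith [hm'.1]

/-- The kernel in the retarded variable: `ω(x, z) = w(x, τ(x) + z)`. -/
noncomputable def retardedKernel (ρ : ℝ → ℝ) (w : ℝ → ℝ → ℝ) (p : ℝ × ℝ) : ℝ :=
  w p.1 (eikonal ρ p.1 + p.2)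

/-- The response kernel `r(t) = w_x(0, t)`; it is written as a derivative of the retarded kernel,
which is smooth up to the corner of the quadrant, and frozen at `r(0)` for negative times. -/
noncomputable def responseKernel (ρ : ℝ → ℝ) (w : ℝ → ℝ → ℝ) (t : ℝ) : ℝ :=
  fderivWithin ℝ (retardedKernel ρ w) (Ici 0 ×ˢ Ici 0) (0, max t 0) (1, 0)

/-- The operator `-α F' + β F + r * F`, with `G` in the place of the derivative `F'`. -/
noncomputable def responseFun (ρ r F G : ℝ → ℝ) (t : ℝ) : ℝ :=
  -(ρ 0 ^ (1 / 2 : ℝ)) * G t + (-(4 * ρ 0)⁻¹ * derivWithin ρ (Ici 0) 0) * F t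
    + ∫ s in (0 : ℝ)..t, r (t - s) * F s

theorem uniqueDiffOn_quadrant : UniqueDiffOn ℝ (Ici (0 : ℝ) ×ˢ Ici (0 : ℝ)) :=
  (uniqueDiffOn_Ici 0).prod (uniqueDiffOn_Ici 0)

section

variable {ρ q : ℝ → ℝ} {w : ℝ → ℝ → ℝ}

theorem contDiffOn_retardedKernel (hρ : ContDiffOn ℝ ∞ ρ (Ici 0)) (hpos : ∀ x, 0 ≤ x → 0 < ρ x)
    (hw : IsFundamentalKernel ρ q w) :
    ContDiffOn ℝ ∞ (retardedKernel ρ w) (Ici 0 ×ˢ Ici 0) := by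
  have c2 : ContDiffOn ℝ ∞ (fun p : ℝ × ℝ => eikonal ρ p.1) (Ici 0 ×ˢ Ici 0) :=
    (contDiffOn_eikonal hρ hpos).comp contDiff_fst.contDiffOn fun p hp => hp.1
  exact hw.smooth.comp (contDiff_fst.contDiffOn.prodMk (c2.add contDiff_snd.contDiffOn))
    fun p hp => ⟨hp.1, by simpa using hp.2⟩

/-- The kernel vanishes on the boundary `x = 0`, since the first term of the Duhamel expression
already has the prescribed boundary value. -/
theorem kernel_boundary (hpos : ∀ x, 0 ≤ x → 0 < ρ x) (hw : IsFundamentalKernel ρ q w) {t : ℝ}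
    (ht : 0 ≤ t) : w 0 t = 0 := by
  have hcw : ContinuousOn (fun t => w 0 t) (Ici 0) :=
    hw.smooth.continuousOn.comp (by fun_prop : ContinuousOn (fun t : ℝ => ((0 : ℝ), t)) (Ici 0))
      fun t ht => ⟨le_rfl, by simpa using ht⟩
  have hpos' : ∀ t, 0 < t → EqOn (fun t => w 0 t) 0 (Ioo 0 t) := by
    intro T hT
    have hcont : ContinuousOn (fun s => w 0 (T - s)) (Ioo 0 T) :=
      hcw.comp (by fun_prop) fun s hs => by
        have := hs.2; simp only [mem_Ici]; linarith
    have h := IsOpen.ae_eq_zero_of_integral_contDiff_smul_eq_zero (μ := volume) isOpen_Ioo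
      (hcont.locallyIntegrableOn measurableSet_Ioo) fun g hg hgc hgs => ?_
    · have h2 := Measure.eqOn_open_of_ae_eq (μ := volume) (f := fun s => w 0 (T - s)) (g := 0)
        ((ae_restrict_iff' measurableSet_Ioo).2 h) isOpen_Ioo hcont continuousOn_const
      intro s hs
      have := h2 (show T - s ∈ Ioo 0 T from ⟨by linarith [hs.2], by linarith [hs.1]⟩)
      simpa using this
    · obtain ⟨ε, hε, -, hge⟩ := exists_eq_zero_near_zero hT hgc hgs
      have hb := (hw.duhamel g hg ⟨ε, hε, hge⟩).boundary T hT.le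
      have : ∫ s in (0 : ℝ)..T, w 0 (T - s) * g s = 0 := by
        simpa [wave, (hpos 0 le_rfl).ne'] using hb
      calc ∫ s, g s • w 0 (T - s) = ∫ s in Ioc 0 T, g s • w 0 (T - s) :=
            (setIntegral_eq_integral_of_forall_compl_eq_zero fun s hs => by
              rw [image_eq_zero_of_notMem_tsupport fun h => hs (Ioo_subset_Ioc_self (hgs h)),
                zero_smul]).symm
        _ = ∫ s in (0 : ℝ)..T, w 0 (T - s) * g s := by
            rw [intervalIntegral.integral_of_le hT.le]
            exact integral_congr_ae (Eventually.of_forall fun s => by simp [mul_comm])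
        _ = 0 := this
  have hIoi : EqOn (fun t => w 0 t) 0 (Ioi 0) := fun t ht =>
    hpos' (t + 1) (by linarith [mem_Ioi.1 ht]) ⟨ht, by linarith⟩
  exact hIoi.of_subset_closure hcw continuousOn_const Ioi_subset_Ici_self
    (by rw [closure_Ioi]) ht

theorem continuous_responseKernel (hρ : ContDiffOn ℝ ∞ ρ (Ici 0)) (hpos : ∀ x, 0 ≤ x → 0 < ρ x)
    (hw : IsFundamentalKernel ρ q w) :
    ContDiffOn ℝ ∞ (responseKernel ρ w) (Ici 0) ∧ Continuous (responseKernel ρ w) := by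
  have h1 : ContDiffOn ℝ ∞ (fun p => fderivWithin ℝ (retardedKernel ρ w) (Ici 0 ×ˢ Ici 0) p (1, 0))
      (Ici 0 ×ˢ Ici 0) :=
    ((contDiffOn_retardedKernel hρ hpos hw).fderivWithin (m := ∞) uniqueDiffOn_quadrant
      (by simp)).clm_apply contDiffOn_const
  constructor
  · refine (h1.comp (f := fun t : ℝ => ((0 : ℝ), t)) (by fun_prop) fun t ht =>
      ⟨self_mem_Ici, ht⟩).congr fun t ht => ?_
    simp [responseKernel, max_eq_left (show (0 : ℝ) ≤ t from ht)]
  · exact h1.continuousOn.comp_continuous (f := fun t : ℝ => ((0 : ℝ), max t 0)) (by fun_prop)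
      fun t => ⟨self_mem_Ici, le_max_right t 0⟩

theorem eventually_eikonal_lt (hρ : ContDiffOn ℝ ∞ ρ (Ici 0)) (hpos : ∀ x, 0 ≤ x → 0 < ρ x)
    {t : ℝ} (ht : 0 < t) : ∀ᶠ x in 𝓝[Ici 0] (0 : ℝ), eikonal ρ x < t := by
  have : Tendsto (eikonal ρ) (𝓝[Ici 0] 0) (𝓝 0) := by
    simpa [ContinuousWithinAt] using continuousOn_eikonal hρ hpos 0 self_mem_Ici
  exact this.eventually_lt_const ht

/-- `w_x(0, t) = r(t)`. -/
theorem hasDerivWithinAt_kernel (hρ : ContDiffOn ℝ ∞ ρ (Ici 0)) (hpos : ∀ x, 0 ≤ x → 0 < ρ x)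
    (hw : IsFundamentalKernel ρ q w) {t : ℝ} (ht : 0 < t) :
    HasDerivWithinAt (fun x => w x t) (responseKernel ρ w t) (Ici 0) 0 := by
  have hd := ((contDiffOn_retardedKernel hρ hpos hw).differentiableOn (by simp) (0, t)
    ⟨self_mem_Ici, ht.le⟩).hasFDerivWithinAt
  set A := fderivWithin ℝ (retardedKernel ρ w) (Ici 0 ×ˢ Ici 0) (0, t) with hA
  have hA2 : A (0, 1) = 0 := by
    have h1 : HasDerivWithinAt (fun z => retardedKernel ρ w (0, z)) (A (0, 1)) (Ici 0) t :=
      hd.comp_hasDerivWithinAt t ((hasDerivAt_const t (0 : ℝ)).prodMk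
        (hasDerivAt_id t)).hasDerivWithinAt fun z hz => ⟨self_mem_Ici, hz⟩
    have h2 : HasDerivWithinAt (fun z => retardedKernel ρ w (0, z)) 0 (Ici 0) t :=
      (hasDerivWithinAt_const t (Ici 0) (0 : ℝ)).congr
        (fun z hz => by simp [retardedKernel, kernel_boundary hpos hw hz])
        (by simp [retardedKernel, kernel_boundary hpos hw ht.le])
    exact (uniqueDiffOn_Ici 0 t ht.le).eq_deriv _ h1 h2
  have hτ := hasDerivWithinAt_eikonal hρ hpos (le_refl (0 : ℝ))
  have hcurve : HasDerivWithinAt (fun x => (x, t - eikonal ρ x)) (1, -(ρ 0 ^ (1 / 2 : ℝ)))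
      (Ici 0) 0 := (hasDerivWithinAt_id 0 _).prodMk (hτ.const_sub t)
  set s : Set ℝ := {x | 0 ≤ x ∧ eikonal ρ x ≤ t} with hs
  have hsn : s ∈ 𝓝[Ici 0] (0 : ℝ) := by
    filter_upwards [self_mem_nhdsWithin, eventually_eikonal_lt hρ hpos ht] with x h1 h2
    exact ⟨h1, h2.le⟩
  have hd' : HasFDerivWithinAt (retardedKernel ρ w) A (Ici 0 ×ˢ Ici 0) (0, t - eikonal ρ 0) := by
    simpa using hd
  have h3 : HasDerivWithinAt (fun x => retardedKernel ρ w (x, t - eikonal ρ x))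
      (A (1, -(ρ 0 ^ (1 / 2 : ℝ)))) s 0 :=
    hd'.comp_hasDerivWithinAt (f := fun x => (x, t - eikonal ρ x)) (0 : ℝ)
      (hcurve.mono fun x (hx : x ∈ s) => hx.1) fun x hx => ⟨hx.1, sub_nonneg.2 hx.2⟩
  have h4 := h3.mono_of_mem_nhdsWithin hsn
  have hval : A (1, -(ρ 0 ^ (1 / 2 : ℝ))) = responseKernel ρ w t := by
    rw [show ((1 : ℝ), -(ρ 0 ^ (1 / 2 : ℝ)))
        = ((1 : ℝ), (0 : ℝ)) + (-(ρ 0 ^ (1 / 2 : ℝ))) • ((0 : ℝ), (1 : ℝ)) by simp,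
      map_add, map_smul, hA2, responseKernel, max_eq_left ht.le]
    simp [hA]
  rw [hval] at h4
  have e : (fun x => retardedKernel ρ w (x, t - eikonal ρ x)) = fun x => w x t := by
    funext x; simp [retardedKernel]
  rwa [e] at h4

/-- Since the kernel vanishes on the boundary, it is `O(x)` on bounded parts of the wedge. -/
theorem exists_kernel_bound (hρ : ContDiffOn ℝ ∞ ρ (Ici 0)) (hpos : ∀ x, 0 ≤ x → 0 < ρ x)
    (hw : IsFundamentalKernel ρ q w) (X B : ℝ) :
    ∃ L, 0 ≤ L ∧ ∀ x t, 0 ≤ x → x ≤ X → eikonal ρ x ≤ t → t ≤ B → |w x t| ≤ L * x := by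
  obtain ⟨K, hK⟩ := ((contDiffOn_retardedKernel hρ hpos hw).mono
    (show Icc 0 X ×ˢ Icc 0 B ⊆ Ici 0 ×ˢ Ici 0 from
      prod_mono Icc_subset_Ici_self Icc_subset_Ici_self)).exists_lipschitzOnWith
      (by simp) ((convex_Icc 0 X).prod (convex_Icc 0 B)) (isCompact_Icc.prod isCompact_Icc)
  refine ⟨K, K.2, fun x t hx hxX ht htB => ?_⟩
  have hτ := eikonal_nonneg hρ hpos hx
  have hz : t - eikonal ρ x ∈ Icc 0 B := ⟨by linarith, by linarith⟩
  have := hK.dist_le_mul (x, t - eikonal ρ x) ⟨⟨hx, hxX⟩, hz⟩ (0, t - eikonal ρ x)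
    ⟨⟨le_rfl, hx.trans hxX⟩, hz⟩
  simpa [retardedKernel, Real.dist_eq, Prod.dist_eq, kernel_boundary hpos hw hz.1,
    abs_of_nonneg hx, max_eq_left hx] using this

theorem hasDerivWithinAt_amplitude (hρ : ContDiffOn ℝ ∞ ρ (Ici 0))
    (hpos : ∀ x, 0 ≤ x → 0 < ρ x) :
    HasDerivWithinAt (fun x => (ρ x / ρ 0) ^ (-(1 / 4) : ℝ))
      (-(4 * ρ 0)⁻¹ * derivWithin ρ (Ici 0) 0) (Ici 0) 0 := by
  have h0 := (hpos 0 le_rfl).ne'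
  have h := (((hρ.differentiableOn (by simp) 0 self_mem_Ici).hasDerivWithinAt).div_const
    (ρ 0)).rpow_const (p := (-(1 / 4) : ℝ)) (Or.inl (by simp [h0]))
  refine h.congr_deriv ?_
  rw [div_self h0, Real.one_rpow]
  field_simp

/-- The Duhamel integral is differentiable in `x` at the boundary; no smoothness of the control is
needed, since the kernel vanishes there. -/
theorem hasDerivWithinAt_duhamel_integral (hρ : ContDiffOn ℝ ∞ ρ (Ici 0))
    (hpos : ∀ x, 0 ≤ x → 0 < ρ x)
    (hw : IsFundamentalKernel ρ q w) {F : ℝ → ℝ} (hF : Continuous F) {t : ℝ} (ht : 0 < t) :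
    HasDerivWithinAt (fun x => ∫ s in (0 : ℝ)..(t - eikonal ρ x), w x (t - s) * F s)
      (∫ s in (0 : ℝ)..t, responseKernel ρ w (t - s) * F s) (Ici 0) 0 := by
  have hI0 : ∫ s in (0 : ℝ)..(t - eikonal ρ 0), w 0 (t - s) * F s = 0 := by
    rw [intervalIntegral.integral_congr (g := fun _ => 0) fun s hs => ?_]
    · simp
    · simp only [eikonal_zero, sub_zero] at hs
      rw [uIcc_of_le ht.le] at hs
      simp only
      rw [kernel_boundary hpos hw (by linarith [hs.2]), zero_mul]
  rw [hasDerivWithinAt_iff_tendsto_slope, Ici_sdiff_left]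
  obtain ⟨L, hL, hLb⟩ := exists_kernel_bound hρ hpos hw 1 t
  have hle : 𝓝[Ioi 0] (0 : ℝ) ≤ 𝓝[Ici 0] 0 := nhdsWithin_mono _ Ioi_subset_Ici_self
  have hx1 : ∀ᶠ x in 𝓝[Ioi 0] (0 : ℝ), 0 < x ∧ x ≤ 1 ∧ eikonal ρ x < t := by
    filter_upwards [self_mem_nhdsWithin, mem_nhdsWithin_of_mem_nhds (Iic_mem_nhds one_pos),
      hle (eventually_eikonal_lt hρ hpos ht)] with x h1 h2 h3
    exact ⟨h1, h2, h3⟩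
  have hslope : ∀ᶠ x in 𝓝[Ioi 0] (0 : ℝ),
      ∫ s in (0 : ℝ)..t, {s | s ≤ t - eikonal ρ x}.indicator
        (fun s => x⁻¹ * (w x (t - s) * F s)) s
      = slope (fun x => ∫ s in (0 : ℝ)..(t - eikonal ρ x), w x (t - s) * F s) 0 x := by
    filter_upwards [hx1] with x hx
    have hτ := eikonal_nonneg hρ hpos hx.1.le
    rw [intervalIntegral.integral_indicator ⟨by linarith [hx.2.2], by linarith⟩, slope_def_field,
      hI0, intervalIntegral.integral_const_mul]
    simp; ring
  refine Tendsto.congr' hslope ?_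
  refine intervalIntegral.tendsto_integral_filter_of_dominated_convergence (fun s => L * |F s|)
    ?_ ?_ ?_ ?_
  · filter_upwards [hx1] with x hx
    change AEStronglyMeasurable ((Iic (t - eikonal ρ x)).indicator _) _
    rw [aestronglyMeasurable_indicator_iff measurableSet_Iic, Measure.restrict_restrict
      measurableSet_Iic, uIoc_of_le ht.le]
    refine ContinuousOn.aestronglyMeasurable ?_ (measurableSet_Iic.inter measurableSet_Ioc)
    refine continuousOn_const.mul (ContinuousOn.mul ?_ hF.continuousOn)
    refine hw.smooth.continuousOn.comp (f := fun s => (x, t - s)) (by fun_prop) fun s hs => ?_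
    have : s ≤ t - eikonal ρ x := hs.1
    exact ⟨hx.1.le, by simp only; linarith⟩
  · filter_upwards [hx1] with x hx
    refine Eventually.of_forall fun s hs => ?_
    rw [uIoc_of_le ht.le] at hs
    by_cases h : s ≤ t - eikonal ρ x
    · rw [indicator_of_mem (show s ∈ {s | s ≤ t - eikonal ρ x} from h), norm_mul, norm_mul,
        norm_inv, Real.norm_eq_abs, Real.norm_eq_abs, Real.norm_eq_abs, abs_of_pos hx.1]
      have := hLb x (t - s) hx.1.le hx.2.1 (by linarith) (by linarith [hs.1])
      rw [inv_mul_le_iff₀ hx.1]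
      calc |w x (t - s)| * |F s| ≤ (L * x) * |F s| := by gcongr
        _ = _ := by ring
    · rw [indicator_of_notMem (show s ∉ {s | s ≤ t - eikonal ρ x} from h), norm_zero]
      positivity
  · exact (continuous_const.mul hF.abs).intervalIntegrable _ _
  · have hne : ∀ᵐ s : ℝ, s ≠ t := by simp [ae_iff, measure_singleton]
    filter_upwards [hne] with s hst hs
    rw [uIoc_of_le ht.le] at hs
    have hpos_s : 0 < t - s := sub_pos.2 (lt_of_le_of_ne hs.2 hst)
    have hd := hasDerivWithinAt_kernel hρ hpos hw hpos_s
    rw [hasDerivWithinAt_iff_tendsto_slope, Ici_sdiff_left] at hd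
    refine (hd.mul_const (F s)).congr' ?_
    filter_upwards [self_mem_nhdsWithin, hle (eventually_eikonal_lt hρ hpos hpos_s)] with x h1 h2
    rw [indicator_of_mem (show s ∈ {s | s ≤ t - eikonal ρ x} from
      show s ≤ t - eikonal ρ x by linarith), slope_def_field, kernel_boundary hpos hw hpos_s.le]
    simp; ring

/-- The `x`-derivative at the boundary of the wave generated by `F`. -/
theorem hasDerivWithinAt_wave (hρ : ContDiffOn ℝ ∞ ρ (Ici 0))
    (hpos : ∀ x, 0 ≤ x → 0 < ρ x)
    (hw : IsFundamentalKernel ρ q w) {F G : ℝ → ℝ} (hF : Continuous F) {t : ℝ} (ht : 0 < t)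
    (hd : HasDerivAt F (G t) t) :
    HasDerivWithinAt (fun x => wave ρ w F x t) (responseFun ρ (responseKernel ρ w) F G t)
      (Ici 0) 0 := by
  have h1 := hasDerivWithinAt_amplitude hρ hpos
  have hd' : HasDerivAt F (G t) (t - eikonal ρ 0) := by simpa using hd
  have h2 := hd'.comp_hasDerivWithinAt (0 : ℝ)
    ((hasDerivWithinAt_eikonal hρ hpos (le_refl (0 : ℝ))).const_sub t)
  refine ((h1.mul h2).add (hasDerivWithinAt_duhamel_integral hρ hpos hw hF ht)).congr_deriv ?_
  simp [responseFun, (hpos 0 le_rfl).ne']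
  ring

/-- Waves commute with differentiation in time. -/
theorem hasDerivAt_wave_time (hρ : ContDiffOn ℝ ∞ ρ (Ici 0))
    (hpos : ∀ x, 0 ≤ x → 0 < ρ x)
    (hw : IsFundamentalKernel ρ q w) {F : ℝ → ℝ} (hF : ContDiff ℝ 2 F) (hF0 : ∀ t ≤ 0, F t = 0)
    {x : ℝ} (hx : 0 ≤ x) (t : ℝ) :
    HasDerivAt (fun t => wave ρ w F x t) (wave ρ w (deriv F) x t) t := by
  have hslice : ContDiffOn ℝ (1 : ℕ) (fun z => retardedKernel ρ w (x, z)) (Ici 0) :=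
    ((contDiffOn_retardedKernel hρ hpos hw).comp (f := fun z : ℝ => (x, z)) (by fun_prop)
      fun z hz => ⟨hx, hz⟩).of_le (by exact_mod_cast le_top)
  obtain ⟨g, hg, hge⟩ := exists_contDiff_extension 1 hslice
  have hF' : ∀ t ≤ 0, deriv F t = 0 := by
    have hc : Continuous (deriv F) := hF.continuous_deriv (by norm_num)
    intro t ht
    have hlt : ∀ t < 0, deriv F t = 0 := fun t ht => by
      have : F =ᶠ[𝓝 t] fun _ => 0 := by
        filter_upwards [eventually_lt_nhds ht] with s hs using hF0 s hs.le
      rw [this.deriv_eq]; simp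
    have hcl : IsClosed {t | deriv F t = 0} := isClosed_eq hc continuous_const
    have : closure (Iio (0 : ℝ)) ⊆ {t | deriv F t = 0} := hcl.closure_subset_iff.2 hlt
    rw [closure_Iio] at this
    exact this ht
  have hrepr : ∀ H : ℝ → ℝ, (∀ t ≤ 0, H t = 0) → ∀ t, wave ρ w H x t
      = (ρ x / ρ 0) ^ (-(1 / 4) : ℝ) * H (t - eikonal ρ x)
        + ∫ z in (0 : ℝ)..(t - eikonal ρ x), g z * H (t - eikonal ρ x - z) := by
    intro H hH t
    rw [wave]
    congr 1
    have := intervalIntegral.integral_comp_sub_left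
      (fun z => g z * H (t - eikonal ρ x - z)) (t - eikonal ρ x) (a := 0) (b := t - eikonal ρ x)
    rw [sub_self, sub_zero] at this
    rw [← this]
    refine intervalIntegral.integral_congr fun s hs => ?_
    simp only [sub_sub_cancel]
    rcases le_total 0 (t - eikonal ρ x) with h | h
    · rw [uIcc_of_le h] at hs
      rw [hge (show t - eikonal ρ x - s ∈ Ici 0 by simpa using hs.2)]
      simp only [retardedKernel]
      congr 2; ring
    · rw [uIcc_of_ge h] at hs
      rw [hH s hs.2]; simp
  rw [hrepr _ hF']
  simp only [hrepr _ hF0]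
  have hτt : HasDerivAt (fun t => t - eikonal ρ x) 1 t := (hasDerivAt_id t).sub_const _
  have hFd : ∀ s, HasDerivAt F (deriv F s) s := fun s =>
    (hF.differentiable (by norm_num) s).hasDerivAt
  have hg1 : ContDiff ℝ 1 g := by exact_mod_cast hg
  refine HasDerivAt.add ?_ ?_
  · have := ((hFd (t - eikonal ρ x)).comp t hτt).const_mul ((ρ x / ρ 0) ^ (-(1 / 4) : ℝ))
    simpa using this
  · have h := hasDerivAt_parametric_integral (G := fun p => g p.2 * F (p.1 - eikonal ρ x - p.2))
      (G' := fun p => g p.2 * deriv F (p.1 - eikonal ρ x - p.2)) (b := fun t => t - eikonal ρ x)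
      (x := t)
      ((hg1.comp contDiff_snd).mul ((hF.of_le (by norm_num)).comp (by fun_prop)))
      (fun y z => ?_) hτt
    · simpa [hF0 0 le_rfl] using h
    · have := ((hFd (y - eikonal ρ x - z)).comp y
        (((hasDerivAt_id y).sub_const (eikonal ρ x)).sub_const z)).const_mul (g z)
      simpa using this

end

/-! ### Green's identity -/

/-- The partial derivative `∂U/∂x` on the closed quadrant. -/
noncomputable def partialX (U : ℝ × ℝ → ℝ) (p : ℝ × ℝ) : ℝ :=
  fderivWithin ℝ U (Ici 0 ×ˢ Ici 0) p (1, 0)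

/-- The partial derivative `∂U/∂t` on the closed quadrant. -/
noncomputable def partialT (U : ℝ × ℝ → ℝ) (p : ℝ × ℝ) : ℝ :=
  fderivWithin ℝ U (Ici 0 ×ˢ Ici 0) p (0, 1)

section

variable {U P : ℝ × ℝ → ℝ}

theorem contDiffOn_partialX (hU : ContDiffOn ℝ ∞ U (Ici 0 ×ˢ Ici 0)) :
    ContDiffOn ℝ ∞ (partialX U) (Ici 0 ×ˢ Ici 0) :=
  (hU.fderivWithin (m := ∞) uniqueDiffOn_quadrant (by simp)).clm_apply contDiffOn_const

theorem contDiffOn_partialT (hU : ContDiffOn ℝ ∞ U (Ici 0 ×ˢ Ici 0)) :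
    ContDiffOn ℝ ∞ (partialT U) (Ici 0 ×ˢ Ici 0) :=
  (hU.fderivWithin (m := ∞) uniqueDiffOn_quadrant (by simp)).clm_apply contDiffOn_const

theorem hasDerivWithinAt_partialX (hU : ContDiffOn ℝ ∞ U (Ici 0 ×ˢ Ici 0)) {x t : ℝ}
    (hx : 0 ≤ x) (ht : 0 ≤ t) :
    HasDerivWithinAt (fun x => U (x, t)) (partialX U (x, t)) (Ici 0) x :=
  ((hU.differentiableOn (by simp) (x, t) ⟨hx, ht⟩).hasFDerivWithinAt).comp_hasDerivWithinAt
    (f := fun x => (x, t)) x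
    ((hasDerivAt_id x).prodMk (hasDerivAt_const x t)).hasDerivWithinAt fun _ hy => ⟨hy, ht⟩

theorem hasDerivWithinAt_partialT (hU : ContDiffOn ℝ ∞ U (Ici 0 ×ˢ Ici 0)) {x t : ℝ}
    (hx : 0 ≤ x) (ht : 0 ≤ t) :
    HasDerivWithinAt (fun t => U (x, t)) (partialT U (x, t)) (Ici 0) t :=
  ((hU.differentiableOn (by simp) (x, t) ⟨hx, ht⟩).hasFDerivWithinAt).comp_hasDerivWithinAt
    (f := fun t => (x, t)) t
    ((hasDerivAt_const t x).prodMk (hasDerivAt_id t)).hasDerivWithinAt fun _ hy => ⟨hx, hy⟩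

theorem hasDerivAt_partialX (hU : ContDiffOn ℝ ∞ U (Ici 0 ×ˢ Ici 0)) {x t : ℝ}
    (hx : 0 < x) (ht : 0 ≤ t) : HasDerivAt (fun x => U (x, t)) (partialX U (x, t)) x :=
  (hasDerivWithinAt_partialX hU hx.le ht).hasDerivAt (Ici_mem_nhds hx)

theorem hasDerivAt_partialT (hU : ContDiffOn ℝ ∞ U (Ici 0 ×ˢ Ici 0)) {x t : ℝ}
    (hx : 0 ≤ x) (ht : 0 < t) : HasDerivAt (fun t => U (x, t)) (partialT U (x, t)) t :=
  (hasDerivWithinAt_partialT hU hx ht.le).hasDerivAt (Ici_mem_nhds ht)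

theorem hasDerivAt_partialT_reflect (hU : ContDiffOn ℝ ∞ U (Ici 0 ×ˢ Ici 0)) {x t c : ℝ}
    (hx : 0 ≤ x) (ht : t < c) :
    HasDerivAt (fun t => U (x, c - t)) (-partialT U (x, c - t)) t := by
  have := (hasDerivAt_partialT hU hx (sub_pos.2 ht)).comp t ((hasDerivAt_id t).const_sub c)
  simpa [Function.comp_def] using this

/-- Green's identity for a solution `P` with zero Cauchy data which vanishes beyond `X` up to the
time `T`, and the odd part (with respect to `t = T`) of a solution `U` whose boundary values are
even with respect to `t = T`. -/
theorem green_identity {ρ q : ℝ → ℝ} {X T : ℝ} (hX : 0 ≤ X) (hT : 0 ≤ T)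
    (hU : ContDiffOn ℝ ∞ U (Ici 0 ×ˢ Ici 0)) (hP : ContDiffOn ℝ ∞ P (Ici 0 ×ˢ Ici 0))
    (eU : ∀ x, 0 < x → ∀ t, 0 < t →
      ρ x * partialT (partialT U) (x, t) - partialX (partialX U) (x, t) + q x * U (x, t) = 0)
    (eP : ∀ x, 0 < x → ∀ t, 0 < t →
      ρ x * partialT (partialT P) (x, t) - partialX (partialX P) (x, t) + q x * P (x, t) = 0)
    (P0 : ∀ x, 0 ≤ x → P (x, 0) = 0) (P1 : ∀ x, 0 ≤ x → partialT P (x, 0) = 0)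
    (PX : ∀ t, 0 ≤ t → t ≤ T → P (X, t) = 0)
    (PX' : ∀ t, 0 ≤ t → t ≤ T → partialX P (X, t) = 0)
    (Ub : ∀ t, 0 ≤ t → t ≤ T → U (0, 2 * T - t) = U (0, t)) :
    2 * ∫ x in (0 : ℝ)..X, ρ x * (partialT U (x, T) * P (x, T))
      = -∫ t in (0 : ℝ)..T, (partialX U (0, t) - partialX U (0, 2 * T - t)) * P (0, t) := by
  have hUx := contDiffOn_partialX hU
  have hUt := contDiffOn_partialT hU
  have hUxx := contDiffOn_partialX hUx
  have hUtt := contDiffOn_partialT hUt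
  have hPx := contDiffOn_partialX hP
  have hPt := contDiffOn_partialT hP
  have hPxx := contDiffOn_partialX hPx
  have hPtt := contDiffOn_partialT hPt
  -- the common value of the `t`-divergence and of the `x`-divergence
  set H : ℝ × ℝ → ℝ := fun p =>
    (partialX (partialX U) p - partialX (partialX U) (p.1, 2 * T - p.2)) * P p
      - (U p - U (p.1, 2 * T - p.2)) * partialX (partialX P) p with hH
  have crect : ∀ {V : ℝ × ℝ → ℝ}, ContDiffOn ℝ ∞ V (Ici 0 ×ˢ Ici 0) →
      ContinuousOn V (Icc 0 X ×ˢ Icc 0 T) := fun hV =>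
    hV.continuousOn.mono (prod_mono Icc_subset_Ici_self Icc_subset_Ici_self)
  have crect' : ∀ {V : ℝ × ℝ → ℝ}, ContDiffOn ℝ ∞ V (Ici 0 ×ˢ Ici 0) →
      ContinuousOn (fun p : ℝ × ℝ => V (p.1, 2 * T - p.2)) (Icc 0 X ×ˢ Icc 0 T) := fun hV =>
    hV.continuousOn.comp (f := fun p : ℝ × ℝ => (p.1, 2 * T - p.2)) (by fun_prop)
      fun p ⟨h1, h2⟩ => ⟨h1.1, show (0 : ℝ) ≤ 2 * T - p.2 by linarith [h2.2]⟩
  have cH : ContinuousOn H (Icc 0 X ×ˢ Icc 0 T) :=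
    (((crect hUxx).sub (crect' hUxx)).mul (crect hP)).sub
      (((crect hU).sub (crect' hU)).mul (crect hPxx))
  -- sections of functions continuous on the rectangle
  have ct : ∀ {V : ℝ × ℝ → ℝ}, ContinuousOn V (Icc 0 X ×ˢ Icc 0 T) → ∀ {x}, x ∈ Icc 0 X →
      ContinuousOn (fun t => V (x, t)) (Icc 0 T) := fun hV x hx =>
    hV.comp (by fun_prop : ContinuousOn (fun t : ℝ => (x, t)) (Icc 0 T)) fun t ht => ⟨hx, ht⟩
  have cx : ∀ {V : ℝ × ℝ → ℝ}, ContinuousOn V (Icc 0 X ×ˢ Icc 0 T) → ∀ {t}, t ∈ Icc 0 T →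
      ContinuousOn (fun x => V (x, t)) (Icc 0 X) := fun hV t ht =>
    hV.comp (by fun_prop : ContinuousOn (fun x : ℝ => (x, t)) (Icc 0 X)) fun x hx => ⟨hx, ht⟩
  have hswap : ∫ x in (0 : ℝ)..X, ∫ t in (0 : ℝ)..T, H (x, t)
      = ∫ t in (0 : ℝ)..T, ∫ x in (0 : ℝ)..X, H (x, t) := by
    refine intervalIntegral_intervalIntegral_swap (F := fun x t => H (x, t)) ?_
    rw [uIoc_of_le hX, uIoc_of_le hT]
    exact (cH.integrableOn_compact (isCompact_Icc.prod isCompact_Icc)).mono_set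
      (prod_mono Ioc_subset_Icc_self Ioc_subset_Icc_self)
  have hA : ∀ x ∈ Ioc 0 X, ∫ t in (0 : ℝ)..T, H (x, t)
      = 2 * (ρ x * (partialT U (x, T) * P (x, T))) := by
    intro x hx
    have hxI : x ∈ Icc 0 X := ⟨hx.1.le, hx.2⟩
    have := intervalIntegral.integral_eq_sub_of_hasDerivAt_of_le hT
      (f := fun t => ρ x * ((partialT U (x, t) + partialT U (x, 2 * T - t)) * P (x, t)
        - (U (x, t) - U (x, 2 * T - t)) * partialT P (x, t))) (f' := fun t => H (x, t)) ?_ ?_ ?_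
    · rw [this, P0 x hx.1.le, P1 x hx.1.le, show 2 * T - T = T by ring]
      ring
    · exact continuousOn_const.mul
        ((((ct (crect hUt) hxI).add (ct (crect' hUt) hxI)).mul (ct (crect hP) hxI)).sub
          (((ct (crect hU) hxI).sub (ct (crect' hU) hxI)).mul (ct (crect hPt) hxI)))
    · intro t ht
      have htc : t < 2 * T := by linarith [ht.1, ht.2]
      have h := ((((hasDerivAt_partialT hUt hx.1.le ht.1).add
        (hasDerivAt_partialT_reflect hUt hx.1.le htc)).mul (hasDerivAt_partialT hP hx.1.le ht.1)).sub
        (((hasDerivAt_partialT hU hx.1.le ht.1).sub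
          (hasDerivAt_partialT_reflect hU hx.1.le htc)).mul
            (hasDerivAt_partialT hPt hx.1.le ht.1))).const_mul (ρ x)
      refine h.congr_deriv ?_
      have e1 := eU x hx.1 t ht.1
      have e2 := eU x hx.1 (2 * T - t) (by linarith)
      have e3 := eP x hx.1 t ht.1
      simp only [hH, Pi.add_apply, Pi.sub_apply]
      linear_combination P (x, t) * e1 - P (x, t) * e2 - (U (x, t) - U (x, 2 * T - t)) * e3
    · exact (ct cH hxI).intervalIntegrable_of_Icc hT
  have hB : ∀ t ∈ Ioc 0 T, ∫ x in (0 : ℝ)..X, H (x, t)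
      = -((partialX U (0, t) - partialX U (0, 2 * T - t)) * P (0, t)) := by
    intro t ht
    have htI : t ∈ Icc 0 T := ⟨ht.1.le, ht.2⟩
    have := intervalIntegral.integral_eq_sub_of_hasDerivAt_of_le hX
      (f := fun x => (partialX U (x, t) - partialX U (x, 2 * T - t)) * P (x, t)
        - (U (x, t) - U (x, 2 * T - t)) * partialX P (x, t)) (f' := fun x => H (x, t)) ?_ ?_ ?_
    · rw [this, PX t ht.1.le ht.2, PX' t ht.1.le ht.2, Ub t ht.1.le ht.2]
      ring
    · exact (((cx (crect hUx) htI).sub (cx (crect' hUx) htI)).mul (cx (crect hP) htI)).sub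
        (((cx (crect hU) htI).sub (cx (crect' hU) htI)).mul (cx (crect hPx) htI))
    · intro x hx
      have htc : 0 ≤ 2 * T - t := by linarith [ht.2]
      have h := (((hasDerivAt_partialX hUx hx.1 ht.1.le).sub
        (hasDerivAt_partialX hUx hx.1 htc)).mul (hasDerivAt_partialX hP hx.1 ht.1.le)).sub
        (((hasDerivAt_partialX hU hx.1 ht.1.le).sub
          (hasDerivAt_partialX hU hx.1 htc)).mul (hasDerivAt_partialX hPx hx.1 ht.1.le))
      refine h.congr_deriv ?_
      simp only [hH, Pi.sub_apply]
      ring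
    · exact (cx cH htI).intervalIntegrable_of_Icc hX
  rw [← intervalIntegral.integral_const_mul, ← intervalIntegral.integral_neg]
  calc _ = ∫ x in (0 : ℝ)..X, ∫ t in (0 : ℝ)..T, H (x, t) :=
        intervalIntegral.integral_congr_ae (Eventually.of_forall fun x hx =>
          (hA x (by rwa [uIoc_of_le hX] at hx)).symm)
    _ = _ := hswap
    _ = _ := intervalIntegral.integral_congr_ae (Eventually.of_forall fun t ht =>
          hB t (by rwa [uIoc_of_le hT] at ht))

end

theorem IsClassicalSolution.partial_wave_eq {ρ q f : ℝ → ℝ} {u : ℝ → ℝ → ℝ}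
    (h : IsClassicalSolution ρ q f u) {x t : ℝ} (hx : 0 < x) (ht : 0 < t) :
    ρ x * partialT (partialT fun p => u p.1 p.2) (x, t)
      - partialX (partialX fun p => u p.1 p.2) (x, t) + q x * u x t = 0 := by
  have hs := h.smooth
  rw [← h.wave_eq x hx t ht]
  rw [iteratedDeriv_two_eq (g := fun t' => u x t')
      (g' := fun s => partialT (fun p => u p.1 p.2) (x, s))
      ((eventually_gt_nhds ht).mono fun s hs' => hasDerivAt_partialT hs hx.le hs')
      (hasDerivAt_partialT (contDiffOn_partialT hs) hx.le ht),
    iteratedDeriv_two_eq (g := fun x' => u x' t)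
      (g' := fun s => partialX (fun p => u p.1 p.2) (s, t))
      ((eventually_gt_nhds hx).mono fun s hs' => hasDerivAt_partialX hs hs' ht.le)
      (hasDerivAt_partialX (contDiffOn_partialX hs) hx ht.le)]

/-! ### The Gram form of the control operator on smooth controls -/

section

variable {ρ q : ℝ → ℝ} {w : ℝ → ℝ → ℝ}

/-- Finite speed of propagation. -/
theorem wave_eq_zero {g : ℝ → ℝ} {ε : ℝ} (hε : 0 ≤ ε) (hg : ∀ t ≤ ε, g t = 0) {x t : ℝ}
    (h : t - eikonal ρ x ≤ ε) : wave ρ w g x t = 0 := by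
  rw [wave, hg _ h, intervalIntegral.integral_congr (g := fun _ => 0) fun s hs => ?_]
  · simp
  · have : s ≤ ε := by rcases mem_uIcc.1 hs with h' | h' <;> linarith [h'.2]
    simp [hg s this]

/-- The integral over `(0, t)` of a function odd with respect to `T` is even with respect to
`T`. -/
theorem integral_eq_of_odd {G : ℝ → ℝ} {T : ℝ} (hG : ∀ a b, IntervalIntegrable G volume a b)
    {t : ℝ} (hodd : ∀ᵐ s, s ∈ uIoc t (2 * T - t) → G (2 * T - s) = -G s) :
    ∫ s in (0 : ℝ)..(2 * T - t), G s = ∫ s in (0 : ℝ)..t, G s := by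
  have h1 := intervalIntegral.integral_comp_sub_left G (2 * T) (a := t) (b := 2 * T - t)
  rw [sub_sub_cancel, intervalIntegral.integral_congr_ae (g := fun s => -G s) hodd,
    intervalIntegral.integral_neg] at h1
  have h2 : ∫ s in t..(2 * T - t), G s = 0 := by linarith
  rw [← intervalIntegral.integral_add_adjacent_intervals (hG 0 t) (hG t (2 * T - t)), h2, add_zero]

theorem oddExtFun_eq_sub {f : ℝ → ℝ} {T : ℝ} (hf : ∀ t, T ≤ t → f t = 0) :
    oddExtFun T f = fun t => f t - f (2 * T - t) := by
  funext t
  by_cases h : t ≤ T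
  · simp [oddExtFun, h, hf (2 * T - t) (by linarith)]
  · simp [oddExtFun, h, hf t (not_le.1 h).le]

/-- The bilinear form `(W f, W g)` of smooth controls, through the boundary values of waves. -/
theorem integral_wave_mul_wave (hρ : ContDiffOn ℝ ∞ ρ (Ici 0)) (hpos : ∀ x, 0 ≤ x → 0 < ρ x)
    (hτ : Tendsto (eikonal ρ) atTop atTop) (hw : IsFundamentalKernel ρ q w) {T : ℝ} (hT : 0 < T)
    {f g : ℝ → ℝ} (hf : ContDiff ℝ ∞ f) (hfc : HasCompactSupport f) (hfs : tsupport f ⊆ Ioo 0 T)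
    (hg : ContDiff ℝ ∞ g) (hgc : HasCompactSupport g) (hgs : tsupport g ⊆ Ioo 0 T) :
    2 * ∫ x in (0 : ℝ)..eikonalInv ρ T, ρ x * (wave ρ w f x T * wave ρ w g x T)
      = -∫ t in (0 : ℝ)..T,
        (responseFun ρ (responseKernel ρ w) (fun t => ∫ s in (0 : ℝ)..t, oddExtFun T f s)
            (oddExtFun T f) t
          - responseFun ρ (responseKernel ρ w) (fun t => ∫ s in (0 : ℝ)..t, oddExtFun T f s)
            (oddExtFun T f) (2 * T - t)) * g t := by
  obtain ⟨ε, hε, hεT, hfε⟩ := exists_eq_zero_near_zero hT hfc hfs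
  obtain ⟨δ, hδ, hδT, hgδ⟩ := exists_eq_zero_near_zero hT hgc hgs
  have hfT : ∀ t, T ≤ t → f t = 0 := fun t ht => by
    refine image_eq_zero_of_notMem_tsupport fun h => ?_
    linarith [(hfs h).2]
  have hG := oddExtFun_eq_sub hfT
  set G := oddExtFun T f with hGdef
  have hGsm : ContDiff ℝ ∞ G := by rw [hG]; fun_prop
  have hG0 : ∀ t ≤ ε, G t = 0 := fun t ht => by
    rw [hG]; simp [hfε t ht, hfT (2 * T - t) (by linarith)]
  set F : ℝ → ℝ := fun t => ∫ s in (0 : ℝ)..t, G s with hFdef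
  have hFd : ∀ t, HasDerivAt F (G t) t := fun t =>
    (hGsm.continuous.integral_hasStrictDerivAt 0 t).hasDerivAt
  have hFsm : ContDiff ℝ ∞ F := by
    rw [contDiff_infty_iff_deriv]
    refine ⟨fun t => (hFd t).differentiableAt, ?_⟩
    rwa [show deriv F = G from funext fun t => (hFd t).deriv]
  have hF0 : ∀ t ≤ ε, F t = 0 := fun t ht => by
    simp only [hFdef]
    rw [intervalIntegral.integral_congr (g := fun _ => 0) fun s hs => ?_]
    · simp
    · refine hG0 s ?_
      rcases mem_uIcc.1 hs with h | h <;> linarith [h.2]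
  have hFeven : ∀ t, F (2 * T - t) = F t := fun t =>
    integral_eq_of_odd (fun a b => hGsm.continuous.intervalIntegrable a b)
      (Eventually.of_forall fun s _ => by rw [hG]; simp)
  have hu := hw.duhamel F hFsm ⟨ε, hε, hF0⟩
  have hp := hw.duhamel g hg ⟨δ, hδ, hgδ⟩
  obtain ⟨hX0, hXT⟩ := eikonalInv_spec hρ hpos hτ hT.le
  set X := eikonalInv ρ T
  have hXpos : 0 < X := by
    rcases hX0.eq_or_lt with h | h
    · rw [← h, eikonal_zero] at hXT; exact absurd hXT hT.ne
    · exact h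
  -- up to the time `T` the wave `u^g` does not reach a neighbourhood of `x(T)`
  have hnear : ∀ t ≤ T, ∀ᶠ x in 𝓝 X, wave ρ w g x t = 0 := by
    intro t ht
    have hc : ContinuousAt (eikonal ρ) X := (hasDerivAt_eikonal hρ hpos hXpos).continuousAt
    filter_upwards [hc.eventually_const_lt (show T - δ < eikonal ρ X by linarith)] with x hx
    exact wave_eq_zero hδ.le hgδ (by linarith)
  have key := green_identity (ρ := ρ) (q := q) (U := fun p => wave ρ w F p.1 p.2)
    (P := fun p => wave ρ w g p.1 p.2) hX0 hT.le hu.smooth hp.smooth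
    (fun x hx t ht => hu.partial_wave_eq hx ht) (fun x hx t ht => hp.partial_wave_eq hx ht)
    hp.init (fun x hx => ?_) (fun t _ ht => (hnear t ht).self_of_nhds) (fun t ht0 ht => ?_)
    (fun t ht0 ht => ?_)
  · have e1 : ∀ x, 0 ≤ x → partialT (fun p => wave ρ w F p.1 p.2) (x, T) = wave ρ w f x T := by
      intro x hx
      have h1 := hasDerivAt_partialT hu.smooth hx hT
      have h2 := hasDerivAt_wave_time hρ hpos hw (hFsm.of_le (WithTop.coe_le_coe.2 le_top))
        (fun t ht => hF0 t (ht.trans hε.le)) hx T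
      rw [h1.unique h2, show deriv F = G from funext fun t => (hFd t).deriv]
      have hle : ∀ s, s ≤ T → G s = f s := fun s hs => by
        rw [hG]; simp [hfT (2 * T - s) (by linarith)]
      have hτx := eikonal_nonneg hρ hpos hx
      rw [wave, wave, hle _ (by linarith)]
      congr 1
      refine intervalIntegral.integral_congr fun s hs => ?_
      have : s ≤ T := by rcases mem_uIcc.1 hs with h | h <;> linarith [h.2]
      simp only [hle s this]
    have e2 : ∀ t, 0 < t → partialX (fun p => wave ρ w F p.1 p.2) (0, t)
        = responseFun ρ (responseKernel ρ w) F G t := by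
      intro t ht
      have h1 := hasDerivWithinAt_partialX hu.smooth le_rfl ht.le
      have h2 := hasDerivWithinAt_wave hρ hpos hw hFsm.continuous ht (hFd t)
      exact (uniqueDiffOn_Ici 0 0 self_mem_Ici).eq_deriv _ h1 h2
    have e3 : ∫ x in (0 : ℝ)..X, ρ x * (wave ρ w f x T * wave ρ w g x T)
        = ∫ x in (0 : ℝ)..X, ρ x * (partialT (fun p => wave ρ w F p.1 p.2) (x, T)
          * wave ρ w g x T) := by
      refine intervalIntegral.integral_congr fun x hx => ?_
      rw [uIcc_of_le hX0] at hx
      simp only [e1 x hx.1]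
    rw [e3, key]
    congr 1
    refine intervalIntegral.integral_congr_ae (Eventually.of_forall fun t ht => ?_)
    rw [uIoc_of_le hT.le] at ht
    rw [e2 t ht.1, e2 (2 * T - t) (by linarith [ht.2])]
    simp only [hp.boundary t ht.1.le]
  · exact ((hasDerivWithinAt_partialT hp.smooth hx le_rfl).derivWithin
      (uniqueDiffOn_Ici 0 0 self_mem_Ici)).symm.trans (hp.init_vel x hx)
  · have h1 := hasDerivAt_partialX hp.smooth hXpos ht0
    have h2 : HasDerivAt (fun x => wave ρ w g x t) 0 X :=
      (hasDerivAt_const X (0 : ℝ)).congr_of_eventuallyEq (hnear t ht)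
    exact h1.unique h2
  · have h1 := hu.boundary t ht0
    have h2 := hu.boundary (2 * T - t) (by linarith)
    simp only [h1, h2, hFeven]

end

/-! ### Bounded operators between `L₂` spaces -/

/-- Integral operators with bounded kernels are bounded in `L₂` over finite measures. -/
theorem exists_integral_operator {μ ν : Measure ℝ} [IsFiniteMeasure μ] [IsFiniteMeasure ν]
    {k : ℝ → ℝ → ℝ} (hk : Measurable (Function.uncurry k)) {C : ℝ} (hC : ∀ x y, |k x y| ≤ C) :
    ∃ A : Lp ℝ 2 ν →L[ℝ] Lp ℝ 2 μ, ∀ f : Lp ℝ 2 ν,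
      ∀ᵐ x ∂μ, A f x = ∫ y, k x y * f y ∂ν := by
  have hC0 : 0 ≤ C := (abs_nonneg _).trans (hC 0 0)
  have hkx : ∀ x, MemLp (k x) 2 ν := fun x =>
    MemLp.of_bound (hk.of_uncurry_left (x := x)).aestronglyMeasurable C
      (Eventually.of_forall (hC x))
  have hinner : ∀ x (f : Lp ℝ 2 ν), inner ℝ ((hkx x).toLp (k x)) f = ∫ y, k x y * f y ∂ν := by
    intro x f
    rw [L2.inner_def]
    refine integral_congr_ae ?_
    filter_upwards [(hkx x).coeFn_toLp] with y hy
    rw [hy]; simp [mul_comm]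
  set D : ℝ := measureUnivNNReal ν ^ (2 : ℝ≥0∞).toReal⁻¹ * C with hD
  have hD0 : 0 ≤ D := by positivity
  have hbound : ∀ x (f : Lp ℝ 2 ν), ‖inner ℝ ((hkx x).toLp (k x)) f‖ ≤ D * ‖f‖ := by
    intro x f
    refine (norm_inner_le_norm _ _).trans ?_
    gcongr
    refine Lp.norm_le_of_ae_bound hC0 ?_
    filter_upwards [(hkx x).coeFn_toLp] with y hy
    rw [hy]; exact hC x y
  have hmem : ∀ f : Lp ℝ 2 ν, MemLp (fun x => inner ℝ ((hkx x).toLp (k x)) f) 2 μ := by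
    intro f
    refine MemLp.of_bound ?_ (D * ‖f‖) (Eventually.of_forall fun x => hbound x f)
    simp only [hinner]
    exact (hk.aestronglyMeasurable.mul
      ((Lp.aestronglyMeasurable f).comp_snd (μ := μ))).integral_prod_right'
  refine ⟨LinearMap.mkContinuous
    { toFun := fun f => (hmem f).toLp _
      map_add' := fun f g => by
        rw [← MemLp.toLp_add]
        exact MemLp.toLp_congr _ _ (Eventually.of_forall fun x => inner_add_right _ _ _)
      map_smul' := fun c f => by
        rw [RingHom.id_apply, ← MemLp.toLp_const_smul]
        exact MemLp.toLp_congr _ _ (Eventually.of_forall fun x => inner_smul_right _ _ _) }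
    (measureUnivNNReal μ ^ (2 : ℝ≥0∞).toReal⁻¹ * D) fun f => ?_, fun f => ?_⟩
  · rw [mul_assoc]
    refine Lp.norm_le_of_ae_bound (by positivity) ?_
    filter_upwards [(hmem f).coeFn_toLp] with x hx
    simp only [LinearMap.coe_mk, AddHom.coe_mk, hx]
    exact hbound x f
  · filter_upwards [(hmem f).coeFn_toLp] with x hx
    rw [← hinner, ← hx]
    rfl

/-- Weighted composition operators are bounded in `L₂` if the push-forward of the measure is
dominated. -/
theorem exists_composition_operator {μ ν : Measure ℝ} {φ m : ℝ → ℝ} (hφ : Measurable φ)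
    {c : ℝ≥0∞} (hc : c ≠ ⊤) (hmap : μ.map φ ≤ c • ν) (hm : AEStronglyMeasurable m μ) {C : ℝ}
    (hC : ∀ᵐ x ∂μ, ‖m x‖ ≤ C) :
    ∃ B : Lp ℝ 2 ν →L[ℝ] Lp ℝ 2 μ, ∀ f : Lp ℝ 2 ν, ∀ᵐ x ∂μ, B f x = m x * f (φ x) := by
  have hq : Measure.QuasiMeasurePreserving φ μ ν :=
    ⟨hφ, hmap.absolutelyContinuous.trans (Measure.AbsolutelyContinuous.rfl.smul_left _)⟩
  have hle : ∀ f : Lp ℝ 2 ν, eLpNorm (fun x => m x * f (φ x)) 2 μ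
      ≤ ENNReal.ofReal C * (c ^ (1 / (2 : ℝ)) * eLpNorm f 2 ν) := by
    intro f
    have h2 : AEStronglyMeasurable f (μ.map φ) :=
      (Lp.aestronglyMeasurable f).mono_ac hq.absolutelyContinuous
    calc eLpNorm (fun x => m x * f (φ x)) 2 μ
        ≤ ENNReal.ofReal C * eLpNorm (f ∘ φ) 2 μ := by
          refine eLpNorm_le_mul_eLpNorm_of_ae_le_mul ?_ 2
          filter_upwards [hC] with x hx
          rw [norm_mul]
          exact mul_le_mul_of_nonneg_right hx (norm_nonneg _)
      _ = ENNReal.ofReal C * eLpNorm f 2 (μ.map φ) := by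
          rw [eLpNorm_map_measure h2 hφ.aemeasurable]
      _ ≤ ENNReal.ofReal C * eLpNorm f 2 (c • ν) := by
          gcongr
      _ = _ := by rw [eLpNorm_smul_measure_of_ne_top (by norm_num)]; simp
  have hctop : c ^ (1 / (2 : ℝ)) ≠ ⊤ := ENNReal.rpow_ne_top_of_nonneg (by norm_num) hc
  have hmem : ∀ f : Lp ℝ 2 ν, MemLp (fun x => m x * f (φ x)) 2 μ := fun f =>
    ⟨hm.mul ((Lp.aestronglyMeasurable f).comp_quasiMeasurePreserving hq),
      (hle f).trans_lt (ENNReal.mul_lt_top ENNReal.ofReal_lt_top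
        (ENNReal.mul_lt_top hctop.lt_top (Lp.memLp f).2))⟩
  refine ⟨LinearMap.mkContinuous
    { toFun := fun f => (hmem f).toLp _
      map_add' := fun f g => by
        rw [← MemLp.toLp_add]
        refine MemLp.toLp_congr _ _ ?_
        filter_upwards [hq.ae_eq_comp (Lp.coeFn_add f g)] with x hx
        simp only [Function.comp_apply, Pi.add_apply] at hx ⊢
        rw [hx]; ring
      map_smul' := fun a f => by
        rw [RingHom.id_apply, ← MemLp.toLp_const_smul]
        refine MemLp.toLp_congr _ _ ?_
        filter_upwards [hq.ae_eq_comp (Lp.coeFn_smul a f)] with x hx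
        simp only [Function.comp_apply, Pi.smul_apply, smul_eq_mul] at hx ⊢
        rw [hx]; ring }
    ((ENNReal.ofReal C).toReal * (c ^ (1 / (2 : ℝ))).toReal) fun f => ?_, fun f => ?_⟩
  · simp only [LinearMap.coe_mk, AddHom.coe_mk, Lp.norm_def]
    rw [eLpNorm_congr_ae (MemLp.coeFn_toLp _), mul_assoc, ← ENNReal.toReal_mul,
      ← ENNReal.toReal_mul]
    exact ENNReal.toReal_mono (ENNReal.mul_ne_top ENNReal.ofReal_ne_top
      (ENNReal.mul_ne_top hctop (Lp.memLp f).2.ne)) (hle f)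
  · filter_upwards [(hmem f).coeFn_toLp] with x hx
    simp only [LinearMap.mkContinuous_apply, LinearMap.coe_mk, AddHom.coe_mk, hx]

/-- An element of `L₂(0, T)` which is orthogonal to all test functions is zero. -/
theorem eq_zero_of_inner_test {T : ℝ} (h : OuterSpace T)
    (hh : ∀ (g : ℝ → ℝ) (hg : MemLp g 2 (volume.restrict (Ioo (0 : ℝ) T))), ContDiff ℝ ∞ g →
      HasCompactSupport g → tsupport g ⊆ Ioo 0 T → inner ℝ h (hg.toLp g) = 0) : h = 0 := by
  have hi : IntegrableOn h (Ioo 0 T) := (Lp.memLp h).integrable (by norm_num)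
  have h0 := IsOpen.ae_eq_zero_of_integral_contDiff_smul_eq_zero (μ := volume) isOpen_Ioo
    hi.locallyIntegrableOn fun g hg hgc hgs => ?_
  · refine Lp.ext ?_
    filter_upwards [(ae_restrict_iff' measurableSet_Ioo).2 h0, Lp.coeFn_zero ℝ 2
      (volume.restrict (Ioo (0 : ℝ) T))] with x hx hx0
    rw [hx, hx0]; rfl
  · have hm : MemLp g 2 (volume.restrict (Ioo (0 : ℝ) T)) :=
      (hg.continuous.memLp_of_hasCompactSupport hgc).restrict _
    have := hh g hm hg hgc hgs
    rw [L2.inner_def] at this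
    rw [← setIntegral_eq_integral_of_forall_compl_eq_zero (s := Ioo 0 T) fun s hs => by
      rw [image_eq_zero_of_notMem_tsupport fun h => hs (hgs h), zero_smul]]
    refine Eq.trans (integral_congr_ae ?_) this
    filter_upwards [hm.coeFn_toLp] with x hx
    rw [hx]; simp

/-! ### The control operator -/

section

variable {ρ q : ℝ → ℝ} {w : ℝ → ℝ → ℝ}

theorem ae_innerMeasure_mem (T : ℝ) :
    ∀ᵐ x ∂(innerMeasure ρ T), x ∈ Ioo 0 (eikonalInv ρ T) :=
  (withDensity_absolutelyContinuous _ _).ae_le (ae_restrict_mem measurableSet_Ioo)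

theorem exists_density_bound (hρ : ContDiffOn ℝ ∞ ρ (Ici 0)) (X : ℝ) :
    ∃ M, ∀ x ∈ Icc 0 X, |ρ x| ≤ M :=
  isCompact_Icc.exists_bound_of_continuousOn (hρ.continuousOn.mono Icc_subset_Ici_self)

theorem isFiniteMeasure_innerMeasure (hρ : ContDiffOn ℝ ∞ ρ (Ici 0)) (T : ℝ) :
    IsFiniteMeasure (innerMeasure ρ T) := by
  obtain ⟨M, hM⟩ := exists_density_bound hρ (eikonalInv ρ T)
  refine isFiniteMeasure_withDensity (ne_of_lt ?_)
  calc ∫⁻ x in Ioo 0 (eikonalInv ρ T), ENNReal.ofReal (ρ x)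
      ≤ ∫⁻ _ in Ioo 0 (eikonalInv ρ T), ENNReal.ofReal M :=
        setLIntegral_mono measurable_const fun x hx =>
          ENNReal.ofReal_le_ofReal ((le_abs_self _).trans (hM x (Ioo_subset_Icc_self hx)))
    _ < ⊤ := by
      rw [setLIntegral_const]
      exact ENNReal.mul_lt_top ENNReal.ofReal_lt_top (by simp)

theorem eikonal_mem_Ioo (hρ : ContDiffOn ℝ ∞ ρ (Ici 0)) (hpos : ∀ x, 0 ≤ x → 0 < ρ x)
    (hτ : Tendsto (eikonal ρ) atTop atTop) {T : ℝ} (hT : 0 < T) {x : ℝ}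
    (hx : x ∈ Ioo 0 (eikonalInv ρ T)) : T - eikonal ρ x ∈ Ioo 0 T := by
  obtain ⟨h0, hX⟩ := eikonalInv_spec hρ hpos hτ hT.le
  have h1 := strictMonoOn_eikonal hρ hpos (self_mem_Ici) hx.1.le hx.1
  have h2 := strictMonoOn_eikonal hρ hpos hx.1.le h0 hx.2
  rw [eikonal_zero] at h1
  rw [hX] at h2
  exact ⟨by linarith, by linarith⟩

/-- The retarded time `x ↦ T - τ(x)` pushes `ρ dx` forward to a measure dominated by a multiple of
`dt`; `e` extends the eikonal to the line. -/
theorem map_retarded_time_le (hρ : ContDiffOn ℝ ∞ ρ (Ici 0)) (hpos : ∀ x, 0 ≤ x → 0 < ρ x)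
    (hτ : Tendsto (eikonal ρ) atTop atTop) {T : ℝ} (hT : 0 < T) {e : ℝ → ℝ} (he : Continuous e)
    (hee : ∀ x, 0 ≤ x → e x = eikonal ρ x) :
    ∃ c : ℝ≥0∞, c ≠ ⊤ ∧ (innerMeasure ρ T).map (fun x => T - e x)
      ≤ c • volume.restrict (Ioo (0 : ℝ) T) := by
  set X := eikonalInv ρ T
  have hsq : ContinuousOn (fun x => ρ x ^ (1 / 2 : ℝ)) (Ici 0) :=
    (contDiffOn_sqrt_density hρ hpos).continuousOn
  obtain ⟨M, hM⟩ := (isCompact_Icc (a := 0) (b := X)).exists_bound_of_continuousOn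
    (hsq.mono Icc_subset_Ici_self)
  refine ⟨ENNReal.ofReal M, ENNReal.ofReal_ne_top, Measure.le_iff.2 fun s hs => ?_⟩
  have hφ : Measurable fun x => T - e x := (continuous_const.sub he).measurable
  rw [Measure.map_apply hφ hs, Measure.smul_apply, Measure.restrict_apply hs, innerMeasure,
    withDensity_apply _ (hφ hs), Measure.restrict_restrict (hφ hs), smul_eq_mul]
  set A := (fun x => T - e x) ⁻¹' s ∩ Ioo 0 X with hA
  have hAm : MeasurableSet A := (hφ hs).inter measurableSet_Ioo
  have hA0 : ∀ x ∈ A, 0 ≤ x := fun x hx => hx.2.1.le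
  calc ∫⁻ x in A, ENNReal.ofReal (ρ x)
      ≤ ∫⁻ x in A, ENNReal.ofReal M * ENNReal.ofReal (ρ x ^ (1 / 2 : ℝ)) := by
        refine setLIntegral_mono' hAm fun x hx => ?_
        have hx0 := hpos x (hA0 x hx)
        have h1 : ρ x ^ (1 / 2 : ℝ) ≤ M :=
          (le_abs_self _).trans (hM x (Ioo_subset_Icc_self hx.2))
        have h2 : 0 < ρ x ^ (1 / 2 : ℝ) := Real.rpow_pos_of_pos hx0 _
        rw [← ENNReal.ofReal_mul (h2.le.trans h1)]
        refine ENNReal.ofReal_le_ofReal ?_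
        calc ρ x = ρ x ^ (1 / 2 : ℝ) * ρ x ^ (1 / 2 : ℝ) := by
              rw [← Real.rpow_add hx0]; norm_num
          _ ≤ _ := by gcongr
    _ = ENNReal.ofReal M * ∫⁻ x in A, ENNReal.ofReal (-(-(ρ x ^ (1 / 2 : ℝ)))) := by
        rw [lintegral_const_mul' _ _ ENNReal.ofReal_ne_top]; simp
    _ = ENNReal.ofReal M * volume ((fun x => T - e x) '' A) := by
        rw [lintegral_deriv_eq_volume_image_of_antitoneOn hAm]
        · intro x hx
          have hx0 : 0 < x := hx.2.1
          refine HasDerivAt.hasDerivWithinAt ?_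
          refine ((hasDerivAt_eikonal hρ hpos hx0).congr_of_eventuallyEq ?_).const_sub T
          filter_upwards [eventually_gt_nhds hx0] with y hy using hee y hy.le
        · intro x hx y hy hxy
          have := (strictMonoOn_eikonal hρ hpos).monotoneOn (hA0 x hx) (hA0 y hy) hxy
          simp only [hee x (hA0 x hx), hee y (hA0 y hy)]
          linarith
    _ ≤ _ := by
        gcongr
        rintro _ ⟨x, hx, rfl⟩
        refine ⟨hx.1, ?_⟩
        simp only [hee x (hA0 x hx)]
        exact eikonal_mem_Ioo hρ hpos hτ hT hx.2

/-- The control operator is bounded.  It can be evaluated on any representative `F` of the control,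
since the wave at time `T` depends on the class of `F` in `L₂(0, T)` only. -/
theorem exists_control_operator (hρ : ContDiffOn ℝ ∞ ρ (Ici 0)) (hpos : ∀ x, 0 ≤ x → 0 < ρ x)
    (hτ : Tendsto (eikonal ρ) atTop atTop) (hw : IsFundamentalKernel ρ q w) {T : ℝ}
    (hT : 0 < T) :
    ∃ W : OuterSpace T →L[ℝ] InnerSpace ρ T, ∀ (f : OuterSpace T) (F : ℝ → ℝ),
      f =ᵐ[volume.restrict (Ioo (0 : ℝ) T)] F →
      ∀ᵐ x ∂(innerMeasure ρ T), W f x = wave ρ w F x T := by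
  obtain ⟨hX0, hXT⟩ := eikonalInv_spec hρ hpos hτ hT.le
  set X := eikonalInv ρ T
  obtain ⟨g, hg, hgpos, hge⟩ := exists_pos_extension hρ hpos 0
  set e : ℝ → ℝ := fun x => ∫ s in (0 : ℝ)..x, g s with hedef
  have he : Continuous e := continuous_iff_continuousAt.2 fun x =>
    (hg.continuous.integral_hasStrictDerivAt 0 x).hasDerivAt.continuousAt
  have hee : ∀ x, 0 ≤ x → e x = eikonal ρ x := fun x hx => (eikonal_eq_of_eqOn hge hx).symm
  obtain ⟨c, hc, hmap⟩ := map_retarded_time_le hρ hpos hτ hT he hee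
  have hφ : Measurable fun x => T - e x := (continuous_const.sub he).measurable
  have hfin := isFiniteMeasure_innerMeasure hρ T
  have hq : Measure.QuasiMeasurePreserving (fun x => T - e x) (innerMeasure ρ T)
      (volume.restrict (Ioo (0 : ℝ) T)) :=
    ⟨hφ, hmap.absolutelyContinuous.trans (Measure.AbsolutelyContinuous.rfl.smul_left _)⟩
  -- the singular part
  have hσ : ContinuousOn (fun x => (ρ x / ρ 0) ^ (-(1 / 4) : ℝ)) (Ici 0) :=
    (contDiffOn_amplitude hρ hpos).continuousOn
  obtain ⟨M, hM⟩ := (isCompact_Icc (a := 0) (b := X)).exists_bound_of_continuousOn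
    (hσ.mono Icc_subset_Ici_self)
  obtain ⟨B, hB⟩ := exists_composition_operator (m := fun x => (ρ x / ρ 0) ^ (-(1 / 4) : ℝ)) hφ hc
    hmap (((hσ.mono (Ioo_subset_Icc_self.trans Icc_subset_Ici_self)).aestronglyMeasurable
      measurableSet_Ioo).mono_ac (withDensity_absolutelyContinuous _ _)) (C := M) (by
      filter_upwards [ae_innerMeasure_mem T] with x hx using hM x (Ioo_subset_Icc_self hx))
  -- the regular part
  set D : Set (ℝ × ℝ) := {p | 0 ≤ p.1 ∧ p.1 ≤ X ∧ 0 ≤ p.2 ∧ e p.1 ≤ T - p.2} with hD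
  have hDm : MeasurableSet D := by
    have h1 : IsClosed {p : ℝ × ℝ | 0 ≤ p.1} := isClosed_le continuous_const continuous_fst
    have h2 : IsClosed {p : ℝ × ℝ | p.1 ≤ X} := isClosed_le continuous_fst continuous_const
    have h3 : IsClosed {p : ℝ × ℝ | 0 ≤ p.2} := isClosed_le continuous_const continuous_snd
    have h4 : IsClosed {p : ℝ × ℝ | e p.1 ≤ T - p.2} :=
      isClosed_le (he.comp continuous_fst) (continuous_const.sub continuous_snd)
    exact (h1.inter (h2.inter (h3.inter h4))).measurableSet
  set k : ℝ × ℝ → ℝ := D.piecewise (fun p => w p.1 (T - p.2)) (fun _ => 0) with hk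
  have hkm : Measurable k := by
    refine ContinuousOn.measurable_piecewise ?_ continuousOn_const hDm
    refine hw.smooth.continuousOn.comp (f := fun p : ℝ × ℝ => (p.1, T - p.2)) (by fun_prop)
      fun p hp => ⟨hp.1, ?_⟩
    simp only [← hee p.1 hp.1]
    exact hp.2.2.2
  obtain ⟨L, hL, hLb⟩ := exists_kernel_bound hρ hpos hw X T
  have hkb : ∀ x y, |k (x, y)| ≤ L * X := by
    intro x y
    by_cases h : (x, y) ∈ D
    · rw [hk, piecewise_eq_of_mem _ _ _ h]
      have h4 : eikonal ρ x ≤ T - y := by rw [← hee x h.1]; exact h.2.2.2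
      refine (hLb x (T - y) h.1 h.2.1 h4 (by linarith [h.2.2.1])).trans ?_
      exact mul_le_mul_of_nonneg_left h.2.1 hL
    · rw [hk, piecewise_eq_of_notMem _ _ _ h, abs_zero]
      positivity
  obtain ⟨A, hA⟩ := exists_integral_operator (μ := innerMeasure ρ T)
    (ν := volume.restrict (Ioo (0 : ℝ) T)) (k := fun x y => k (x, y)) hkm hkb
  refine ⟨B + A, fun f F hfF => ?_⟩
  filter_upwards [hA f, hB f, ae_innerMeasure_mem T, hq.ae_eq_comp hfF,
    Lp.coeFn_add (B f) (A f)] with x hxA hxB hx hxF hxadd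
  have hmem := eikonal_mem_Ioo hρ hpos hτ hT hx
  rw [_root_.add_apply, hxadd, Pi.add_apply, hxA, hxB, wave]
  simp only [Function.comp_apply, hee x hx.1.le] at hxF ⊢
  rw [hxF]
  congr 1
  rw [intervalIntegral.integral_of_le hmem.1.le, integral_Ioc_eq_integral_Ioo]
  have hsub : Ioo 0 (T - eikonal ρ x) ⊆ Ioo 0 T := Ioo_subset_Ioo_right hmem.2.le
  calc ∫ y in Ioo 0 T, k (x, y) * f y
      = ∫ y in Ioo 0 T, k (x, y) * F y := by
        refine integral_congr_ae ?_
        filter_upwards [hfF] with y hy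
        rw [hy]
    _ = ∫ y in Ioo 0 (T - eikonal ρ x), k (x, y) * F y := by
        refine setIntegral_eq_of_subset_of_ae_sdiff_eq_zero (f := fun y => k (x, y) * F y)
          measurableSet_Ioo.nullMeasurableSet hsub ?_
        have hne : ∀ᵐ y : ℝ, y ≠ T - eikonal ρ x := by simp [ae_iff, measure_singleton]
        filter_upwards [hne] with y hy hyd
        have : (x, y) ∉ D := fun h => by
          have h4 := h.2.2.2
          simp only [hee x hx.1.le] at h4
          exact hyd.2 ⟨hyd.1.1, lt_of_le_of_ne (by linarith) hy⟩
        rw [hk, piecewise_eq_of_notMem _ _ _ this, zero_mul]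
    _ = ∫ y in Ioo 0 (T - eikonal ρ x), w x (T - y) * F y := by
        refine setIntegral_congr_fun measurableSet_Ioo fun y hy => ?_
        have : (x, y) ∈ D := ⟨hx.1.le, hx.2.le, hy.1.le, by
          simp only [hee x hx.1.le]; linarith [hy.2]⟩
        simp only [hk, piecewise_eq_of_mem _ _ _ this]

/-- The inner product of `L₂(ρ dx)` as an interval integral. -/
theorem integral_innerMeasure (hρ : ContDiffOn ℝ ∞ ρ (Ici 0)) (hpos : ∀ x, 0 ≤ x → 0 < ρ x)
    (hτ : Tendsto (eikonal ρ) atTop atTop) {T : ℝ} (hT : 0 < T) (F : ℝ → ℝ) :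
    ∫ x, F x ∂(innerMeasure ρ T) = ∫ x in (0 : ℝ)..eikonalInv ρ T, ρ x * F x := by
  obtain ⟨hX0, -⟩ := eikonalInv_spec hρ hpos hτ hT.le
  have hm : AEMeasurable (fun x => ENNReal.ofReal (ρ x))
      (volume.restrict (Ioo (0 : ℝ) (eikonalInv ρ T))) :=
    ((hρ.continuousOn.mono (Ioo_subset_Icc_self.trans Icc_subset_Ici_self)).aemeasurable
      measurableSet_Ioo).ennreal_ofReal
  rw [innerMeasure, integral_withDensity_eq_integral_toReal_smul₀ hm
    (Eventually.of_forall fun _ => ENNReal.ofReal_lt_top),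
    intervalIntegral.integral_of_le hX0, integral_Ioc_eq_integral_Ioo]
  refine setIntegral_congr_fun measurableSet_Ioo fun x hx => ?_
  simp only [ENNReal.toReal_ofReal (hpos x hx.1.le).le, smul_eq_mul]

end

/-! ### The response operator -/

theorem ae_hasDerivAt_primitive {a : ℝ} (g : OuterSpace a) :
    ∀ᵐ t, HasDerivAt (primitive a g) (zeroExt a g t) t := by
  filter_upwards [LocallyIntegrable.ae_hasDerivAt_integral
    (integrable_zeroExt g).locallyIntegrable] with t ht
  exact ht 0

theorem coeFn_integrationOp {a : ℝ} (g : OuterSpace a) :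
    integrationOp a g =ᵐ[volume.restrict (Ioo (0 : ℝ) a)] primitive a g :=
  (memLp_primitive g).coeFn_toLp

theorem hasL2Deriv_iff {a : ℝ} {f g : OuterSpace a} :
    HasL2Deriv a f g ↔ f = integrationOp a g := by
  constructor
  · intro h
    refine Lp.ext (EventuallyEq.trans ?_ (coeFn_integrationOp g).symm)
    exact h
  · rintro rfl
    exact coeFn_integrationOp g

theorem integrationOp_injective (a : ℝ) : Function.Injective (integrationOp a) := by
  rw [injective_iff_map_eq_zero]
  intro g hg
  have h0 : primitive a g =ᵐ[volume.restrict (Ioo (0 : ℝ) a)] 0 := by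
    refine (coeFn_integrationOp g).symm.trans ?_
    rw [hg]
    exact Lp.coeFn_zero ℝ 2 _
  have h1 : EqOn (primitive a g) 0 (Ioo 0 a) := Measure.eqOn_open_of_ae_eq h0 isOpen_Ioo
    (continuous_primitive g).continuousOn continuousOn_const
  refine Lp.ext ?_
  filter_upwards [ae_restrict_of_ae (ae_hasDerivAt_primitive g), ae_restrict_mem measurableSet_Ioo,
    Lp.coeFn_zero ℝ 2 (volume.restrict (Ioo (0 : ℝ) a))] with t ht htm hz
  have h2 : primitive a g =ᶠ[𝓝 t] fun _ => 0 := by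
    filter_upwards [isOpen_Ioo.mem_nhds htm] with s hs using h1 hs
  have h3 := ht.unique ((hasDerivAt_const t (0 : ℝ)).congr_of_eventuallyEq h2)
  rw [zeroExt, indicator_of_mem htm] at h3
  rw [h3, hz]; rfl

/-- Convolution on `(0, a)` with a continuous function is bounded in `L₂(0, a)`. -/
theorem exists_convolution_operator {r : ℝ → ℝ} (hr : Continuous r) (a : ℝ) :
    ∃ A : OuterSpace a →L[ℝ] OuterSpace a, ∀ f : OuterSpace a,
      ∀ᵐ t ∂(volume.restrict (Ioo (0 : ℝ) a)), A f t = ∫ s in (0 : ℝ)..t, r (t - s) * f s := by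
  set D : Set (ℝ × ℝ) := {p | 0 ≤ p.2 ∧ p.2 ≤ p.1 ∧ p.1 ≤ a} with hD
  have hDm : MeasurableSet D := by
    have h1 : IsClosed {p : ℝ × ℝ | 0 ≤ p.2} := isClosed_le continuous_const continuous_snd
    have h2 : IsClosed {p : ℝ × ℝ | p.2 ≤ p.1} := isClosed_le continuous_snd continuous_fst
    have h3 : IsClosed {p : ℝ × ℝ | p.1 ≤ a} := isClosed_le continuous_fst continuous_const
    exact (h1.inter (h2.inter h3)).measurableSet
  obtain ⟨C, hC⟩ := (isCompact_Icc (a := 0) (b := a)).exists_bound_of_continuousOn hr.continuousOn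
  set k : ℝ × ℝ → ℝ := D.indicator fun p => r (p.1 - p.2) with hk
  have hkm : Measurable k := (hr.comp (by fun_prop)).measurable.indicator hDm
  have hkb : ∀ x y, |k (x, y)| ≤ max C 0 := by
    intro x y
    by_cases h : (x, y) ∈ D
    · rw [hk, indicator_of_mem h]
      exact (hC (x - y) ⟨sub_nonneg.2 h.2.1, by linarith [h.1, h.2.2]⟩).trans (le_max_left _ _)
    · rw [hk, indicator_of_notMem h, abs_zero]
      exact le_max_right _ _
  obtain ⟨A, hA⟩ := exists_integral_operator (μ := volume.restrict (Ioo (0 : ℝ) a))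
    (ν := volume.restrict (Ioo (0 : ℝ) a)) (k := fun x y => k (x, y)) hkm hkb
  refine ⟨A, fun f => ?_⟩
  filter_upwards [hA f, ae_restrict_mem measurableSet_Ioo] with t ht htm
  rw [ht, intervalIntegral.integral_of_le htm.1.le, integral_Ioc_eq_integral_Ioo]
  have hsub : Ioo 0 t ⊆ Ioo 0 a := Ioo_subset_Ioo_right htm.2.le
  calc ∫ s in Ioo 0 a, k (t, s) * f s = ∫ s in Ioo 0 t, k (t, s) * f s := by
        refine setIntegral_eq_of_subset_of_ae_sdiff_eq_zero (f := fun y => k (t, y) * f y)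
          measurableSet_Ioo.nullMeasurableSet hsub ?_
        have hne : ∀ᵐ y : ℝ, y ≠ t := by simp [ae_iff, measure_singleton]
        filter_upwards [hne] with y hy hyd
        have : (t, y) ∉ D := fun h => hyd.2 ⟨hyd.1.1, lt_of_le_of_ne h.2.1 hy⟩
        rw [hk, indicator_of_notMem this, zero_mul]
    _ = ∫ s in Ioo 0 t, r (t - s) * f s := by
        refine setIntegral_congr_fun measurableSet_Ioo fun y hy => ?_
        have : (t, y) ∈ D := ⟨hy.1.le, hy.2.le, htm.2.le⟩
        simp only [hk, indicator_of_mem this]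

/-- The operator `f ↦ -α f_t + β f + r * f` with the domain `{f ∈ H¹[0, a] | f(0) = 0}`. -/
theorem exists_response_operator (ρ : ℝ → ℝ) {r : ℝ → ℝ} (hr : Continuous r) (a : ℝ) :
    ∃ R : OuterSpace a →ₗ.[ℝ] OuterSpace a, (∀ f, f ∈ R.domain ↔ ∃ g, HasL2Deriv a f g) ∧
      ∀ (f : R.domain) (g : OuterSpace a), HasL2Deriv a f g →
        ∀ᵐ t ∂(volume.restrict (Ioo (0 : ℝ) a)),
          R f t = responseFun ρ r (primitive a g) (zeroExt a g) t := by
  obtain ⟨A, hA⟩ := exists_convolution_operator hr a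
  set J := integrationOp a
  set e := LinearEquiv.ofInjective J (integrationOp_injective a)
  set c₁ : ℝ := -(ρ 0 ^ (1 / 2 : ℝ))
  set c₂ : ℝ := -(4 * ρ 0)⁻¹ * derivWithin ρ (Ici 0) 0
  set P : OuterSpace a →ₗ[ℝ] OuterSpace a :=
    c₁ • LinearMap.id + c₂ • J + (A : OuterSpace a →ₗ[ℝ] OuterSpace a) ∘ₗ J with hP
  refine ⟨⟨LinearMap.range J, P ∘ₗ e.symm.toLinearMap⟩, fun f => ?_, fun f g hfg => ?_⟩
  · change f ∈ LinearMap.range J ↔ _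
    simp only [LinearMap.mem_range, hasL2Deriv_iff]
    exact ⟨fun ⟨g, hg⟩ => ⟨g, hg.symm⟩, fun ⟨g, hg⟩ => ⟨g, hg.symm⟩⟩
  · have hf : f = e g := Subtype.ext (hasL2Deriv_iff.1 hfg)
    have hval : P (e.symm f) = c₁ • g + c₂ • J g + A (J g) := by
      rw [hf, e.symm_apply_apply, hP]; rfl
    change ∀ᵐ t ∂(volume.restrict (Ioo (0 : ℝ) a)), P (e.symm f) t = _
    rw [hval]
    filter_upwards [Lp.coeFn_add (c₁ • g + c₂ • J g) (A (J g)), Lp.coeFn_add (c₁ • g) (c₂ • J g),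
      Lp.coeFn_smul c₁ g, Lp.coeFn_smul c₂ (J g), hA (J g), coeFn_integrationOp g,
      ae_restrict_mem measurableSet_Ioo] with t h1 h2 h3 h4 h5 h6 htm
    rw [h1, Pi.add_apply, h2, Pi.add_apply, h3, h4, h5, Pi.smul_apply, Pi.smul_apply, h6,
      responseFun, zeroExt, indicator_of_mem htm]
    congr 1
    refine intervalIntegral.integral_congr_ae ?_
    filter_upwards [(ae_restrict_iff' measurableSet_Ioo).1 (coeFn_integrationOp g)] with s hs hst
    rw [uIoc_of_le htm.1.le] at hst
    rw [hs ⟨hst.1, hst.2.trans_lt htm.2⟩]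

theorem isExtendedResponseOp_of_responseFun {ρ q : ℝ → ℝ} {w : ℝ → ℝ → ℝ} {T : ℝ}
    (hρ : ContDiffOn ℝ ∞ ρ (Ici 0)) (hpos : ∀ x, 0 ≤ x → 0 < ρ x)
    (hw : IsFundamentalKernel ρ q w) {R : OuterSpace (2 * T) →ₗ.[ℝ] OuterSpace (2 * T)}
    (hdom : ∀ f, f ∈ R.domain ↔ ∃ g, HasL2Deriv (2 * T) f g)
    (hR : ∀ (f : R.domain) (g : OuterSpace (2 * T)), HasL2Deriv (2 * T) f g →
        ∀ᵐ t ∂(volume.restrict (Ioo (0 : ℝ) (2 * T))),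
          R f t = responseFun ρ (responseKernel ρ w) (primitive (2 * T) g) (zeroExt (2 * T) g) t) :
    IsExtendedResponseOp ρ w T R := by
  refine ⟨hdom, fun f g hfg => ?_⟩
  filter_upwards [hR f g hfg, ae_restrict_of_ae (ae_hasDerivAt_primitive g),
    ae_restrict_mem measurableSet_Ioo] with t h1 h2 htm
  rw [h1]
  exact hasDerivWithinAt_wave hρ hpos hw (continuous_primitive g) htm.1 h2

theorem isResponseKernel_of_responseFun {ρ r : ℝ → ℝ} {T : ℝ}
    {R : OuterSpace (2 * T) →ₗ.[ℝ] OuterSpace (2 * T)} (hr : ContDiffOn ℝ ∞ r (Icc 0 (2 * T)))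
    (hR : ∀ (f : R.domain) (g : OuterSpace (2 * T)), HasL2Deriv (2 * T) f g →
        ∀ᵐ t ∂(volume.restrict (Ioo (0 : ℝ) (2 * T))),
          R f t = responseFun ρ r (primitive (2 * T) g) (zeroExt (2 * T) g) t) :
    IsResponseKernel ρ T R r := by
  refine ⟨hr, fun f g hfg => ?_⟩
  filter_upwards [hR f g hfg, hfg, ae_restrict_mem measurableSet_Ioo] with t h1 h2 htm
  rw [h1, h2, responseFun, zeroExt, indicator_of_mem htm]
  congr 1
  refine intervalIntegral.integral_congr_ae ?_
  filter_upwards [(ae_restrict_iff' measurableSet_Ioo).1 hfg] with s hs hst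
  rw [uIoc_of_le htm.1.le] at hst
  rw [hs ⟨hst.1, hst.2.trans_lt htm.2⟩]

/-! ### The response to even controls -/

/-- Integration by parts in a convolution with an absolutely continuous function. -/
theorem integral_mul_primitive {r G : ℝ → ℝ} (hr : Continuous r)
    (hG : ∀ a b, IntervalIntegrable G volume a b) (t : ℝ) :
    ∫ s in (0 : ℝ)..t, r (t - s) * ∫ z in (0 : ℝ)..s, G z
      = ∫ s in (0 : ℝ)..t, (∫ z in (0 : ℝ)..(t - s), r z) * G s := by
  have hd : ∀ s, HasDerivAt (fun s => -∫ z in (0 : ℝ)..(t - s), r z) (r (t - s)) s := fun s => by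
    have := ((hr.integral_hasStrictDerivAt 0 (t - s)).hasDerivAt.comp s
      ((hasDerivAt_id s).const_sub t)).neg
    exact this.congr_deriv (by simp)
  have hsm : ContDiff ℝ 1 fun s => -∫ z in (0 : ℝ)..(t - s), r z := by
    rw [contDiff_one_iff_deriv]
    refine ⟨fun s => (hd s).differentiableAt, ?_⟩
    rw [show deriv (fun s => -∫ z in (0 : ℝ)..(t - s), r z) = fun s => r (t - s) from
      funext fun s => (hd s).deriv]
    fun_prop
  have h := AbsolutelyContinuousOnInterval.integral_mul_deriv_eq_deriv_mul
    ((hG 0 t).absolutelyContinuousOnInterval_intervalIntegral (c := 0) (by simp))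
    (hsm.contDiffOn.absolutelyContinuousOnInterval (a := 0) (b := t))
  simp only [(hd _).deriv, sub_self, intervalIntegral.integral_same, neg_zero, mul_zero,
    zero_mul] at h
  calc _ = ∫ s in (0 : ℝ)..t, (∫ z in (0 : ℝ)..s, G z) * r (t - s) := by simp only [mul_comm]
    _ = _ := by
      rw [h, zero_sub, ← intervalIntegral.integral_neg]
      refine intervalIntegral.integral_congr_ae ?_
      filter_upwards [(hG 0 t).ae_hasDerivAt_integral] with s hs hst
      rw [(hs (uIoc_subset_uIcc hst) 0 (by simp)).deriv]
      ring

/-- The kernel `½ ∫_{|t - s|}^{2T - t - s} r` of the connecting operator appears as the difference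
of the responses at the times `t` and `2T - t` to a control `F` with `F' = G` odd with respect to
`T`. -/
theorem responseFun_sub_reflect (ρ : ℝ → ℝ) {r G : ℝ → ℝ} {T : ℝ} (hr : Continuous r)
    (hG : ∀ a b, IntervalIntegrable G volume a b)
    (hodd : ∀ᵐ s, s ∈ Ioo 0 (2 * T) → G (2 * T - s) = -G s) {t : ℝ} (ht : t ∈ Ioo 0 T)
    (hodd_t : G (2 * T - t) = -G t) :
    responseFun ρ r (fun t => ∫ s in (0 : ℝ)..t, G s) G t
      - responseFun ρ r (fun t => ∫ s in (0 : ℝ)..t, G s) G (2 * T - t)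
      = -2 * (ρ 0 ^ (1 / 2 : ℝ) * G t
        + ∫ s in (0 : ℝ)..T, (1 / 2 * ∫ η in |t - s|..(2 * T - t - s), r η) * G s) := by
  obtain ⟨ht0, htT⟩ := ht
  have hev : ∫ s in (0 : ℝ)..(2 * T - t), G s = ∫ s in (0 : ℝ)..t, G s := by
    refine integral_eq_of_odd hG ?_
    filter_upwards [hodd] with s hs hst
    rw [uIoc_of_le (by linarith)] at hst
    exact hs ⟨ht0.trans hst.1, by linarith [hst.2]⟩
  set P : ℝ → ℝ := fun z => ∫ s in (0 : ℝ)..z, r s with hP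
  have hPc : Continuous P :=
    intervalIntegral.continuous_primitive (fun a b => hr.intervalIntegrable a b) 0
  have hm1 : ∀ a b, IntervalIntegrable (fun s => P |t - s| * G s) volume a b := fun a b =>
    (hG a b).continuousOn_mul
      (hPc.comp (by fun_prop : Continuous fun s : ℝ => |t - s|)).continuousOn
  have hm2 : ∀ a b, IntervalIntegrable (fun s => P (2 * T - t - s) * G s) volume a b := fun a b =>
    (hG a b).continuousOn_mul
      (hPc.comp (by fun_prop : Continuous fun s : ℝ => 2 * T - t - s)).continuousOn
  -- the part of the late convolution over `(T, 2T - t)`, reflected to `(t, T)`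
  have hlate : ∫ s in T..(2 * T - t), P (2 * T - t - s) * G s
      = -∫ s in t..T, P (s - t) * G s := by
    have h := intervalIntegral.integral_comp_sub_left (fun s => P (2 * T - t - s) * G s) (2 * T)
      (a := t) (b := T)
    rw [show 2 * T - T = T by ring] at h
    rw [← h, ← intervalIntegral.integral_neg]
    refine intervalIntegral.integral_congr_ae ?_
    filter_upwards [hodd] with s hs hst
    rw [uIoc_of_le htT.le] at hst
    rw [hs ⟨ht0.trans hst.1, by linarith [hst.2]⟩, show 2 * T - t - (2 * T - s) = s - t by ring]
    ring
  have hsplit : ∫ s in (0 : ℝ)..T, P |t - s| * G s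
      = (∫ s in (0 : ℝ)..t, P (t - s) * G s) + ∫ s in t..T, P (s - t) * G s := by
    rw [← intervalIntegral.integral_add_adjacent_intervals (hm1 0 t) (hm1 t T)]
    congr 1
    · refine intervalIntegral.integral_congr fun s hs => ?_
      rw [uIcc_of_le ht0.le] at hs
      simp only [abs_of_nonneg (sub_nonneg.2 hs.2)]
    · refine intervalIntegral.integral_congr fun s hs => ?_
      rw [uIcc_of_le htT.le] at hs
      simp only [abs_of_nonpos (sub_nonpos.2 hs.1), neg_sub]
  have hker : ∫ s in (0 : ℝ)..T, (1 / 2 * ∫ η in |t - s|..(2 * T - t - s), r η) * G s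
      = 1 / 2 * ((∫ s in (0 : ℝ)..T, P (2 * T - t - s) * G s)
        - ∫ s in (0 : ℝ)..T, P |t - s| * G s) := by
    rw [← intervalIntegral.integral_sub (hm2 0 T) (hm1 0 T),
      ← intervalIntegral.integral_const_mul]
    refine intervalIntegral.integral_congr fun s _ => ?_
    simp only [hP]
    rw [← intervalIntegral.integral_interval_sub_left (hr.intervalIntegrable 0 (2 * T - t - s))
      (hr.intervalIntegrable 0 |t - s|)]
    ring
  have hconv := integral_mul_primitive hr hG
  have hadj := intervalIntegral.integral_add_adjacent_intervals (hm2 0 T)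
    (hm2 T (2 * T - t))
  simp only [responseFun, hconv, hev, hodd_t, hker, hsplit]
  change -(ρ 0 ^ (1 / 2 : ℝ)) * G t + _ + (∫ s in (0 : ℝ)..t, P (t - s) * G s)
    - (_ + _ + ∫ s in (0 : ℝ)..(2 * T - t), P (2 * T - t - s) * G s) = _
  rw [← hadj, hlate]
  ring

/-! ### The odd extension and its adjoint -/

theorem ae_and_reflect {T : ℝ} {p : ℝ → Prop}
    (h : ∀ᵐ t ∂(volume.restrict (Ioo (0 : ℝ) (2 * T))), p t) :
    ∀ᵐ t ∂(volume.restrict (Ioo (0 : ℝ) T)), p t ∧ p (2 * T - t) := by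
  have h1 := (ae_restrict_iff' measurableSet_Ioo).1 h
  have h2 := (Measure.measurePreserving_sub_left (volume : Measure ℝ)
    (2 * T)).quasiMeasurePreserving.ae h1
  filter_upwards [ae_restrict_of_ae h1, ae_restrict_of_ae h2,
    ae_restrict_mem measurableSet_Ioo] with t h1 h2 ht
  exact ⟨h1 ⟨ht.1, by linarith [ht.1, ht.2]⟩, h2 ⟨by linarith [ht.1, ht.2], by linarith [ht.1]⟩⟩

theorem coeFn_oddExt {T : ℝ} (f : OuterSpace T) :
    oddExt T f =ᵐ[volume.restrict (Ioo (0 : ℝ) (2 * T))] oddExtFun T f :=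
  (memLp_oddExtFun (Lp.memLp f)).coeFn_toLp

theorem ae_zeroExt_oddExt {T : ℝ} (f : OuterSpace T) :
    ∀ᵐ t ∂(volume.restrict (Ioo (0 : ℝ) T)), zeroExt (2 * T) (oddExt T f) t = f t ∧
      zeroExt (2 * T) (oddExt T f) (2 * T - t) = -f t := by
  filter_upwards [ae_and_reflect (coeFn_oddExt f), ae_restrict_mem measurableSet_Ioo] with t h ht
  have h1 : t ∈ Ioo 0 (2 * T) := ⟨ht.1, by linarith [ht.1, ht.2]⟩
  have h2 : 2 * T - t ∈ Ioo 0 (2 * T) := ⟨by linarith [ht.1, ht.2], by linarith [ht.1]⟩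
  rw [zeroExt, indicator_of_mem h1, indicator_of_mem h2, h.1, h.2]
  simp [oddExtFun, ht.2.le, show ¬ (2 * T - t ≤ T) by linarith [ht.2]]

theorem ae_zeroExt_oddExt_odd {T : ℝ} (f : OuterSpace T) :
    ∀ᵐ t, t ∈ Ioo 0 (2 * T) →
      zeroExt (2 * T) (oddExt T f) (2 * T - t) = -zeroExt (2 * T) (oddExt T f) t := by
  have h1 := (ae_restrict_iff' measurableSet_Ioo).1 (ae_zeroExt_oddExt f)
  have h2 := (Measure.measurePreserving_sub_left (volume : Measure ℝ)
    (2 * T)).quasiMeasurePreserving.ae h1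
  have hne : ∀ᵐ t : ℝ, t ≠ T := by simp [ae_iff, measure_singleton]
  filter_upwards [h1, h2, hne] with t h1 h2 hne ht
  rcases lt_or_gt_of_ne hne with h | h
  · obtain ⟨a, b⟩ := h1 ⟨ht.1, h⟩
    rw [a, b]
  · obtain ⟨a, b⟩ := h2 ⟨by linarith [ht.2], by linarith⟩
    rw [sub_sub_cancel] at b
    rw [a, b, neg_neg]

/-- The adjoint of the odd extension is `(S* h)(t) = h(t) - h(2T - t)`. -/
theorem inner_oddExt {T : ℝ} (hT : 0 < T) (h : OuterSpace (2 * T)) (g : OuterSpace T) :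
    inner ℝ h (oddExt T g) = ∫ t in Ioo 0 T, (h t - h (2 * T - t)) * g t := by
  have hint : IntegrableOn (fun t => h t * oddExt T g t) (Ioo 0 (2 * T)) := by
    have := L2.integrable_inner (𝕜 := ℝ) h (oddExt T g)
    refine Integrable.congr this (Eventually.of_forall fun t => ?_)
    simp only [RCLike.inner_apply, conj_trivial]
    ring
  have hii : IntervalIntegrable (fun t => h t * oddExt T g t) volume 0 (2 * T) := by
    rwa [intervalIntegrable_iff_integrableOn_Ioo_of_le (by linarith)]
  have hi1 : IntervalIntegrable (fun t => h t * oddExt T g t) volume 0 T :=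
    hii.mono_set (by rw [uIcc_of_le hT.le, uIcc_of_le (by linarith)]
                     exact Icc_subset_Icc_right (by linarith))
  have hi2 : IntervalIntegrable (fun t => h t * oddExt T g t) volume T (2 * T) :=
    hii.mono_set (by rw [uIcc_of_le (by linarith), uIcc_of_le (by linarith)]
                     exact Icc_subset_Icc_left hT.le)
  have hi3 : IntervalIntegrable (fun t => h (2 * T - t) * oddExt T g (2 * T - t)) volume 0 T := by
    have := (hi2.comp_sub_left (2 * T)).symm
    simpa [show 2 * T - T = T by ring] using this
  have hrefl := intervalIntegral.integral_comp_sub_left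
    (fun t => h t * oddExt T g t) (2 * T) (a := 0) (b := T)
  rw [sub_zero, show 2 * T - T = T by ring] at hrefl
  calc inner ℝ h (oddExt T g) = ∫ t in Ioo 0 (2 * T), h t * oddExt T g t := by
        rw [L2.inner_def]
        refine integral_congr_ae (Eventually.of_forall fun t => ?_)
        simp only [RCLike.inner_apply, conj_trivial]
        ring
    _ = (∫ t in (0 : ℝ)..T, h t * oddExt T g t)
        + ∫ t in (0 : ℝ)..T, h (2 * T - t) * oddExt T g (2 * T - t) := by
        rw [hrefl, intervalIntegral.integral_add_adjacent_intervals hi1 hi2,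
          intervalIntegral.integral_of_le (by linarith), integral_Ioc_eq_integral_Ioo]
    _ = ∫ t in Ioo 0 T, (h t * oddExt T g t + h (2 * T - t) * oddExt T g (2 * T - t)) := by
        rw [← intervalIntegral.integral_add hi1 hi3, intervalIntegral.integral_of_le hT.le,
          integral_Ioc_eq_integral_Ioo]
    _ = _ := by
        refine integral_congr_ae ?_
        filter_upwards [ae_zeroExt_oddExt g, ae_restrict_mem measurableSet_Ioo] with t h1 ht
        rw [zeroExt, indicator_of_mem (show t ∈ Ioo 0 (2 * T) from ⟨ht.1, by linarith [ht.1, ht.2]⟩),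
          indicator_of_mem (show 2 * T - t ∈ Ioo 0 (2 * T) from
            ⟨by linarith [ht.1, ht.2], by linarith [ht.1]⟩)] at h1
        rw [h1.1, h1.2]
        ring

/-! ### The connecting operator -/

/-- The operator `f ↦ α f + ∫₀ᵀ [½ ∫_{|t - s|}^{2T - t - s} r] f(s) ds` is bounded in
`L₂(0, T)`. -/
theorem exists_gram_operator (α : ℝ) {r : ℝ → ℝ} (hr : Continuous r) {T : ℝ} (hT : 0 < T) :
    ∃ K : OuterSpace T →L[ℝ] OuterSpace T, ∀ f : OuterSpace T,
      ∀ᵐ t ∂(volume.restrict (Ioo (0 : ℝ) T)), K f t = α * f t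
        + ∫ s in (0 : ℝ)..T, (1 / 2 * ∫ η in |t - s|..(2 * T - t - s), r η) * f s := by
  have hPc : Continuous fun z => ∫ s in (0 : ℝ)..z, r s :=
    intervalIntegral.continuous_primitive (fun a b => hr.intervalIntegrable a b) 0
  have hkc : Continuous fun p : ℝ × ℝ => 1 / 2 * ∫ η in |p.1 - p.2|..(2 * T - p.1 - p.2), r η := by
    have hsub : (fun p : ℝ × ℝ => 1 / 2 * ∫ η in |p.1 - p.2|..(2 * T - p.1 - p.2), r η)
        = fun p => 1 / 2 * ((∫ η in (0 : ℝ)..(2 * T - p.1 - p.2), r η)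
          - ∫ η in (0 : ℝ)..|p.1 - p.2|, r η) := funext fun p => by
      rw [intervalIntegral.integral_interval_sub_left (hr.intervalIntegrable 0 _)
        (hr.intervalIntegrable 0 _)]
    rw [hsub]
    exact continuous_const.mul ((hPc.comp (by fun_prop)).sub (hPc.comp (by fun_prop)))
  obtain ⟨C, hC⟩ := ((isCompact_Icc (a := 0) (b := T)).prod
    (isCompact_Icc (a := 0) (b := T))).exists_bound_of_continuousOn hkc.continuousOn
  set D : Set (ℝ × ℝ) := Ioo 0 T ×ˢ Ioo 0 T
  have hDm : MeasurableSet D := measurableSet_Ioo.prod measurableSet_Ioo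
  set k : ℝ × ℝ → ℝ :=
    D.indicator fun p => 1 / 2 * ∫ η in |p.1 - p.2|..(2 * T - p.1 - p.2), r η with hk
  have hkb : ∀ x y, |k (x, y)| ≤ max C 0 := by
    intro x y
    by_cases h : (x, y) ∈ D
    · rw [hk, indicator_of_mem h]
      exact (hC (x, y) ⟨Ioo_subset_Icc_self h.1, Ioo_subset_Icc_self h.2⟩).trans (le_max_left _ _)
    · rw [hk, indicator_of_notMem h, abs_zero]
      exact le_max_right _ _
  obtain ⟨A, hA⟩ := exists_integral_operator (μ := volume.restrict (Ioo (0 : ℝ) T))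
    (ν := volume.restrict (Ioo (0 : ℝ) T)) (k := fun x y => k (x, y))
    (hkc.measurable.indicator hDm) hkb
  refine ⟨α • ContinuousLinearMap.id ℝ _ + A, fun f => ?_⟩
  filter_upwards [hA f, ae_restrict_mem measurableSet_Ioo, Lp.coeFn_add (α • f) (A f),
    Lp.coeFn_smul α f] with t h1 ht h2 h3
  change (α • f + A f) t = _
  rw [h2, Pi.add_apply, h3, h1, Pi.smul_apply, smul_eq_mul, intervalIntegral.integral_of_le hT.le,
    integral_Ioc_eq_integral_Ioo]
  congr 1
  refine setIntegral_congr_fun measurableSet_Ioo fun s hs => ?_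
  have : (t, s) ∈ D := ⟨ht, hs⟩
  simp only [hk, indicator_of_mem this]

/-- The operator `K` of `exists_gram_operator` is `-½ S* R J S`; here `h` stands for `R J S f`. -/
theorem adjoint_oddExt_response (ρ : ℝ → ℝ) {r : ℝ → ℝ} (hr : Continuous r) {T : ℝ} (hT : 0 < T)
    {K : OuterSpace T →L[ℝ] OuterSpace T}
    (hK : ∀ f : OuterSpace T, ∀ᵐ t ∂(volume.restrict (Ioo (0 : ℝ) T)),
      K f t = ρ 0 ^ (1 / 2 : ℝ) * f t
        + ∫ s in (0 : ℝ)..T, (1 / 2 * ∫ η in |t - s|..(2 * T - t - s), r η) * f s)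
    (f : OuterSpace T) {h : OuterSpace (2 * T)}
    (hh : ∀ᵐ t ∂(volume.restrict (Ioo (0 : ℝ) (2 * T))),
      h t = responseFun ρ r (primitive (2 * T) (oddExt T f)) (zeroExt (2 * T) (oddExt T f)) t) :
    K f = -(1 / 2 : ℝ) • ContinuousLinearMap.adjoint (oddExt T) h := by
  refine ext_inner_right ℝ fun g => ?_
  rw [inner_smul_left, ContinuousLinearMap.adjoint_inner_left, inner_oddExt hT, L2.inner_def]
  simp only [map_neg, RCLike.conj_to_real]
  rw [← integral_const_mul]
  refine integral_congr_ae ?_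
  filter_upwards [hK f, ae_and_reflect hh, ae_zeroExt_oddExt f,
    ae_restrict_mem measurableSet_Ioo] with t h1 h2 h3 ht
  have hid := responseFun_sub_reflect ρ (G := zeroExt (2 * T) (oddExt T f)) hr
    (fun a b => (integrable_zeroExt (oddExt T f)).intervalIntegrable) (ae_zeroExt_oddExt_odd f) ht
    (by rw [h3.1, h3.2])
  change responseFun ρ r (primitive (2 * T) (oddExt T f)) _ _
    - responseFun ρ r (primitive (2 * T) (oddExt T f)) _ _ = _ at hid
  rw [h2.1, h2.2, hid, h1, h3.1]
  have hcongr : ∫ s in (0 : ℝ)..T, (1 / 2 * ∫ η in |t - s|..(2 * T - t - s), r η)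
        * zeroExt (2 * T) (oddExt T f) s
      = ∫ s in (0 : ℝ)..T, (1 / 2 * ∫ η in |t - s|..(2 * T - t - s), r η) * f s := by
    rw [intervalIntegral.integral_of_le hT.le, intervalIntegral.integral_of_le hT.le,
      integral_Ioc_eq_integral_Ioo, integral_Ioc_eq_integral_Ioo]
    refine integral_congr_ae ?_
    filter_upwards [ae_zeroExt_oddExt f] with s hs
    rw [hs.1]
  rw [hcongr]
  simp
  ring

/-- The connecting operator `W* W` is the operator `K` of `exists_gram_operator`. -/
theorem connectingOp_eq {ρ q : ℝ → ℝ} {w : ℝ → ℝ → ℝ} (hρ : ContDiffOn ℝ ∞ ρ (Ici 0))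
    (hpos : ∀ x, 0 ≤ x → 0 < ρ x)
    (hτ : Tendsto (eikonal ρ) atTop atTop) (hw : IsFundamentalKernel ρ q w) {T : ℝ} (hT : 0 < T)
    {W : OuterSpace T →L[ℝ] InnerSpace ρ T}
    (hW : ∀ (f : OuterSpace T) (F : ℝ → ℝ), f =ᵐ[volume.restrict (Ioo (0 : ℝ) T)] F →
      ∀ᵐ x ∂(innerMeasure ρ T), W f x = wave ρ w F x T)
    {K : OuterSpace T →L[ℝ] OuterSpace T}
    (hK : ∀ f : OuterSpace T, ∀ᵐ t ∂(volume.restrict (Ioo (0 : ℝ) T)),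
      K f t = ρ 0 ^ (1 / 2 : ℝ) * f t
        + ∫ s in (0 : ℝ)..T, (1 / 2 * ∫ η in |t - s|..(2 * T - t - s), responseKernel ρ w η) * f s) :
    connectingOp W = K := by
  have hr := (continuous_responseKernel hρ hpos hw).2
  -- the two quadratic forms agree on test functions
  have htest : ∀ (f g : ℝ → ℝ) (hfm : MemLp f 2 (volume.restrict (Ioo (0 : ℝ) T)))
      (hgm : MemLp g 2 (volume.restrict (Ioo (0 : ℝ) T))), ContDiff ℝ ∞ f → HasCompactSupport f →
      tsupport f ⊆ Ioo 0 T → ContDiff ℝ ∞ g → HasCompactSupport g → tsupport g ⊆ Ioo 0 T →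
      inner ℝ (connectingOp W (hfm.toLp f)) (hgm.toLp g)
        = inner ℝ (K (hfm.toLp f)) (hgm.toLp g) := by
    intro f g hfm hgm hf hfc hfs hg hgc hgs
    have hfT : ∀ t, T ≤ t → f t = 0 := fun t ht =>
      image_eq_zero_of_notMem_tsupport fun h => by linarith [(hfs h).2]
    have hG := oddExtFun_eq_sub hfT
    have hGc : Continuous (oddExtFun T f) := by
      have := hf.continuous
      rw [hG]; fun_prop
    have hodd : ∀ s, oddExtFun T f (2 * T - s) = -oddExtFun T f s := fun s => by rw [hG]; simp
    have hgram := integral_wave_mul_wave hρ hpos hτ hw hT hf hfc hfs hg hgc hgs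
    have hL : inner ℝ (connectingOp W (hfm.toLp f)) (hgm.toLp g)
        = ∫ x in (0 : ℝ)..eikonalInv ρ T, ρ x * (wave ρ w f x T * wave ρ w g x T) := by
      rw [connectingOp, ContinuousLinearMap.comp_apply, ContinuousLinearMap.adjoint_inner_left,
        L2.inner_def, ← integral_innerMeasure hρ hpos hτ hT]
      refine integral_congr_ae ?_
      filter_upwards [hW _ f hfm.coeFn_toLp, hW _ g hgm.coeFn_toLp] with x h1 h2
      rw [h1, h2]; simp [mul_comm]
    have hRt : inner ℝ (K (hfm.toLp f)) (hgm.toLp g)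
        = ∫ t in (0 : ℝ)..T, (ρ 0 ^ (1 / 2 : ℝ) * f t + ∫ s in (0 : ℝ)..T,
          (1 / 2 * ∫ η in |t - s|..(2 * T - t - s), responseKernel ρ w η) * f s) * g t := by
      rw [L2.inner_def, intervalIntegral.integral_of_le hT.le, integral_Ioc_eq_integral_Ioo]
      refine integral_congr_ae ?_
      filter_upwards [hK (hfm.toLp f), hfm.coeFn_toLp, hgm.coeFn_toLp] with t h1 h2 h3
      rw [h1, h2, h3, intervalIntegral.integral_of_le hT.le, intervalIntegral.integral_of_le hT.le,
        integral_Ioc_eq_integral_Ioo, integral_Ioc_eq_integral_Ioo,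
        integral_congr_ae (g := fun s => (1 / 2 * ∫ η in |t - s|..(2 * T - t - s),
          responseKernel ρ w η) * f s)]
      · simp [mul_comm]
      · filter_upwards [hfm.coeFn_toLp] with s hs
        rw [hs]
    have hP : ∫ t in (0 : ℝ)..T,
        (responseFun ρ (responseKernel ρ w) (fun t => ∫ s in (0 : ℝ)..t, oddExtFun T f s)
            (oddExtFun T f) t
          - responseFun ρ (responseKernel ρ w) (fun t => ∫ s in (0 : ℝ)..t, oddExtFun T f s)
            (oddExtFun T f) (2 * T - t)) * g t
        = -2 * ∫ t in (0 : ℝ)..T, (ρ 0 ^ (1 / 2 : ℝ) * f t + ∫ s in (0 : ℝ)..T,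
          (1 / 2 * ∫ η in |t - s|..(2 * T - t - s), responseKernel ρ w η) * f s) * g t := by
      rw [← intervalIntegral.integral_const_mul, intervalIntegral.integral_of_le hT.le,
        intervalIntegral.integral_of_le hT.le, integral_Ioc_eq_integral_Ioo,
        integral_Ioc_eq_integral_Ioo]
      refine setIntegral_congr_fun measurableSet_Ioo fun t ht => ?_
      have hle : ∀ s, s ≤ T → oddExtFun T f s = f s := fun s hs => by simp [oddExtFun, hs]
      rw [responseFun_sub_reflect ρ hr (fun a b => hGc.intervalIntegrable a b)
        (Eventually.of_forall fun s _ => hodd s) ht (hodd t), hle t ht.2.le,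
        intervalIntegral.integral_congr (g := fun s => (1 / 2 * ∫ η in |t - s|..(2 * T - t - s),
          responseKernel ρ w η) * f s)]
      · ring
      · intro s hs
        rw [uIcc_of_le hT.le] at hs
        simp only [hle s hs.2]
    rw [hL, hRt]
    rw [hP] at hgram
    linarith
  -- test functions are total
  have hzero : ∀ (f : ℝ → ℝ) (hfm : MemLp f 2 (volume.restrict (Ioo (0 : ℝ) T))), ContDiff ℝ ∞ f →
      HasCompactSupport f → tsupport f ⊆ Ioo 0 T → (connectingOp W - K) (hfm.toLp f) = 0 := by
    intro f hfm hf hfc hfs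
    refine eq_zero_of_inner_test _ fun g hgm hg hgc hgs => ?_
    rw [_root_.sub_apply, inner_sub_left, htest f g hfm hgm hf hfc hfs hg hgc hgs, sub_self]
  have hadj : ContinuousLinearMap.adjoint (connectingOp W - K) = 0 := by
    ext1 h
    refine eq_zero_of_inner_test _ fun g hgm hg hgc hgs => ?_
    rw [ContinuousLinearMap.adjoint_inner_left, hzero g hgm hg hgc hgs, inner_zero_right]
  have := (LinearIsometryEquiv.map_eq_zero_iff ContinuousLinearMap.adjoint).1 hadj
  exact sub_eq_zero.1 this

end DirichletWave

theorem theorem1 (ρ q : ℝ → ℝ) (T : ℝ)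
    (hρ : ContDiffOn ℝ ∞ ρ (Set.Ici 0)) (hρ_pos : ∀ x, 0 ≤ x → 0 < ρ x)
    (hq : ContDiffOn ℝ ∞ q (Set.Ici 0))
    (hτ : Filter.Tendsto (DirichletWave.eikonal ρ) Filter.atTop Filter.atTop)
    (hT : 0 < T) :
    (∃ w : ℝ → ℝ → ℝ, DirichletWave.IsFundamentalKernel ρ q w) ∧
    ∀ w : ℝ → ℝ → ℝ, DirichletWave.IsFundamentalKernel ρ q w →
      ∃ (W : DirichletWave.OuterSpace T →L[ℝ] DirichletWave.InnerSpace ρ T)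
        (R : DirichletWave.OuterSpace (2 * T) →ₗ.[ℝ] DirichletWave.OuterSpace (2 * T))
        (r : ℝ → ℝ),
        DirichletWave.IsControlOp ρ w T W ∧
        DirichletWave.IsExtendedResponseOp ρ w T R ∧
        DirichletWave.IsResponseKernel ρ T R r ∧
        (∀ t ∈ Set.Ioc 0 (2 * T), HasDerivWithinAt (fun x => w x t) (r t) (Set.Ici 0) 0) ∧
        (∀ f : DirichletWave.OuterSpace T,
          ∃ h : DirichletWave.integrationOp (2 * T) (DirichletWave.oddExt T f) ∈ R.domain,
            DirichletWave.connectingOp W f =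
              -(1 / 2 : ℝ) • ContinuousLinearMap.adjoint (DirichletWave.oddExt T)
                (R ⟨DirichletWave.integrationOp (2 * T) (DirichletWave.oddExt T f), h⟩)) ∧
        (∀ f : DirichletWave.OuterSpace T,
          ∀ᵐ t ∂(MeasureTheory.volume.restrict (Set.Ioo (0 : ℝ) T)),
            DirichletWave.connectingOp W f t =
              ρ 0 ^ (1 / 2 : ℝ) * f t
                + ∫ s in (0 : ℝ)..T,
                    (1 / 2 * ∫ η in |t - s|..(2 * T - t - s), r η) * f s) := by
  refine ⟨DirichletWave.exists_fundamentalKernel hρ hρ_pos hq hτ, fun w hw => ?_⟩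
  obtain ⟨hr, hrc⟩ := DirichletWave.continuous_responseKernel hρ hρ_pos hw
  obtain ⟨W, hW⟩ := DirichletWave.exists_control_operator hρ hρ_pos hτ hw hT
  obtain ⟨R, hdom, hR⟩ := DirichletWave.exists_response_operator ρ hrc (2 * T)
  obtain ⟨K, hK⟩ := DirichletWave.exists_gram_operator (ρ 0 ^ (1 / 2 : ℝ)) hrc hT
  have hC := DirichletWave.connectingOp_eq hρ hρ_pos hτ hw hT hW hK
  refine ⟨W, R, DirichletWave.responseKernel ρ w, fun f => hW f _ ?_,
    DirichletWave.isExtendedResponseOp_of_responseFun hρ hρ_pos hw hdom hR,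
    DirichletWave.isResponseKernel_of_responseFun (hr.mono Set.Icc_subset_Ici_self) hR,
    fun t ht => DirichletWave.hasDerivWithinAt_kernel hρ hρ_pos hw ht.1, fun f => ?_, fun f => ?_⟩
  · filter_upwards [ae_restrict_mem measurableSet_Ioo] with t ht
    rw [DirichletWave.zeroExt, Set.indicator_of_mem ht]
  · have hmem : DirichletWave.integrationOp (2 * T) (DirichletWave.oddExt T f) ∈ R.domain :=
      (hdom _).2 ⟨DirichletWave.oddExt T f, DirichletWave.hasL2Deriv_iff.2 rfl⟩
    refine ⟨hmem, ?_⟩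
    rw [hC]
    exact DirichletWave.adjoint_oddExt_response ρ hrc hT hK f
      (hR ⟨_, hmem⟩ (DirichletWave.oddExt T f) (DirichletWave.hasL2Deriv_iff.2 rfl))
  · rw [hC]
    exact hK f
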